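/- Let $\Omega\subset\mathbb R^4$ be a bounded open set, let $\rho,\tau\in\mathbb R$, and let $u:\overline\Omega\to\mathbb R$. Put $$A(\rho,u)_{ij}=-u_{ij}+\rho\,u_iu_j-\tfrac{\rho}{2}|\nabla u|^2\delta_{ij},$$ let $\sigma_k$ of a symmetric $4\times4$ matrix be the $k$-th elementary symmetric polynomial of its eigenvalues, and let $\Gamma_2^+$ be the set of symmetric matrices with $\sigma_1>0$ and $\sigma_2>0$. Let $K\in C^1(\Omega)$, let $f$ be a real function, and let $F$ be an antiderivative of $f$ on the range $u(\overline\Omega)$, that is $F'=f$ there, with $F(\tau)=0$. Suppose that $$\sigma_2(A(\rho,u))=K(x)f(u)\ \text{ and }\ A(\rho,u)\in\Gamma_2^+\ \text{ in }\Omega,\qquad u=\tau\ \text{ on }\partial\Omega,$$ and that $\left(K+\frac14\langle x,\nabla K\rangle\right)F(u)$ is integrable on $\Omega$ (this is automatic when $K\in C^1(\overline\Omega)$). Here $C^2(\overline\Omega)$ is the set of functions that are $C^2$ in $\Omega$, continuous on $\overline\Omega$, and whose derivatives of order at most $2$ extend continuously from $\Omega$ to $\overline\Omega$. A point $p\in\partial\Omega$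 is a regular ($C^2$) boundary point if near $p$ one has $\Omega=\{\varphi<0\}$ for a $C^2$ function $\varphi$ with $\varphi(p)=0$ and $\nabla\varphi(p)\neq0$; the boundary is almost $C^2$ if the set of its non-regular points has zero $3$-dimensional Hausdorff measure $\mathcal H^3$; it is smooth if every boundary point has such a $\varphi$ of class $C^\infty$. Assume that one of the following holds: 1. $\Omega$ has finite perimeter and almost $C^2$ boundary, and $u\in C^3(\Omega)\cap C^2(\overline\Omega)$; 2. $\Omega$ has smooth boundary, and $u\in C^2(\overline\Omega)$. Then the right-hand integrand below is $\mathcal H^3$-integrable on $\partial\Omega$, and $$\int_\Omega 8\left(K+\tfrac14\langle x,\nabla K\rangle\right)F(u)\,dx=\int_{\partial\Omega}\left(-\tfrac34\rho|\nabla u|^4\langle x,\nu\rangle+\tfrac23H|\nabla u|^3\langle x,\nu\rangle\right)d\mathcal H^3,$$ where, at the regular points of $\partial\Omega$, $\nu$ is the unit outward normal and $H$ is the mean curvature, i.e. the sum of the principal curvatures with respect to $-\nu$ (so that $H=3$ for the unit ball). On $\partial\Omega$, $\nabla u$ denotes the continuous extension of the gradient, and $\mathcal H^3$ is normalized so as to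 agree with the hypersurface area. -/

import Mathlib

open Set Filter MeasureTheory
open scoped Topology ContDiff MeasureTheory

/-- Euclidean space `ℝ⁴`. -/
abbrev E4 : Type := EuclideanSpace ℝ (Fin 4)

/-- The partial derivative `∂v/∂xⁱ`. -/
noncomputable def pderiv (i : Fin 4) (v : E4 → ℝ) (x : E4) : ℝ :=
  fderiv ℝ v x (EuclideanSpace.single i 1)

/-- The divergence `∑ ∂Tⁱ/∂xⁱ` of a vector field on `ℝ⁴`. -/
noncomputable def divergence (T : E4 → E4) (x : E4) : ℝ :=
  ∑ i, pderiv i (fun y => T y i) x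

/-- The tensor `A(ρ,u)ᵢⱼ = -uᵢⱼ + ρ uᵢ uⱼ - (ρ/2) |∇u|² δᵢⱼ`. -/
noncomputable def tensorA (ρ : ℝ) (u : E4 → ℝ) (x : E4) : Matrix (Fin 4) (Fin 4) ℝ :=
  Matrix.of fun i j =>
    -pderiv i (pderiv j u) x + ρ * (pderiv i u x * pderiv j u x)
      - ρ / 2 * ‖gradient u x‖ ^ 2 * (if i = j then 1 else 0)

/-- `σ_k(A)`: the `k`-th elementary symmetric polynomial of the eigenvalues of the matrix `A`, which
are the roots of its characteristic polynomial with multiplicity (a real symmetric matrix has all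
its eigenvalues in `ℝ`). -/
noncomputable def sigma (k : ℕ) (A : Matrix (Fin 4) (Fin 4) ℝ) : ℝ :=
  A.charpoly.roots.esymm k

/-- The cone `Γ₂⁺` of symmetric matrices with `σ₁ > 0` and `σ₂ > 0`. -/
def GammaTwoPos : Set (Matrix (Fin 4) (Fin 4) ℝ) :=
  {A | A.IsSymm ∧ 0 < sigma 1 A ∧ 0 < sigma 2 A}

/-- `u ∈ C^k(Ω̄)`: `u` is `C^k` in the open set `Ω`, continuous on `Ω̄`, and all its derivatives of
order at most `k` in `Ω` extend continuously to `Ω̄`. -/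
def IsCkUpToBoundary (k : ℕ) (Ω : Set E4) (u : E4 → ℝ) : Prop :=
  ContDiffOn ℝ k u Ω ∧ ContinuousOn u (closure Ω) ∧
    ∀ m ≤ k, ∃ g : E4 → ContinuousMultilinearMap ℝ (fun _ : Fin m => E4) ℝ,
      ContinuousOn g (closure Ω) ∧ EqOn g (iteratedFDeriv ℝ m u) Ω

/-- `φ` is a `C^n` defining function of `Ω` near `x`: `φ(x) = 0`, `∇φ(x) ≠ 0` and `Ω = {φ < 0}`
near `x`. (A defining function that is only given near `x` can be cut off to a global one.) -/
structure IsLocalDefiningFunction (n : ℕ∞) (Ω : Set E4) (x : E4) (φ : E4 → ℝ) : Prop where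
  contDiff : ContDiff ℝ n φ
  eq_zero : φ x = 0
  gradient_ne_zero : gradient φ x ≠ 0
  mem_iff : ∀ᶠ y in 𝓝 x, y ∈ Ω ↔ φ y < 0

/-- The part of `∂Ω` near which `∂Ω` is a `C^n` hypersurface bounding `Ω`. -/
def regularBoundary (n : ℕ∞) (Ω : Set E4) : Set E4 :=
  {x ∈ frontier Ω | ∃ φ, IsLocalDefiningFunction n Ω x φ}

/-- `Ω` has almost `C²` boundary: the singular part of `∂Ω` is a null set for the three-dimensional
Hausdorff measure. -/
def HasAlmostC2Boundary (Ω : Set E4) : Prop :=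
  (μHE[3] : Measure E4) (frontier Ω \ regularBoundary 2 Ω) = 0

/-- `Ω` has smooth boundary. -/
def HasSmoothBoundary (Ω : Set E4) : Prop :=
  frontier Ω ⊆ regularBoundary ⊤ Ω

/-- `Ω` has finite perimeter: the integrals over `Ω` of the divergences of compactly supported `C¹`
vector fields bounded by `1` are bounded above. -/
def HasFinitePerimeter (Ω : Set E4) : Prop :=
  ∃ C : ℝ, ∀ T : E4 → E4, ContDiff ℝ 1 T → HasCompactSupport T → (∀ x, ‖T x‖ ≤ 1) →
    ∫ x in Ω, divergence T x ≤ C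

/-- The unit normal field `∇φ/|∇φ|` of the level sets of `φ`. -/
noncomputable def levelNormal (φ : E4 → ℝ) (x : E4) : E4 :=
  ‖gradient φ x‖⁻¹ • gradient φ x

open Classical in
/-- The unit outward normal `ν` of `∂Ω` at the points of its `C²` part (`0` elsewhere); it does not
depend on the defining function. -/
noncomputable def outwardNormal (Ω : Set E4) (x : E4) : E4 :=
  if h : ∃ φ, IsLocalDefiningFunction 2 Ω x φ then levelNormal h.choose x else 0

open Classical in
/-- The mean curvature `H` of `∂Ω` at the points of its `C²` part (`0` elsewhere): the trace of the
second fundamental form with respect to `-ν`, i.e. the sum of the three principal curvatures, which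
is the divergence of the unit normal field; it does not depend on the defining function. The unit
sphere, as boundary of the ball, has `H = 3`. -/
noncomputable def meanCurvature (Ω : Set E4) (x : E4) : ℝ :=
  if h : ∃ φ, IsLocalDefiningFunction 2 Ω x φ then divergence (levelNormal h.choose) x else 0

/-- The continuous extension of `∇u` from `Ω` to `Ω̄`. -/
noncomputable def gradUpToBoundary (Ω : Set E4) (u : E4 → ℝ) : E4 → E4 :=
  extendFrom Ω (gradient u)

/-!
Write `p = ∇u` and `Q = D²u`. The proof is a Pohozaev identity. The vector field `pohozaevFlux`
has divergence `2 σ₂(A(ρ,u)) ⟨x, ∇u⟩`. As `u` need only be `C²`, its third derivatives are not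
available and the divergence is understood weakly, by pairing with test functions: the second
order part of the field is a sum of terms `a (∂_w b v - ∂_v b w)` with `a` and `b` of class `C¹`,
whose weak divergence is `∂_v a ∂_w b - ∂_w a ∂_v b` (`isWeakDiv_null_lagrangian`). In dimension
four the terms of `σ₂(A(ρ,u))` of degree four in `∇u` cancel (`sigma_two_expand`), which is why
the identity closes up (`isWeakDiv_pohozaevFlux`).

*Interior side.* Since `σ₁(A) > 0`, the function `u` has no interior minimum, so `u > τ` in `Ω`.
As `K f(u) = σ₂(A) > 0`, neither `K` nor `f(u)` vanishes in `Ω`, and by Rolle's theorem neither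
does `F(u)`. Hence `{F(u) = 0}` is the boundary, cutoffs in the values of `F(u)` are compactly
supported in `Ω`, and the divergence of `K F(u) x` integrates to zero without any regularity of
the boundary. The result is `∫ 8 (K + ¼⟨x, ∇K⟩) F(u) = -∫ 2 σ₂(A) ⟨x, ∇u⟩`
(`integral_curvature_eq_neg_integral_sigma_two`).

*Divergence theorem.* A continuous field with a weak divergence satisfies the divergence theorem
on `Ω` (`integral_eq_integral_frontier_inner`). In a chart where `Ω` lies below a graph of slope
at most `ε`, testing with cutoffs in the depth under the graph gives the boundary term as an
integral over the parameters. There area and parameter volume agree up to a factor `(1 + ε)³`, by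
Lipschitz bounds alone, so the identity holds up to a multiple of `ε`
(`IsGraphChart.abs_flux_sub_le`). A partition of unity and `ε → 0` remove the error
(`integral_eq_flux`), without the area formula. The regular boundary has finite area: it is
compact if the boundary is smooth, and otherwise its area is bounded by the perimeter
(`measure_regularBoundary_lt_top`). The singular part is `ℋ³`-null and compact, so it has cutoffs
whose gradients tend to zero in `L¹` (`exists_cutoff_of_measure_zero`).

*Boundary side.* On the regular boundary `∇u = -|∇u| ν` (`eq_neg_norm_smul_outwardNormal`), and
differentiating this along the boundary gives `tr D²u - ⟨D²u ν, ν⟩ = -|∇u| H`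
(`trace_sub_inner_eq`). These two facts turn the normal component of the flux into minus the
boundary integrand (`boundary_integrand_eq`).
-/

/-! ### Weak divergence -/

theorem contDiff_of_contDiffOn_of_tsupport_subset {E G : Type*} [NormedAddCommGroup E]
    [NormedSpace ℝ E] [NormedAddCommGroup G] [NormedSpace ℝ G] {n : WithTop ℕ∞} {f : E → G}
    {Ω : Set E} (hΩ : IsOpen Ω) (hf : ContDiffOn ℝ n f Ω) (h : tsupport f ⊆ Ω) :
    ContDiff ℝ n f := by
  rw [contDiff_iff_contDiffAt]
  intro x
  by_cases hx : x ∈ tsupport f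
  · exact hf.contDiffAt (hΩ.mem_nhds (h hx))
  · exact (contDiffAt_const (c := (0 : G))).congr_of_eventuallyEq
      (notMem_tsupport_iff_eventuallyEq.mp hx)

theorem continuous_of_continuousOn_of_tsupport_subset {X G : Type*} [TopologicalSpace X]
    [TopologicalSpace G] [Zero G] {f : X → G} {Ω : Set X} (hΩ : IsOpen Ω)
    (hf : ContinuousOn f Ω) (h : tsupport f ⊆ Ω) : Continuous f :=
  continuous_of_tsupport fun _ hx => hf.continuousAt (hΩ.mem_nhds (h hx))

theorem exists_contDiff_one_nhds_of_isCompact {E : Type*}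
    [NormedAddCommGroup E] [InnerProductSpace ℝ E] [FiniteDimensional ℝ E] {K U : Set E}
    (hK : IsCompact K) (hU : IsOpen U) (h : K ⊆ U) :
    ∃ χ : E → ℝ, ContDiff ℝ ∞ χ ∧ HasCompactSupport χ ∧ tsupport χ ⊆ U ∧
      (∀ᶠ x in 𝓝ˢ K, χ x = 1) ∧ ∀ x, χ x ∈ Icc (0 : ℝ) 1 := by
  obtain ⟨L, hL, hKL, hLU⟩ := exists_compact_between hK hU h
  obtain ⟨f, h1, h0, hf⟩ := exists_contMDiffMap_one_nhds_of_subset_interior (n := ⊤)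
    (modelWithCornersSelf ℝ E) hK.isClosed hKL
  have hsupp : tsupport f ⊆ L :=
    closure_minimal (Function.support_subset_iff'.2 h0) hL.isClosed
  exact ⟨f, f.contMDiff.contDiff, hL.of_isClosed_subset isClosed_closure hsupp,
    hsupp.trans hLU, h1, hf⟩

section WeakDivergence

variable {E : Type*} [NormedAddCommGroup E] [InnerProductSpace ℝ E] [FiniteDimensional ℝ E]
  [MeasurableSpace E] [BorelSpace E]

/-- The continuous vector field `V` on `Ω` has weak divergence `g`, a continuous function on `Ω`:
`∫ (η g + ⟨∇η, V⟩) = 0` for every test function `η ∈ C¹_c(Ω)`. -/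
structure IsWeakDiv (Ω : Set E) (V : E → E) (g : E → ℝ) : Prop where
  continuousOn_field : ContinuousOn V Ω
  continuousOn_div : ContinuousOn g Ω
  integral_eq_zero : ∀ η : E → ℝ, ContDiff ℝ 1 η → HasCompactSupport η → tsupport η ⊆ Ω →
    ∫ x, (η x * g x + fderiv ℝ η x (V x)) = 0

theorem integral_fderiv_eq_zero {c : E → ℝ} (hc : ContDiff ℝ 1 c) (hs : HasCompactSupport c)
    (v : E) : ∫ x, fderiv ℝ c x v = 0 := by
  have h1 : Continuous fun x => fderiv ℝ c x v :=
    (hc.continuous_fderiv one_ne_zero).clm_apply continuous_const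
  have h := integral_mul_fderiv_eq_neg_fderiv_mul_of_integrable (μ := (volume : Measure E))
    (f := fun _ => (1 : ℝ)) (g := c) (v := v) (by simp)
    (by simpa using h1.integrable_of_hasCompactSupport (hs.fderiv_apply (𝕜 := ℝ) v))
    (by simpa using hc.continuous.integrable_of_hasCompactSupport hs) (by simp)
    (fun x _ => (hc.differentiable one_ne_zero) x)
  simpa using h

theorem integrable_test_pairing {Ω : Set E} (hΩ : IsOpen Ω) {V : E → E} {g η : E → ℝ}
    (hV : ContinuousOn V Ω) (hg : ContinuousOn g Ω) (hη : ContDiff ℝ 1 η)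
    (hc : HasCompactSupport η) (hs : tsupport η ⊆ Ω) :
    Integrable (fun x => η x * g x) ∧ Integrable fun x => fderiv ℝ η x (V x) := by
  have hsub : tsupport (fun x => η x * g x) ⊆ tsupport η :=
    closure_mono (Function.support_subset_iff'.2 fun x hx => by
      simp [Function.notMem_support.1 hx])
  have hsub' : tsupport (fun x => fderiv ℝ η x (V x)) ⊆ tsupport η := by
    refine closure_minimal (Function.support_subset_iff'.2 fun x hx => ?_) isClosed_closure
    simp [fderiv_of_notMem_tsupport ℝ hx]
  constructor
  · refine Continuous.integrable_of_hasCompactSupport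
      (continuous_of_continuousOn_of_tsupport_subset hΩ
        (hη.continuous.continuousOn.mul hg) (hsub.trans hs)) ?_
    exact hc.mono' (subset_closure.trans hsub)
  · refine Continuous.integrable_of_hasCompactSupport
      (continuous_of_continuousOn_of_tsupport_subset hΩ
        ((hη.continuous_fderiv one_ne_zero).continuousOn.clm_apply hV) (hsub'.trans hs)) ?_
    exact hc.mono' (subset_closure.trans hsub')

namespace IsWeakDiv

variable {Ω : Set E} {V W : E → E} {g h : E → ℝ}

theorem zero : IsWeakDiv Ω (fun _ => (0 : E)) (fun _ => (0 : ℝ)) :=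
  ⟨continuousOn_const, continuousOn_const, fun η _ _ _ => by simp⟩

theorem add (hΩ : IsOpen Ω) (hV : IsWeakDiv Ω V g) (hW : IsWeakDiv Ω W h) :
    IsWeakDiv Ω (fun x => V x + W x) (fun x => g x + h x) := by
  refine ⟨hV.1.add hW.1, hV.2.add hW.2, fun η hη hc hs => ?_⟩
  obtain ⟨a1, a2⟩ := integrable_test_pairing hΩ hV.1 hV.2 hη hc hs
  obtain ⟨b1, b2⟩ := integrable_test_pairing hΩ hW.1 hW.2 hη hc hs
  have := integral_add (a1.add a2) (b1.add b2)
  simp only [Pi.add_apply] at this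
  rw [hV.3 η hη hc hs, hW.3 η hη hc hs, add_zero] at this
  rw [← this]
  congr 1; ext x; simp only [map_add]; ring

theorem sum (hΩ : IsOpen Ω) {ι : Type*} (s : Finset ι) {V : ι → E → E} {g : ι → E → ℝ}
    (hV : ∀ i ∈ s, IsWeakDiv Ω (V i) (g i)) :
    IsWeakDiv Ω (fun x => ∑ i ∈ s, V i x) (fun x => ∑ i ∈ s, g i x) := by
  classical
  induction s using Finset.induction_on with
  | empty => simpa using zero
  | insert i s hi ih =>
    simp only [Finset.sum_insert hi]
    exact (hV i (by simp)).add hΩ (ih fun j hj => hV j (by simp [hj]))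

theorem const_smul (hV : IsWeakDiv Ω V g) (c : ℝ) :
    IsWeakDiv Ω (fun x => c • V x) (fun x => c * g x) := by
  refine ⟨hV.1.const_smul c, continuousOn_const.mul hV.2, fun η hη hc hs => ?_⟩
  have := hV.3 η hη hc hs
  rw [← mul_zero c, ← this, ← integral_const_mul]
  congr 1; ext x; simp only [map_smul, smul_eq_mul]; ring

theorem congr (hV : IsWeakDiv Ω V g) (h1 : EqOn W V Ω) (h2 : EqOn h g Ω) : IsWeakDiv Ω W h := by
  refine ⟨hV.1.congr h1, hV.2.congr h2, fun η hη hc hs => ?_⟩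
  rw [← hV.3 η hη hc hs]
  congr 1; ext x
  by_cases hx : x ∈ tsupport η
  · rw [h1 (hs hx), h2 (hs hx)]
  · simp [fderiv_of_notMem_tsupport ℝ hx, image_eq_zero_of_notMem_tsupport hx]

/-- A `C¹` field `a v` with constant direction `v` has weak divergence `∂_v a`. -/
theorem of_contDiffOn (hΩ : IsOpen Ω) {a : E → ℝ} (ha : ContDiffOn ℝ 1 a Ω) (v : E) :
    IsWeakDiv Ω (fun x => a x • v) (fun x => fderiv ℝ a x v) := by
  have hda := ha.continuousOn_fderiv_of_isOpen hΩ le_rfl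
  refine ⟨ha.continuousOn.smul continuousOn_const, hda.clm_apply continuousOn_const,
    fun η hη hc hs => ?_⟩
  have hsub : tsupport (fun x => η x * a x) ⊆ tsupport η := tsupport_mul_subset_left
  have h := integral_fderiv_eq_zero (contDiff_of_contDiffOn_of_tsupport_subset hΩ
    (hη.contDiffOn.mul ha) (hsub.trans hs)) (hc.mono' (subset_closure.trans hsub)) v
  rw [← h]
  congr 1; ext x
  by_cases hx : x ∈ tsupport η
  · have hax := (ha.contDiffAt (hΩ.mem_nhds (hs hx))).differentiableAt one_ne_zero
    rw [fderiv_fun_mul (hη.differentiable one_ne_zero x) hax]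
    simp
  · rw [fderiv_of_notMem_tsupport ℝ hx, image_eq_zero_of_notMem_tsupport hx,
      fderiv_of_notMem_tsupport ℝ fun h' => hx (hsub h')]
    simp

end IsWeakDiv

/-- `∫ ∂_v c ∂_w b = ∫ ∂_w c ∂_v b` for compactly supported `C¹` functions. Second derivatives need
not exist: one derivative is replaced by difference quotients. -/
theorem integral_fderiv_mul_fderiv_comm {b c : E → ℝ} (hb : ContDiff ℝ 1 b)
    (hbs : HasCompactSupport b) (hc : ContDiff ℝ 1 c) (hcs : HasCompactSupport c) (v w : E) :
    ∫ x, fderiv ℝ c x v * fderiv ℝ b x w = ∫ x, fderiv ℝ c x w * fderiv ℝ b x v := by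
  obtain ⟨B, hB⟩ := hb.lipschitzWith_of_hasCompactSupport hbs one_ne_zero
  obtain ⟨C, hC⟩ := hc.lipschitzWith_of_hasCompactSupport hcs one_ne_zero
  have cb : ∀ z, Continuous fun x => fderiv ℝ b x z := fun z =>
    (hb.continuous_fderiv one_ne_zero).clm_apply continuous_const
  have cc : ∀ z, Continuous fun x => fderiv ℝ c x z := fun z =>
    (hc.continuous_fderiv one_ne_zero).clm_apply continuous_const
  have ld : ∀ {f : E → ℝ}, ContDiff ℝ 1 f → ∀ z x, lineDeriv ℝ f x z = fderiv ℝ f x z :=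
    fun hf z x => (hf.differentiable one_ne_zero x).lineDeriv_eq_fderiv
  have L1 := hC.integral_inv_smul_sub_mul_tendsto_integral_lineDeriv_mul' (μ := volume) hcs
    (cb w) v
  have L2 := hB.integral_inv_smul_sub_mul_tendsto_integral_lineDeriv_mul' (μ := volume) hbs
    (cc w) (-v)
  simp only [ld hc, ld hb, map_neg] at L1 L2
  have L3 : Tendsto (fun t : ℝ => ∫ x, (t⁻¹ • (c (x + t • v) - c x)) * fderiv ℝ b x w) (𝓝[>] 0)
      (𝓝 (-∫ x, -(fderiv ℝ b x v) * fderiv ℝ c x w)) := by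
    refine L2.neg.congr fun t => ?_
    have ibp : ∀ z : E, ∫ x, c (x + z) * fderiv ℝ b x w = -∫ x, b (x - z) * fderiv ℝ c x w := by
      intro z
      have e1 : ∫ x, c (x + z) * fderiv ℝ b x w = ∫ x, c x * fderiv ℝ b (x - z) w := by
        rw [← integral_sub_right_eq_self (fun x => c (x + z) * fderiv ℝ b x w) z]
        simp
      have hbz : ContDiff ℝ 1 fun x => b (x - z) := hb.comp (contDiff_id.sub contDiff_const)
      have e2 : ∀ x, fderiv ℝ (fun x => b (x - z)) x w = fderiv ℝ b (x - z) w := fun x => by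
        rw [fderiv_comp_sub]
      have hcb : ∀ {f1 f2 : E → ℝ}, Continuous f1 → Continuous f2 → HasCompactSupport f1 →
          Integrable fun x => f1 x * f2 x := fun h1 h2 h3 =>
        (h1.mul h2).integrable_of_hasCompactSupport h3.mul_right
      have := integral_mul_fderiv_eq_neg_fderiv_mul_of_integrable (μ := (volume : Measure E))
        (f := c) (g := fun x => b (x - z)) (v := w)
        (hcb (cc w) hbz.continuous (hcs.fderiv_apply (𝕜 := ℝ) w))
        (hcb hc.continuous (by
          simp only [e2]; exact (cb w).comp (continuous_id.sub continuous_const)) hcs)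
        (hcb hc.continuous hbz.continuous hcs)
        (fun x _ => hc.differentiable one_ne_zero x) (fun x _ => hbz.differentiable one_ne_zero x)
      simp only [e2] at this
      rw [e1, this]
      congr 2; ext x; ring
    have i1 : ∀ z : E, Integrable fun x => c (x + z) * fderiv ℝ b x w := fun z =>
      ((hc.continuous.comp (continuous_id.add continuous_const)).mul (cb w)
        ).integrable_of_hasCompactSupport (hbs.fderiv_apply (𝕜 := ℝ) w).mul_left
    have i2 : ∀ z : E, Integrable fun x => b (x - z) * fderiv ℝ c x w := fun z =>
      ((hb.continuous.comp (continuous_id.sub continuous_const)).mul (cc w)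
        ).integrable_of_hasCompactSupport (hcs.fderiv_apply (𝕜 := ℝ) w).mul_left
    have A1 : ∫ x, (t⁻¹ • (c (x + t • v) - c x)) * fderiv ℝ b x w
        = t⁻¹ * ((∫ x, c (x + t • v) * fderiv ℝ b x w) - ∫ x, c (x + 0) * fderiv ℝ b x w) := by
      rw [← integral_sub (i1 _) (i1 _), ← integral_const_mul]
      congr 1; ext x; simp; ring
    have A2 : ∫ x, (t⁻¹ • (b (x + t • -v) - b x)) * fderiv ℝ c x w
        = t⁻¹ * ((∫ x, b (x - t • v) * fderiv ℝ c x w) - ∫ x, b (x - 0) * fderiv ℝ c x w) := by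
      rw [← integral_sub (i2 _) (i2 _), ← integral_const_mul]
      congr 1; ext x; simp [← sub_eq_add_neg]; ring
    rw [A1, A2, ibp, ibp]; ring
  have := tendsto_nhds_unique L1 L3
  rw [this, ← integral_neg]
  congr 1; ext x; ring

/-- The field `a (∂_w b v - ∂_v b w)` has weak divergence `∂_v a ∂_w b - ∂_w a ∂_v b`, although `b`
need only be `C¹`. -/
theorem isWeakDiv_null_lagrangian {Ω : Set E} (hΩ : IsOpen Ω) {a b : E → ℝ}
    (ha : ContDiffOn ℝ 1 a Ω) (hb : ContDiffOn ℝ 1 b Ω) (v w : E) :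
    IsWeakDiv Ω (fun x => a x • (fderiv ℝ b x w • v - fderiv ℝ b x v • w))
      (fun x => fderiv ℝ a x v * fderiv ℝ b x w - fderiv ℝ a x w * fderiv ℝ b x v) := by
  have hda := ha.continuousOn_fderiv_of_isOpen hΩ le_rfl
  have hdb := hb.continuousOn_fderiv_of_isOpen hΩ le_rfl
  have ca : ∀ z, ContinuousOn (fun x => fderiv ℝ a x z) Ω := fun z =>
    hda.clm_apply continuousOn_const
  have cb : ∀ z, ContinuousOn (fun x => fderiv ℝ b x z) Ω := fun z =>
    hdb.clm_apply continuousOn_const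
  refine ⟨ha.continuousOn.smul (((cb w).smul continuousOn_const).sub
    ((cb v).smul continuousOn_const)), ((ca v).mul (cb w)).sub ((ca w).mul (cb v)),
    fun η hη hc hs => ?_⟩
  obtain ⟨χ, hχ, hχc, hχs, hχ1, -⟩ := exists_contDiff_one_nhds_of_isCompact hc hΩ hs
  have hsub : tsupport (fun x => η x * a x) ⊆ tsupport η := tsupport_mul_subset_left
  have hsub' : tsupport (fun x => χ x * b x) ⊆ tsupport χ := tsupport_mul_subset_left
  have Hc := contDiff_of_contDiffOn_of_tsupport_subset hΩ
    (hη.contDiffOn.mul ha) (hsub.trans hs)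
  have Hb := contDiff_of_contDiffOn_of_tsupport_subset hΩ
    ((hχ.of_le (by norm_cast)).contDiffOn.mul hb) (hsub'.trans hχs)
  have Hcs : HasCompactSupport fun x => η x * a x := hc.mono' (subset_closure.trans hsub)
  have Hbs : HasCompactSupport fun x => χ x * b x := hχc.mono' (subset_closure.trans hsub')
  have key := integral_fderiv_mul_fderiv_comm Hb Hbs Hc Hcs v w
  have int : ∀ z z', Integrable fun x =>
      fderiv ℝ (fun x => η x * a x) x z * fderiv ℝ (fun x => χ x * b x) x z' := fun z z' =>
    (((Hc.continuous_fderiv one_ne_zero).clm_apply continuous_const).mul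
      ((Hb.continuous_fderiv one_ne_zero).clm_apply
        continuous_const)).integrable_of_hasCompactSupport (Hcs.fderiv_apply (𝕜 := ℝ) z).mul_right
  rw [← sub_eq_zero, ← integral_sub (int _ _) (int _ _)] at key
  rw [← key]
  congr 1; ext x
  by_cases hx : x ∈ tsupport η
  · have hax := (ha.contDiffAt (hΩ.mem_nhds (hs hx))).differentiableAt one_ne_zero
    have hbx : (fun x => χ x * b x) =ᶠ[𝓝 x] b := by
      filter_upwards [(eventually_nhdsSet_iff_forall.1 hχ1) x hx] with y hy
      simp [hy]
    rw [fderiv_fun_mul (hη.differentiable one_ne_zero x) hax, hbx.fderiv_eq]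
    simp; ring
  · rw [fderiv_of_notMem_tsupport ℝ hx, image_eq_zero_of_notMem_tsupport hx,
      fderiv_of_notMem_tsupport ℝ fun h' => hx (hsub h')]
    simp

end WeakDivergence

/-! ### The algebra of `σ₁` and `σ₂` -/

theorem sigma_one_of_isSymm {A : Matrix (Fin 4) (Fin 4) ℝ} (hA : A.IsSymm) :
    sigma 1 A = A.trace := by
  have hH : A.IsHermitian := by
    rwa [Matrix.IsHermitian, Matrix.conjTranspose_eq_transpose_of_trivial]
  rw [hH.trace_eq_sum_eigenvalues, sigma, hH.roots_charpoly_eq_eigenvalues]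
  simp [Multiset.esymm, Multiset.powersetCard_one, Finset.sum]

theorem sigma_two_of_isSymm {A : Matrix (Fin 4) (Fin 4) ℝ} (hA : A.IsSymm) :
    sigma 2 A = (A.trace ^ 2 - ∑ i, ∑ j, A i j ^ 2) / 2 := by
  have hH : A.IsHermitian := by
    rwa [Matrix.IsHermitian, Matrix.conjTranspose_eq_transpose_of_trivial]
  have hsq : ∑ i, ∑ j, A i j ^ 2 = ∑ i, hH.eigenvalues i ^ 2 := by
    have h1 : (A * A).trace = ∑ i, ∑ j, A i j ^ 2 := by
      simp only [Matrix.trace, Matrix.diag_apply, Matrix.mul_apply]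
      refine Finset.sum_congr rfl fun i _ => Finset.sum_congr rfl fun j _ => ?_
      rw [hA.apply i j]; ring
    have h2 : (A * A).trace = ∑ i, hH.eigenvalues i ^ 2 := by
      have h3 := hH.spectral_theorem
      set D : Matrix (Fin 4) (Fin 4) ℝ := Matrix.diagonal (RCLike.ofReal ∘ hH.eigenvalues)
      have h4 : A * A = Unitary.conjStarAlgAut ℝ _ hH.eigenvectorUnitary (D * D) := by
        rw [map_mul, ← h3]
      rw [h4, Unitary.conjStarAlgAut_apply, Matrix.trace_mul_comm, ← mul_assoc]
      simp [D, Matrix.trace, sq]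
    rw [← h1, h2]
  rw [hsq, hH.trace_eq_sum_eigenvalues, sigma, hH.roots_charpoly_eq_eigenvalues]
  have : (Finset.univ : Finset (Fin 4)).val = {0, 1, 2, 3} := rfl
  rw [this]
  simp only [Fin.sum_univ_four, Multiset.insert_eq_cons, Multiset.map_cons,
    Multiset.map_singleton, Multiset.esymm]
  simp [Multiset.powersetCard_cons, Multiset.powersetCard_one, Multiset.powersetCard_zero_left,
    ← Multiset.cons_zero]
  ring

/-! ### Partial derivatives -/

theorem gradient_apply_eq_pderiv (v : E4 → ℝ) (x : E4) (i : Fin 4) :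
    gradient v x i = pderiv i v x := by
  have h : inner ℝ (gradient v x) (EuclideanSpace.single i 1) = pderiv i v x := by
    rw [gradient, InnerProductSpace.toDual_symm_apply]; rfl
  rw [← h, EuclideanSpace.inner_single_right]; simp

theorem fderiv_eq_inner_gradient (v : E4 → ℝ) (x w : E4) :
    fderiv ℝ v x w = inner ℝ (gradient v x) w := by
  rw [gradient, InnerProductSpace.toDual_symm_apply]

theorem pderiv_sub {a b : E4 → ℝ} {x : E4} (k : Fin 4) (ha : DifferentiableAt ℝ a x)
    (hb : DifferentiableAt ℝ b x) :
    pderiv k (fun y => a y - b y) x = pderiv k a x - pderiv k b x := by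
  simp [pderiv, fderiv_fun_sub ha hb]

theorem pderiv_mul {a b : E4 → ℝ} {x : E4} (k : Fin 4) (ha : DifferentiableAt ℝ a x)
    (hb : DifferentiableAt ℝ b x) :
    pderiv k (fun y => a y * b y) x = a x * pderiv k b x + pderiv k a x * b x := by
  simp [pderiv, fderiv_fun_mul ha hb]; ring

theorem pderiv_const_mul {b : E4 → ℝ} {x : E4} (k : Fin 4) (c : ℝ)
    (hb : DifferentiableAt ℝ b x) :
    pderiv k (fun y => c * b y) x = c * pderiv k b x := by
  simp [pderiv, fderiv_const_mul hb]

theorem pderiv_sum {ι : Type*} (s : Finset ι) {a : ι → E4 → ℝ} {x : E4} (k : Fin 4)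
    (ha : ∀ i ∈ s, DifferentiableAt ℝ (a i) x) :
    pderiv k (fun y => ∑ i ∈ s, a i y) x = ∑ i ∈ s, pderiv k (a i) x := by
  simp [pderiv, fderiv_fun_sum ha]

theorem pderiv_coord (k l : Fin 4) (x : E4) :
    pderiv k (fun y : E4 => y l) x = if k = l then 1 else 0 := by
  have : fderiv ℝ (fun y : E4 => y l) x = (EuclideanSpace.proj l : E4 →L[ℝ] ℝ) :=
    (EuclideanSpace.proj l : E4 →L[ℝ] ℝ).fderiv
  simp [pderiv, this, eq_comm]

theorem contDiff_coord (l : Fin 4) {n : WithTop ℕ∞} : ContDiff ℝ n fun y : E4 => y l :=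
  (EuclideanSpace.proj l : E4 →L[ℝ] ℝ).contDiff

theorem ContDiffOn.pderiv {n : WithTop ℕ∞} {Ω : Set E4} (hΩ : IsOpen Ω) {u : E4 → ℝ}
    {m : WithTop ℕ∞} (hu : ContDiffOn ℝ n u Ω) (hmn : m + 1 ≤ n) (i : Fin 4) :
    ContDiffOn ℝ m (_root_.pderiv i u) Ω :=
  (hu.fderiv_of_isOpen hΩ hmn).clm_apply contDiffOn_const

theorem pderiv_comm {Ω : Set E4} (hΩ : IsOpen Ω) {u : E4 → ℝ} (hu : ContDiffOn ℝ 2 u Ω)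
    {x : E4} (hx : x ∈ Ω) (i j : Fin 4) :
    pderiv i (pderiv j u) x = pderiv j (pderiv i u) x := by
  have h1 : DifferentiableAt ℝ (fderiv ℝ u) x :=
    ((hu.fderiv_of_isOpen hΩ (m := 1) (by norm_num)).contDiffAt
      (hΩ.mem_nhds hx)).differentiableAt one_ne_zero
  have h2 : ∀ k l, pderiv k (pderiv l u) x = fderiv ℝ (fderiv ℝ u) x
      (EuclideanSpace.single k 1) (EuclideanSpace.single l 1) := by
    intro k l
    have : pderiv l u = fun y => fderiv ℝ u y (EuclideanSpace.single l 1) := rfl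
    rw [this, pderiv, fderiv_clm_apply h1 (by fun_prop)]
    simp
  rw [h2, h2]
  exact (hu.contDiffAt (hΩ.mem_nhds hx)).isSymmSndFDerivAt (by simp) _ _

theorem inner_eq_sum (x y : E4) : inner ℝ x y = ∑ i, x i * y i := by
  simp [PiLp.inner_apply, mul_comm]

theorem norm_sq_eq_sum (x : E4) : ‖x‖ ^ 2 = ∑ i, x i ^ 2 := by
  simp [EuclideanSpace.norm_sq_eq]

/-! ### The Pohozaev flux -/

/-- The Hessian matrix of `u`. -/
noncomputable def hessianMatrix (u : E4 → ℝ) (x : E4) : Matrix (Fin 4) (Fin 4) ℝ :=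
  Matrix.of fun i j => pderiv i (pderiv j u) x

/-- The product `Q v` of a matrix with a vector of `ℝ⁴`. -/
noncomputable def matVec (Q : Matrix (Fin 4) (Fin 4) ℝ) (v : E4) : E4 :=
  WithLp.toLp 2 (Q.mulVec v)

theorem matVec_apply (Q : Matrix (Fin 4) (Fin 4) ℝ) (v : E4) (i : Fin 4) :
    matVec Q v i = ∑ j, Q i j * v j := rfl

/-- The field whose divergence is `2 σ₂(A(ρ,u)) ⟨x, ∇u⟩` when `p = ∇u` and `Q = D²u`. The usual
Pohozaev field `⟨x,p⟩ (tr Q p - Q p) - …` is corrected by a divergence-free field, so that on a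
level set of `u` its normal component contains no tangential derivatives. -/
noncomputable def pohozaevFlux (ρ : ℝ) (x p : E4) (Q : Matrix (Fin 4) (Fin 4) ℝ) : E4 :=
  (inner ℝ x p) • (Q.trace • p - matVec Q p)
    - (1 / 3 * ‖p‖ ^ 2) • (Q.trace • x - matVec Q x)
    + (1 / 3 * inner ℝ p (matVec Q p)) • x - (1 / 3 * inner ℝ x (matVec Q p)) • p
    + ρ • ((‖p‖ ^ 2 * inner ℝ x p) • p - (1 / 4 * (‖p‖ ^ 2) ^ 2) • x)

theorem tensorA_apply (ρ : ℝ) (u : E4 → ℝ) (x : E4) (i j : Fin 4) :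
    tensorA ρ u x i j = -hessianMatrix u x i j + ρ * (pderiv i u x * pderiv j u x)
      - ρ / 2 * (∑ k, pderiv k u x ^ 2) * (if i = j then 1 else 0) := by
  simp only [tensorA, hessianMatrix, Matrix.of_apply, norm_sq_eq_sum, gradient_apply_eq_pderiv]

/-- In dimension four the gradient terms of `A` alone contribute nothing to `σ₂`. -/
theorem sigma_two_expand (ρ : ℝ) {p : Fin 4 → ℝ} {Q A : Matrix (Fin 4) (Fin 4) ℝ}
    (hQ : Q.IsSymm)
    (hA : ∀ i j, A i j = -Q i j + ρ * (p i * p j)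
      - ρ / 2 * (∑ k, p k ^ 2) * (if i = j then 1 else 0)) :
    sigma 2 A = (Q.trace ^ 2 - ∑ i, ∑ j, Q i j ^ 2) / 2
      + ρ * ((∑ k, p k ^ 2) * Q.trace / 2 + ∑ i, ∑ j, p i * Q i j * p j) := by
  have hsymm : A.IsSymm := by
    ext i j
    rw [Matrix.transpose_apply, hA, hA, hQ.apply]
    simp only [eq_comm (a := j)]; ring
  rw [sigma_two_of_isSymm hsymm]
  have e : ∀ i j, Q j i = Q i j := fun i j => hQ.apply i j
  simp only [Matrix.trace, Matrix.diag_apply, hA, Fin.sum_univ_four]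
  simp [e 0 1, e 0 2, e 0 3, e 1 2, e 1 3, e 2 3]
  ring

/-- The pointwise identity behind `isWeakDiv_pohozaevFlux`, with `s = ⟨x, p⟩`: on the right stand
the divergences of the null Lagrangian fields and of the `C¹` fields that make up the flux. -/
theorem pohozaev_algebra (ρ s : ℝ) (x p : Fin 4 → ℝ) (Q : Fin 4 → Fin 4 → ℝ)
    (sy : ∀ i j, Q j i = Q i j) :
    2 * (((∑ i, Q i i) ^ 2 - ∑ i, ∑ j, Q i j ^ 2) / 2
      + ρ * ((∑ k, p k ^ 2) * (∑ i, Q i i) / 2 + ∑ i, ∑ j, p i * Q i j * p j)) * s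
    = (∑ i, ∑ j, ((s * Q i i + (∑ l, (x l * Q i l + (if i = l then 1 else 0) * p l)) * p i
            - 1 / 3 * ((∑ l, p l * p l) * (if i = i then 1 else 0)
              + (∑ l, 2 * p l * Q i l) * x i)) * Q j j
          - (s * Q j i + (∑ l, (x l * Q j l + (if j = l then 1 else 0) * p l)) * p i
            - 1 / 3 * ((∑ l, p l * p l) * (if j = i then 1 else 0)
              + (∑ l, 2 * p l * Q j l) * x i)) * Q i j
          + 1 / 6 * ((x i * Q i j + (if i = i then 1 else 0) * p j) * (∑ l, 2 * p l * Q j l)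
            - (x i * Q j j + (if j = i then 1 else 0) * p j) * (∑ l, 2 * p l * Q i l))))
      + ∑ i, ρ * ((∑ l, p l * p l) * (s * Q i i
            + (∑ l, (x l * Q i l + (if i = l then 1 else 0) * p l)) * p i)
          + (∑ l, 2 * p l * Q i l) * (s * p i)
          - 1 / 4 * ((∑ l, p l * p l) * (∑ l, p l * p l)
            + 2 * (∑ l, p l * p l) * (∑ l, 2 * p l * Q i l) * x i)) := by
  simp only [Fin.sum_univ_four]
  simp only [sy 0 1, sy 0 2, sy 0 3, sy 1 2, sy 1 3, sy 2 3]
  simp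
  ring

/-- The Pohozaev identity in weak form. Computing the divergence pointwise would take third
derivatives of `u`; the field is instead a sum of null Lagrangian fields, which need only two, and
of `C¹` fields. -/
theorem isWeakDiv_pohozaevFlux {Ω : Set E4} (hΩ : IsOpen Ω) (ρ : ℝ) {u : E4 → ℝ}
    (hu : ContDiffOn ℝ 2 u Ω) :
    IsWeakDiv Ω (fun x => pohozaevFlux ρ x (gradient u x) (hessianMatrix u x))
      (fun x => 2 * sigma 2 (tensorA ρ u x) * inner ℝ x (gradient u x)) := by
  have hp : ∀ i, ContDiffOn ℝ 1 (pderiv i u) Ω := fun i => hu.pderiv hΩ (by norm_num) i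
  have hx : ∀ i, ContDiffOn ℝ 1 (fun y : E4 => y i) Ω := fun i => (contDiff_coord i).contDiffOn
  set S : E4 → ℝ := fun x => ∑ l, x l * pderiv l u x with hS
  set N : E4 → ℝ := fun x => ∑ l, pderiv l u x * pderiv l u x with hN
  have hSd : ContDiffOn ℝ 1 S Ω := ContDiffOn.sum fun l _ => (hx l).mul (hp l)
  have hNd : ContDiffOn ℝ 1 N Ω := ContDiffOn.sum fun l _ => (hp l).mul (hp l)
  set e : Fin 4 → E4 := fun i => EuclideanSpace.single i 1
  have W1 := fun i j => isWeakDiv_null_lagrangian hΩ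
    (((hSd.mul (hp i)).sub (contDiffOn_const (c := (1 / 3 : ℝ)) |>.mul (hNd.mul (hx i)))))
    (hp j) (e i) (e j)
  have W2 := fun i j => (isWeakDiv_null_lagrangian hΩ ((hx i).mul (hp j)) hNd (e i)
    (e j)).const_smul (1 / 6)
  have W3 := fun i => (IsWeakDiv.of_contDiffOn hΩ ((hNd.mul (hSd.mul (hp i))).sub
    (contDiffOn_const (c := (1 / 4 : ℝ)) |>.mul ((hNd.mul hNd).mul (hx i)))) (e i)).const_smul ρ
  have W := (IsWeakDiv.sum hΩ Finset.univ fun i _ => IsWeakDiv.sum hΩ Finset.univ fun j _ =>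
    (W1 i j).add hΩ (W2 i j)).add hΩ (IsWeakDiv.sum hΩ Finset.univ fun i _ => W3 i)
  refine W.congr ?_ ?_ <;> intro x hxΩ
  all_goals
    have dp : ∀ i, DifferentiableAt ℝ (pderiv i u) x := fun i =>
      ((hp i).contDiffAt (hΩ.mem_nhds hxΩ)).differentiableAt one_ne_zero
    have dx : ∀ i, DifferentiableAt ℝ (fun y : E4 => y i) x := fun i =>
      (contDiff_coord (n := 1) i).differentiable one_ne_zero x
    have dS := (hSd.contDiffAt (hΩ.mem_nhds hxΩ)).differentiableAt one_ne_zero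
    have dN := (hNd.contDiffAt (hΩ.mem_nhds hxΩ)).differentiableAt one_ne_zero
    have sy : ∀ i j, pderiv j (pderiv i u) x = pderiv i (pderiv j u) x := fun i j =>
      pderiv_comm hΩ hu hxΩ j i
    have pS : ∀ k, pderiv k S x = ∑ l, (x l * pderiv k (pderiv l u) x
        + (if k = l then 1 else 0) * pderiv l u x) := fun k => by
      rw [hS, pderiv_sum _ _ fun l _ => (dx l).fun_mul (dp l)]
      refine Finset.sum_congr rfl fun l _ => ?_
      rw [pderiv_mul k (dx l) (dp l), pderiv_coord]
    have pN : ∀ k, pderiv k N x = ∑ l, (2 * pderiv l u x * pderiv k (pderiv l u) x) := fun k => by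
      rw [hN, pderiv_sum _ _ fun l _ => (dp l).fun_mul (dp l)]
      refine Finset.sum_congr rfl fun l _ => ?_
      rw [pderiv_mul k (dp l) (dp l)]; ring
  · have hS' : inner ℝ x (gradient u x) = S x := by
      simp only [inner_eq_sum, gradient_apply_eq_pderiv, hS]
    have hN' : ‖gradient u x‖ ^ 2 = N x := by
      rw [norm_sq_eq_sum]; simp only [gradient_apply_eq_pderiv, hN, sq]
    have hf : ∀ (b : E4 → ℝ) i, fderiv ℝ b x (e i) = pderiv i b x := fun _ _ => rfl
    have he : ∀ i k, e i k = if k = i then 1 else 0 := fun i k => by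
      simp [e]
    ext k
    simp only [pohozaevFlux, hS', hN', hf, pN, PiLp.add_apply, PiLp.sub_apply, PiLp.smul_apply,
      smul_eq_mul, matVec_apply, gradient_apply_eq_pderiv, inner_eq_sum, hessianMatrix,
      Matrix.of_apply, Matrix.trace, Matrix.diag_apply, he,
      Fin.sum_univ_four]
    simp only [sy 0 1, sy 0 2, sy 0 3, sy 1 2, sy 1 3, sy 2 3]
    have hk : k = 0 ∨ k = 1 ∨ k = 2 ∨ k = 3 := by fin_cases k <;> simp
    rcases hk with rfl | rfl | rfl | rfl <;>
      simp only [Fin.isValue, Fin.reduceEq, if_true, if_false, sy 0 1, sy 0 2, sy 0 3, sy 1 2,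
        sy 1 3, sy 2 3] <;>
      ring
  · have hf : ∀ (b : E4 → ℝ) i, fderiv ℝ b x (e i) = pderiv i b x := fun _ _ => rfl
    have hS' : inner ℝ x (gradient u x) = S x := by
      simp only [inner_eq_sum, gradient_apply_eq_pderiv, hS]
    have d1 : ∀ i k, pderiv k (fun x => S x * pderiv i u x - 1 / 3 * (N x * x i)) x
        = S x * pderiv k (pderiv i u) x + pderiv k S x * pderiv i u x
          - 1 / 3 * (N x * (if k = i then 1 else 0) + pderiv k N x * x i) := fun i k => by
      rw [pderiv_sub k (dS.fun_mul (dp i)) ((dN.fun_mul (dx i)).const_mul _),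
        pderiv_mul k dS (dp i), pderiv_const_mul k _ (dN.fun_mul (dx i)), pderiv_mul k dN (dx i),
        pderiv_coord]
    have d2 : ∀ i j k, pderiv k (fun x => x i * pderiv j u x) x
        = x i * pderiv k (pderiv j u) x + (if k = i then 1 else 0) * pderiv j u x :=
      fun i j k => by rw [pderiv_mul k (dx i) (dp j), pderiv_coord]
    have d3 : ∀ i, pderiv i (fun x => N x * (S x * pderiv i u x) - 1 / 4 * (N x * N x * x i)) x
        = N x * (S x * pderiv i (pderiv i u) x + pderiv i S x * pderiv i u x)
          + pderiv i N x * (S x * pderiv i u x)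
          - 1 / 4 * (N x * N x + 2 * N x * pderiv i N x * x i) := fun i => by
      rw [pderiv_sub i (dN.fun_mul (dS.fun_mul (dp i)))
        (((dN.fun_mul dN).fun_mul (dx i)).const_mul _),
        pderiv_mul i dN (dS.fun_mul (dp i)), pderiv_mul i dS (dp i),
        pderiv_const_mul i _ ((dN.fun_mul dN).fun_mul (dx i)),
        pderiv_mul i (dN.fun_mul dN) (dx i), pderiv_mul i dN dN, pderiv_coord, if_pos rfl]
      ring
    beta_reduce
    rw [sigma_two_expand ρ (p := fun k => pderiv k u x) (Q := hessianMatrix u x)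
      (Matrix.IsSymm.ext fun i j => pderiv_comm hΩ hu hxΩ j i) (tensorA_apply ρ u x)]
    simp only [hS', hf, d1, d2, d3, pS, pN]
    have hNx : N x = ∑ l, pderiv l u x * pderiv l u x := rfl
    simp only [hNx, hessianMatrix, Matrix.trace, Matrix.diag_apply, Matrix.of_apply]
    generalize S x = s
    generalize hQ : (fun i j => pderiv i (pderiv j u) x) = Q
    have hQ' : ∀ i j, pderiv i (pderiv j u) x = Q i j := fun i j => by rw [← hQ]
    simp only [hQ'] at sy ⊢
    generalize hP : (fun i => pderiv i u x) = P
    have hP' : ∀ i, pderiv i u x = P i := fun i => by rw [← hP]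
    simp only [hP']
    exact pohozaev_algebra ρ s (fun i => x i) P Q sy

/-! ### The sign of `u - τ` -/

/-- A function with `σ₁(A(ρ,u)) > 0` has no interior minimum, since at such a point `A = -D²u`. -/
theorem not_isLocalMin_of_sigma_one_pos {Ω : Set E4} (hΩ : IsOpen Ω) {ρ : ℝ} {u : E4 → ℝ}
    (hu : ContDiffOn ℝ 2 u Ω) {x : E4} (hx : x ∈ Ω) (hA : (tensorA ρ u x).IsSymm)
    (hpos : 0 < sigma 1 (tensorA ρ u x)) : ¬ IsLocalMin u x := by
  intro hmin
  have hp0 : ∀ i, pderiv i u x = 0 := fun i => by simp [pderiv, hmin.fderiv_eq_zero]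
  rw [sigma_one_of_isSymm hA, Matrix.trace] at hpos
  obtain ⟨i, -, hi⟩ := Finset.exists_lt_of_sum_lt (s := Finset.univ) (f := fun _ : Fin 4 => (0 : ℝ))
    (by simpa using hpos)
  simp only [tensorA_apply, hp0, hessianMatrix, Matrix.of_apply] at hi
  have hneg : pderiv i (pderiv i u) x < 0 := by simpa using hi
  -- restrict `u` to the line through `x` in the direction `e i`
  set c : ℝ → E4 := fun s => x + s • EuclideanSpace.single i 1 with hc
  have hcd : ∀ s, HasDerivAt c (EuclideanSpace.single i 1) s := fun s => by
    have := ((hasDerivAt_id s).smul_const (EuclideanSpace.single i (1 : ℝ) : E4)).const_add x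
    rwa [one_smul] at this
  have hc0 : c 0 = x := by simp [hc]
  have hcont : ContinuousAt c 0 := (hcd 0).continuousAt
  have hcΩ : ∀ᶠ s in 𝓝 (0 : ℝ), c s ∈ Ω := hcont.eventually_mem (by
    rw [hc0]; exact hΩ.mem_nhds hx)
  have hd1 : ∀ᶠ s in 𝓝 (0 : ℝ), HasDerivAt (fun s => u (c s)) (pderiv i u (c s)) s := by
    filter_upwards [hcΩ] with s hs
    exact (((hu.contDiffAt (hΩ.mem_nhds hs)).differentiableAt
      two_ne_zero).hasFDerivAt).comp_hasDerivAt s (hcd s)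
  have hd2 : HasDerivAt (fun s => pderiv i u (c s)) (pderiv i (pderiv i u) x) 0 := by
    have := (((hu.pderiv hΩ (m := 1) (by norm_num) i).contDiffAt
      (hΩ.mem_nhds hx)).differentiableAt one_ne_zero).hasFDerivAt
    exact this.comp_hasDerivAt_of_eq 0 (hcd 0) hc0.symm
  have hde : deriv (fun s => u (c s)) =ᶠ[𝓝 0] fun s => pderiv i u (c s) :=
    hd1.mono fun s hs => hs.deriv
  have hdd : deriv (deriv fun s => u (c s)) 0 = pderiv i (pderiv i u) x := by
    rw [hde.deriv_eq, hd2.deriv]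
  have hmax := isLocalMax_of_deriv_deriv_neg (by rw [hdd]; exact hneg)
    (by rw [hde.self_of_nhds]; simp only [hc0, hp0]) hd1.self_of_nhds.continuousAt
  have hmin' : IsLocalMin (fun s => u (c s)) 0 := by
    have h : ∀ᶠ y in 𝓝 (c 0), u (c 0) ≤ u y := by rw [hc0]; exact hmin
    exact hcont.eventually h
  have hconst : (fun s => u (c s)) =ᶠ[𝓝 0] fun _ => u (c 0) := by
    filter_upwards [hmax, hmin'] with s h1 h2
    exact le_antisymm h1 h2
  have : deriv (fun s => u (c s)) =ᶠ[𝓝 0] fun _ => 0 := by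
    filter_upwards [hconst.deriv] with s hs
    rw [hs]; simp
  rw [this.deriv_eq] at hdd
  simp at hdd
  linarith

/-- The minimum principle: a function with `σ₁(A(ρ,u)) > 0` exceeds its constant boundary value. -/
theorem lt_of_sigma_one_pos {Ω : Set E4} (hΩ : IsOpen Ω) (hΩb : Bornology.IsBounded Ω)
    {ρ τ : ℝ} {u : E4 → ℝ} (hu : ContDiffOn ℝ 2 u Ω) (huc : ContinuousOn u (closure Ω))
    (hA : ∀ x ∈ Ω, (tensorA ρ u x).IsSymm ∧ 0 < sigma 1 (tensorA ρ u x))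
    (hbd : ∀ x ∈ frontier Ω, u x = τ) {x : E4} (hx : x ∈ Ω) : τ < u x := by
  have hno : ∀ y ∈ Ω, ¬ IsMinOn u (closure Ω) y := fun y hy h =>
    not_isLocalMin_of_sigma_one_pos hΩ hu hy (hA y hy).1 (hA y hy).2
      (h.isLocalMin (mem_of_superset (hΩ.mem_nhds hy) subset_closure))
  obtain ⟨z, hz, hmin⟩ := hΩb.isCompact_closure.exists_isMinOn ⟨x, subset_closure hx⟩ huc
  have hzf : z ∈ frontier Ω := by
    rw [hΩ.frontier_eq]; exact ⟨hz, fun h => hno z h hmin⟩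
  have hle : ∀ y ∈ closure Ω, τ ≤ u y := fun y hy => hbd z hzf ▸ hmin hy
  refine lt_of_le_of_ne (hle x (subset_closure hx)) fun h => hno x hx fun y hy => ?_
  simpa [← h] using hle y hy

/-- Every value between the boundary value and `u x` is attained. -/
theorem Icc_subset_image_closure {E : Type*} [NormedAddCommGroup E] [NormedSpace ℝ E]
    [Nontrivial E] {Ω : Set E} (hΩ : IsOpen Ω) (hΩb : Bornology.IsBounded Ω) {τ : ℝ} {u : E → ℝ}
    (huc : ContinuousOn u (closure Ω)) (hbd : ∀ x ∈ frontier Ω, u x = τ) {x : E} (hx : x ∈ Ω) :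
    Icc τ (u x) ⊆ u '' closure Ω := by
  intro t ht
  by_contra hno
  have hne : ∀ y ∈ closure Ω, u y ≠ t := fun y hy h => hno ⟨y, hy, h⟩
  -- otherwise `{u > t}` would be a bounded clopen set
  set S : Set E := {y ∈ closure Ω | t ≤ u y}
  have hclosed : IsClosed S := huc.preimage_isClosed_of_isClosed isClosed_closure isClosed_Ici
  have hSeq : S = Ω ∩ u ⁻¹' Ioi t := by
    ext y
    constructor
    · rintro ⟨hy, hty⟩
      have hlt := lt_of_le_of_ne hty (hne y hy).symm
      refine ⟨by_contra fun h => ?_, hlt⟩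
      have := hbd y (by rw [hΩ.frontier_eq]; exact ⟨hy, h⟩)
      linarith [ht.1]
    · exact fun hy => ⟨subset_closure hy.1, le_of_lt hy.2⟩
  have hopen : IsOpen S := by
    rw [hSeq]; exact (huc.mono subset_closure).isOpen_inter_preimage hΩ isOpen_Ioi
  rcases isClopen_iff.1 ⟨hclosed, hopen⟩ with h | h
  · have : x ∈ S := ⟨subset_closure hx, ht.2⟩
    rw [h] at this; exact this
  · have hb : Bornology.IsBounded (univ : Set E) := by
      rw [← h]; exact hΩb.closure.subset fun y hy => hy.1
    exact NormedSpace.unbounded_univ ℝ E hb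

/-- If `f = F'` does not vanish at interior values of `u`, then neither does `F - F(τ)`: this is
Rolle's theorem on `[τ, u x]`. -/
theorem antiderivative_comp_ne_zero {E : Type*} [NormedAddCommGroup E] [NormedSpace ℝ E]
    [Nontrivial E] {Ω : Set E} (hΩ : IsOpen Ω) (hΩb : Bornology.IsBounded Ω) {τ : ℝ} {u : E → ℝ}
    {f F : ℝ → ℝ} (huc : ContinuousOn u (closure Ω)) (hbd : ∀ x ∈ frontier Ω, u x = τ)
    (hF : ∀ t ∈ u '' closure Ω, HasDerivWithinAt F (f t) (u '' closure Ω) t) (hFτ : F τ = 0)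
    (hτ : ∀ x ∈ Ω, τ < u x) (hf : ∀ x ∈ Ω, f (u x) ≠ 0) {x : E} (hx : x ∈ Ω) : F (u x) ≠ 0 := by
  intro h0
  have hsub := Icc_subset_image_closure hΩ hΩb huc hbd hx
  obtain ⟨c, hc, hfc⟩ := exists_hasDerivAt_eq_zero (f := F) (f' := f) (hτ x hx)
    (fun t ht => ((hF t (hsub ht)).mono hsub).continuousWithinAt) (by rw [hFτ, h0])
    (fun t ht => (hF t (hsub (Ioo_subset_Icc_self ht))).hasDerivAt
      (mem_of_superset (Icc_mem_nhds ht.1 ht.2) hsub))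
  obtain ⟨y, hy, rfl⟩ := hsub (Ioo_subset_Icc_self hc)
  by_cases hyΩ : y ∈ Ω
  · exact hf y hyΩ hfc
  · have := hbd y (by rw [hΩ.frontier_eq]; exact ⟨hy, hyΩ⟩)
    exact absurd hc.1 (by rw [this]; exact lt_irrefl _)

/-! ### The interior side of the identity -/

/-- An even cutoff of the real line: `0` on `[-1, 1]` and `1` off `[-2, 2]`. -/
noncomputable def evenCutoff (s : ℝ) : ℝ := Real.smoothTransition (s ^ 2 - 1)

theorem contDiff_evenCutoff : ContDiff ℝ ∞ evenCutoff :=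
  Real.smoothTransition.contDiff.comp ((contDiff_id.pow 2).sub contDiff_const)

theorem evenCutoff_eq_zero {s : ℝ} (h : |s| ≤ 1) : evenCutoff s = 0 :=
  Real.smoothTransition.zero_of_nonpos (by
    have := (sq_le_one_iff_abs_le_one s).2 h; linarith)

theorem evenCutoff_eq_one {s : ℝ} (h : 2 ≤ |s|) : evenCutoff s = 1 :=
  Real.smoothTransition.one_of_one_le (by rw [← sq_abs]; nlinarith)

theorem deriv_evenCutoff_eq_zero {s : ℝ} (h : 2 < |s|) : deriv evenCutoff s = 0 := by
  have : evenCutoff =ᶠ[𝓝 s] fun _ => 1 := by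
    filter_upwards [(isOpen_lt continuous_const continuous_abs).mem_nhds h] with t ht
    exact evenCutoff_eq_one (le_of_lt ht)
  rw [this.deriv_eq]; simp

theorem exists_bound_mul_deriv_evenCutoff : ∃ C, ∀ s, |s * deriv evenCutoff s| ≤ C := by
  have hc : Continuous fun s => s * deriv evenCutoff s :=
    continuous_id.mul (contDiff_evenCutoff.continuous_deriv (by simp))
  obtain ⟨C, hC⟩ := (isCompact_Icc (a := (-2 : ℝ)) (b := 2)).exists_bound_of_continuousOn
    hc.continuousOn
  refine ⟨max C 0, fun s => ?_⟩
  by_cases hs : 2 < |s|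
  · simp [deriv_evenCutoff_eq_zero hs]
  · exact (hC s (abs_le.1 (not_lt.1 hs))).trans (le_max_left _ _)

theorem integral_mul_add_fderiv_self {w : E4 → ℝ} (hw : ContDiff ℝ 1 w) (hs : HasCompactSupport w) :
    ∫ x, (4 * w x + fderiv ℝ w x x) = 0 := by
  have h1 : ∀ i : Fin 4, ContDiff ℝ 1 fun x : E4 => w x * x i := fun i => hw.mul (contDiff_coord i)
  have h2 : ∀ i : Fin 4, HasCompactSupport fun x : E4 => w x * x i := fun i => hs.mul_right
  have h3 : ∀ i x, pderiv i (fun x : E4 => w x * x i) x = w x + pderiv i w x * x i := fun i x => by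
    rw [pderiv_mul i (hw.differentiable one_ne_zero x)
      ((contDiff_coord (n := 1) i).differentiable one_ne_zero x), pderiv_coord]
    simp
  have h4 : ∀ x, 4 * w x + fderiv ℝ w x x = ∑ i, pderiv i (fun x : E4 => w x * x i) x := fun x => by
    simp only [h3, fderiv_eq_inner_gradient, inner_eq_sum, gradient_apply_eq_pderiv,
      Fin.sum_univ_four]
    ring
  simp only [h4]
  rw [integral_finsetSum _ fun i _ => ?_]
  · exact Finset.sum_eq_zero fun i _ => integral_fderiv_eq_zero (h1 i) (h2 i) _
  · exact ((h1 i).continuous_fderiv one_ne_zero |>.clm_apply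
      continuous_const).integrable_of_hasCompactSupport ((h2 i).fderiv_apply (𝕜 := ℝ) _)

/-- `∫ div (K G x) = 0` when `G` vanishes on the boundary, without any control of `K` there. The
cutoff is a function of `n G`, so that its derivative is bounded by a multiple of the integrable
function `K ⟨x, ∇G⟩` and lives on a set that shrinks to `∅`. -/
theorem integral_div_radial_eq_zero {Ω : Set E4} (hΩ : IsOpen Ω) (hΩb : Bornology.IsBounded Ω)
    {K G : E4 → ℝ} (hK : ContDiffOn ℝ 1 K Ω) (hG : ContDiffOn ℝ 1 G Ω)
    (hGc : ContinuousOn G (closure Ω)) (hG0 : ∀ x ∈ frontier Ω, G x = 0)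
    (hGne : ∀ x ∈ Ω, G x ≠ 0)
    (hA : IntegrableOn (fun x => (4 * K x + fderiv ℝ K x x) * G x) Ω)
    (hB : IntegrableOn (fun x => K x * fderiv ℝ G x x) Ω) :
    ∫ x in Ω, (4 * K x + fderiv ℝ K x x) * G x = -∫ x in Ω, K x * fderiv ℝ G x x := by
  set w : ℕ → E4 → ℝ := fun n => Ω.indicator fun x => K x * (G x * evenCutoff (n * G x)) with hw
  have hwΩ : ∀ n, EqOn (w n) (fun x => K x * (G x * evenCutoff (n * G x))) Ω := fun n x hx =>
    indicator_of_mem hx _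
  have hsupp : ∀ n, ∃ C, IsCompact C ∧ C ⊆ Ω ∧ tsupport (w n) ⊆ C := by
    intro n
    have hcl : IsClosed {x ∈ closure Ω | 1 ≤ |n * G x|} :=
      (continuousOn_const.mul hGc).abs.preimage_isClosed_of_isClosed isClosed_closure isClosed_Ici
    refine ⟨_, hΩb.isCompact_closure.of_isClosed_subset hcl fun x hx => hx.1, ?_,
      closure_minimal (fun x hx => ?_) hcl⟩
    · rintro x ⟨hx, h1⟩
      by_contra hxΩ
      rw [hG0 x (by rw [hΩ.frontier_eq]; exact ⟨hx, hxΩ⟩)] at h1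
      norm_num at h1
    · have hxΩ : x ∈ Ω := by
        by_contra h
        exact hx (indicator_of_notMem h _)
      refine ⟨subset_closure hxΩ, ?_⟩
      by_contra h
      exact hx (by rw [hwΩ n hxΩ]; simp [evenCutoff_eq_zero (not_le.1 h).le])
  have hwd : ∀ n, ContDiff ℝ 1 (w n) := fun n => by
    obtain ⟨C, -, hC, hs⟩ := hsupp n
    refine contDiff_of_contDiffOn_of_tsupport_subset hΩ ?_ (hs.trans hC)
    refine ContDiffOn.congr (hK.mul (hG.mul ?_)) (hwΩ n)
    exact (contDiff_evenCutoff.of_le (by norm_cast)).comp_contDiffOn (contDiffOn_const.mul hG)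
  have hwc : ∀ n, HasCompactSupport (w n) := fun n => by
    obtain ⟨C, hC, -, hs⟩ := hsupp n
    exact hC.of_isClosed_subset isClosed_closure hs
  -- the divergence of `w n • x`, in terms of the two given integrands
  have hform : ∀ n, ∀ x ∈ Ω, 4 * w n x + fderiv ℝ (w n) x x
      = evenCutoff (n * G x) * ((4 * K x + fderiv ℝ K x x) * G x)
        + (evenCutoff (n * G x) + (n * G x) * deriv evenCutoff (n * G x))
          * (K x * fderiv ℝ G x x) := by
    intro n x hx
    have dK := ((hK.contDiffAt (hΩ.mem_nhds hx)).differentiableAt one_ne_zero)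
    have dG := ((hG.contDiffAt (hΩ.mem_nhds hx)).differentiableAt one_ne_zero)
    have dZ : HasFDerivAt (fun x => evenCutoff (n * G x))
        (deriv evenCutoff (n * G x) • ((n : ℝ) • fderiv ℝ G x)) x :=
      ((contDiff_evenCutoff.differentiable (by simp)) _).hasDerivAt.comp_hasFDerivAt x
        (dG.hasFDerivAt.const_mul _)
    have hev : w n =ᶠ[𝓝 x] fun x => K x * (G x * evenCutoff (n * G x)) := by
      filter_upwards [hΩ.mem_nhds hx] with y hy using hwΩ n hy
    rw [hev.fderiv_eq, hwΩ n hx,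
      (dK.hasFDerivAt.fun_mul (dG.hasFDerivAt.fun_mul dZ)).fderiv]
    simp; ring
  obtain ⟨C, hC⟩ := exists_bound_mul_deriv_evenCutoff
  have hint : ∀ n : ℕ, ∫ x in Ω, (evenCutoff (n * G x) * ((4 * K x + fderiv ℝ K x x) * G x)
        + (evenCutoff (n * G x) + (n * G x) * deriv evenCutoff (n * G x))
          * (K x * fderiv ℝ G x x)) = 0 := fun n => by
    refine (setIntegral_congr_fun hΩ.measurableSet fun x hx => (hform n x hx).symm).trans ?_
    refine (setIntegral_eq_integral_of_forall_compl_eq_zero fun x hx => ?_).trans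
      (integral_mul_add_fderiv_self (hwd n) (hwc n))
    obtain ⟨C, -, hC, hs⟩ := hsupp n
    have : x ∉ tsupport (w n) := fun h => hx (hC (hs h))
    simp [fderiv_of_notMem_tsupport ℝ this, image_eq_zero_of_notMem_tsupport this]
  have hcG : ∀ n : ℕ, ContinuousOn (fun x => (n : ℝ) * G x) Ω := fun n =>
    continuousOn_const.mul hG.continuousOn
  have c1 : ∀ n : ℕ, AEStronglyMeasurable (fun x => evenCutoff (n * G x)) (volume.restrict Ω) :=
    fun n => (contDiff_evenCutoff.continuous.comp_continuousOn (hcG n)).aestronglyMeasurable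
      hΩ.measurableSet
  have c2 : ∀ n : ℕ, AEStronglyMeasurable (fun x => (n * G x) * deriv evenCutoff (n * G x))
      (volume.restrict Ω) := fun n => ((hcG n).mul
        ((contDiff_evenCutoff.continuous_deriv (by simp)).comp_continuousOn
          (hcG n))).aestronglyMeasurable hΩ.measurableSet
  have hlim := tendsto_integral_of_dominated_convergence (μ := volume.restrict Ω)
    (F := fun (n : ℕ) x => evenCutoff (n * G x) * ((4 * K x + fderiv ℝ K x x) * G x)
        + (evenCutoff (n * G x) + (n * G x) * deriv evenCutoff (n * G x))
          * (K x * fderiv ℝ G x x))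
    (f := fun x => (4 * K x + fderiv ℝ K x x) * G x + K x * fderiv ℝ G x x)
    (fun x => ‖(4 * K x + fderiv ℝ K x x) * G x‖ + (1 + C) * ‖K x * fderiv ℝ G x x‖)
    (fun n => ((c1 n).mul hA.1).add (((c1 n).add (c2 n)).mul hB.1))
    (hA.norm.add (hB.norm.const_mul _))
    (fun n => ae_of_all _ fun x => by
      have hz : |evenCutoff (n * G x)| ≤ 1 := by
        rw [evenCutoff, abs_of_nonneg (Real.smoothTransition.nonneg _)]
        exact Real.smoothTransition.le_one _
      refine (norm_add_le _ _).trans ?_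
      rw [norm_mul, norm_mul (evenCutoff (n * G x) + _), Real.norm_eq_abs (evenCutoff _),
        Real.norm_eq_abs (evenCutoff (n * G x) + _)]
      gcongr
      · exact mul_le_of_le_one_left (norm_nonneg _) hz
      · exact (abs_add_le _ _).trans (add_le_add hz (hC _)))
    ((ae_restrict_mem hΩ.measurableSet).mono fun x hx => by
      have hbig : ∀ᶠ n : ℕ in atTop, 2 < |(n : ℝ) * G x| := by
        have : Tendsto (fun n : ℕ => (n : ℝ) * |G x|) atTop atTop :=
          tendsto_natCast_atTop_atTop.atTop_mul_const (abs_pos.2 (hGne x hx))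
        filter_upwards [this.eventually_gt_atTop 2] with n hn
        rwa [abs_mul, Nat.abs_cast]
      refine tendsto_const_nhds.congr' ?_
      filter_upwards [hbig] with n hn
      rw [evenCutoff_eq_one hn.le, deriv_evenCutoff_eq_zero hn]; ring)
  simp only [hint] at hlim
  have h0 := tendsto_nhds_unique hlim tendsto_const_nhds
  rw [integral_add hA hB] at h0
  linarith

/-- The equation turns `∫ 8 (K + ¼⟨x, ∇K⟩) F(u)` into `-∫ 2 σ₂(A) ⟨x, ∇u⟩`. -/
theorem integral_curvature_eq_neg_integral_sigma_two {Ω : Set E4} (hΩ : IsOpen Ω)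
    (hΩb : Bornology.IsBounded Ω) {ρ τ : ℝ} {u K : E4 → ℝ} {f F : ℝ → ℝ}
    (hu : ContDiffOn ℝ 2 u Ω) (huc : ContinuousOn u (closure Ω)) (hK : ContDiffOn ℝ 1 K Ω)
    (hF : ∀ t ∈ u '' closure Ω, HasDerivWithinAt F (f t) (u '' closure Ω) t) (hFτ : F τ = 0)
    (hKF : IntegrableOn
      (fun x => 8 * (K x + 1 / 4 * inner ℝ x (gradient K x)) * F (u x)) Ω volume)
    (heq : ∀ x ∈ Ω, sigma 2 (tensorA ρ u x) = K x * f (u x))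
    (hcone : ∀ x ∈ Ω, tensorA ρ u x ∈ GammaTwoPos) (hbd : ∀ x ∈ frontier Ω, u x = τ)
    (hg : IntegrableOn (fun x => 2 * sigma 2 (tensorA ρ u x) * inner ℝ x (gradient u x)) Ω)
    (hσ : ContinuousOn (fun x => sigma 2 (tensorA ρ u x)) Ω) :
    ∫ x in Ω, 8 * (K x + 1 / 4 * inner ℝ x (gradient K x)) * F (u x)
      = -∫ x in Ω, 2 * sigma 2 (tensorA ρ u x) * inner ℝ x (gradient u x) := by
  have hτ : ∀ x ∈ Ω, τ < u x := fun x hx => lt_of_sigma_one_pos hΩ hΩb hu huc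
    (fun y hy => ⟨(hcone y hy).1, (hcone y hy).2.1⟩) hbd hx
  have hKf : ∀ x ∈ Ω, K x ≠ 0 ∧ f (u x) ≠ 0 := fun x hx => by
    have := (hcone x hx).2.2
    rw [heq x hx] at this
    exact ⟨left_ne_zero_of_mul this.ne', right_ne_zero_of_mul this.ne'⟩
  have hGne : ∀ x ∈ Ω, F (u x) ≠ 0 := fun x hx =>
    antiderivative_comp_ne_zero hΩ hΩb huc hbd hF hFτ hτ (fun y hy => (hKf y hy).2) hx
  have hGd : ∀ x ∈ Ω, HasFDerivAt (fun x => F (u x)) (f (u x) • fderiv ℝ u x) x := fun x hx =>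
    (hF (u x) (mem_image_of_mem u (subset_closure hx))).comp_hasFDerivAt x
      ((hu.contDiffAt (hΩ.mem_nhds hx)).differentiableAt two_ne_zero).hasFDerivAt
      (by filter_upwards [hΩ.mem_nhds hx] with y hy using mem_image_of_mem u (subset_closure hy))
  -- `f ∘ u` is continuous because it equals `σ₂(A) / K`
  have hfc : ContinuousOn (fun x => f (u x)) Ω :=
    (hσ.div hK.continuousOn fun x hx => (hKf x hx).1).congr fun x hx => by
      rw [Pi.div_apply, heq x hx, mul_div_cancel_left₀ _ (hKf x hx).1]
  have hG : ContDiffOn ℝ 1 (fun x => F (u x)) Ω := by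
    rw [show (1 : WithTop ℕ∞) = 0 + 1 by simp, contDiffOn_succ_iff_fderiv_of_isOpen hΩ]
    refine ⟨fun x hx => (hGd x hx).differentiableAt.differentiableWithinAt, by simp, ?_⟩
    rw [contDiffOn_zero]
    exact (hfc.smul (hu.continuousOn_fderiv_of_isOpen hΩ (by norm_num))).congr
      fun x hx => (hGd x hx).fderiv
  have hGc : ContinuousOn (fun x => F (u x)) (closure Ω) := fun x hx =>
    (hF (u x) (mem_image_of_mem u hx)).continuousWithinAt.comp (huc x hx) (mapsTo_image _ _)
  have e1 : ∀ x, 8 * (K x + 1 / 4 * inner ℝ x (gradient K x)) * F (u x)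
      = 2 * ((4 * K x + fderiv ℝ K x x) * F (u x)) := fun x => by
    rw [fderiv_eq_inner_gradient, real_inner_comm]; ring
  have e2 : ∀ x ∈ Ω, 2 * sigma 2 (tensorA ρ u x) * inner ℝ x (gradient u x)
      = 2 * (K x * fderiv ℝ (fun x => F (u x)) x x) := fun x hx => by
    rw [(hGd x hx).fderiv, heq x hx, smul_apply, fderiv_eq_inner_gradient,
      real_inner_comm, smul_eq_mul]; ring
  simp only [e1] at hKF ⊢
  have hA : IntegrableOn (fun x => (4 * K x + fderiv ℝ K x x) * F (u x)) Ω := by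
    simpa [IntegrableOn] using hKF.const_mul (1 / 2)
  have hB : IntegrableOn (fun x => K x * fderiv ℝ (fun x => F (u x)) x x) Ω := by
    have := (hg.congr_fun e2 hΩ.measurableSet).const_mul (1 / 2)
    simpa [IntegrableOn] using this
  rw [setIntegral_congr_fun hΩ.measurableSet e2, integral_const_mul, integral_const_mul,
    integral_div_radial_eq_zero hΩ hΩb hK hG hGc (fun x hx => by rw [hbd x hx, hFτ]) hGne hA hB]
  ring

/-! ### Regular boundary points and their normals -/

/-- Euclidean space `ℝ³`, the parameter space of boundary charts. -/
abbrev E3 : Type := EuclideanSpace ℝ (Fin 3)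

theorem IsLocalDefiningFunction.of_le {n m : ℕ∞} {Ω : Set E4} {x : E4} {φ : E4 → ℝ}
    (h : IsLocalDefiningFunction n Ω x φ) (hmn : m ≤ n) : IsLocalDefiningFunction m Ω x φ :=
  ⟨h.contDiff.of_le (by exact_mod_cast hmn), h.eq_zero, h.gradient_ne_zero, h.mem_iff⟩

theorem continuous_gradient {φ : E4 → ℝ} (hφ : ContDiff ℝ 1 φ) : Continuous (gradient φ) :=
  (InnerProductSpace.toDual ℝ E4).symm.continuous.comp (hφ.continuous_fderiv one_ne_zero)

theorem norm_levelNormal {φ : E4 → ℝ} {x : E4} (h : gradient φ x ≠ 0) : ‖levelNormal φ x‖ = 1 := by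
  rw [levelNormal, norm_smul, norm_inv, norm_norm, inv_mul_cancel₀ (norm_ne_zero_iff.2 h)]

/-- `φ` increases along `d` at `x` to first order if `⟨∇φ, d⟩ > 0`. -/
theorem eventually_pos_along_line {φ : E4 → ℝ} {x d : E4} (hφ : DifferentiableAt ℝ φ x)
    (h0 : φ x = 0) (hd : 0 < inner ℝ (gradient φ x) d) :
    ∀ᶠ s in 𝓝[>] (0 : ℝ), 0 < φ (x + s • d) := by
  have hline : HasDerivAt (fun s : ℝ => x + s • d) d 0 := by
    have := ((hasDerivAt_id (0 : ℝ)).smul_const d).const_add x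
    rwa [one_smul] at this
  have h1 : HasDerivAt (fun s : ℝ => φ (x + s • d)) (inner ℝ (gradient φ x) d) 0 := by
    rw [← fderiv_eq_inner_gradient]
    exact hφ.hasFDerivAt.comp_hasDerivAt_of_eq 0 hline (by simp)
  have h2 := (hasDerivAt_iff_tendsto_slope.1 h1).eventually_const_lt hd
  have h3 : ∀ᶠ s in 𝓝[>] (0 : ℝ), 0 < slope (fun s : ℝ => φ (x + s • d)) 0 s :=
    h2.filter_mono (nhdsWithin_mono _ fun s (hs : 0 < s) => hs.ne')
  filter_upwards [h3, self_mem_nhdsWithin] with s hs (hs0 : 0 < s)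
  rw [slope_def_field] at hs
  simp only [zero_smul, add_zero, h0, sub_zero] at hs
  exact (div_pos_iff_of_pos_right hs0).1 hs

/-- The unit normal does not depend on the defining function. -/
theorem levelNormal_eq_of_isLocalDefiningFunction {Ω : Set E4} {x : E4} {φ₁ φ₂ : E4 → ℝ}
    (h₁ : IsLocalDefiningFunction 2 Ω x φ₁) (h₂ : IsLocalDefiningFunction 2 Ω x φ₂) :
    levelNormal φ₁ x = levelNormal φ₂ x := by
  by_contra hne
  -- otherwise `φ₁ < 0 < φ₂` holds along the direction `ν₂ - ν₁`
  set d : E4 := levelNormal φ₂ x - levelNormal φ₁ x with hd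
  have n1 := norm_levelNormal h₁.gradient_ne_zero
  have n2 := norm_levelNormal h₂.gradient_ne_zero
  have hlt : inner ℝ (levelNormal φ₁ x) (levelNormal φ₂ x) < (1 : ℝ) :=
    (inner_lt_one_iff_real_of_norm_eq_one n1 n2).2 hne
  have g : ∀ {φ : E4 → ℝ}, gradient φ x ≠ 0 →
      gradient φ x = ‖gradient φ x‖ • levelNormal φ x := fun h => by
    rw [levelNormal, smul_inv_smul₀ (norm_ne_zero_iff.2 h)]
  have p2 : 0 < inner ℝ (gradient φ₂ x) d := by
    rw [g h₂.gradient_ne_zero, inner_smul_left, hd, inner_sub_right, real_inner_self_eq_norm_sq,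
      n2, real_inner_comm]
    exact mul_pos (norm_pos_iff.2 h₂.gradient_ne_zero) (by linarith)
  have p1 : 0 < inner ℝ (gradient φ₁ x) (-d) := by
    rw [g h₁.gradient_ne_zero, inner_smul_left, hd, inner_neg_right, inner_sub_right,
      real_inner_self_eq_norm_sq, n1]
    exact mul_pos (norm_pos_iff.2 h₁.gradient_ne_zero) (by linarith)
  have c : ∀ {φ : E4 → ℝ}, IsLocalDefiningFunction 2 Ω x φ → DifferentiableAt ℝ φ x := fun h =>
    h.contDiff.differentiable (by simp) x
  have hcont : Tendsto (fun s : ℝ => x + s • -d) (𝓝[>] 0) (𝓝 x) := by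
    have : ContinuousAt (fun s : ℝ => x + s • -d) 0 := by fun_prop
    have h0 : Tendsto (fun s : ℝ => x + s • -d) (𝓝 0) (𝓝 x) := by simpa [ContinuousAt] using this
    exact h0.mono_left nhdsWithin_le_nhds
  have e2 : ∀ᶠ s in 𝓝[>] (0 : ℝ), φ₂ (x + s • -d) < 0 := by
    have := eventually_pos_along_line (φ := fun y => -φ₂ y) (d := -d) (c h₂).neg
      (by simp [h₂.eq_zero]) (by
        have hg : gradient (fun y => -φ₂ y) x = -gradient φ₂ x := by
          simp [gradient]
        rw [hg, inner_neg_neg]; exact p2)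
    filter_upwards [this] with s hs using by linarith
  obtain ⟨s, hs1, hs2, hs3, hs4⟩ := ((eventually_pos_along_line (c h₁) h₁.eq_zero p1).and
    (e2.and ((hcont.eventually h₁.mem_iff).and (hcont.eventually h₂.mem_iff)))).exists
  have := hs3.1 (hs4.2 hs2)
  linarith

theorem outwardNormal_eq_levelNormal {Ω : Set E4} {x : E4} {φ : E4 → ℝ}
    (h : IsLocalDefiningFunction 2 Ω x φ) : outwardNormal Ω x = levelNormal φ x := by
  have hex : ∃ φ, IsLocalDefiningFunction 2 Ω x φ := ⟨φ, h⟩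
  rw [outwardNormal, dif_pos hex]
  exact levelNormal_eq_of_isLocalDefiningFunction hex.choose_spec h

/-- A defining function at `z` is a defining function at all nearby zeros. -/
theorem IsLocalDefiningFunction.eventually_of_eq_zero {n : ℕ∞} (hn : 1 ≤ n) {Ω : Set E4} {z : E4}
    {φ : E4 → ℝ} (h : IsLocalDefiningFunction n Ω z φ) :
    ∀ᶠ x in 𝓝 z, φ x = 0 → IsLocalDefiningFunction n Ω x φ := by
  have hg : ∀ᶠ x in 𝓝 z, gradient φ x ≠ 0 :=
    (continuous_gradient (h.contDiff.of_le (by exact_mod_cast hn))).continuousAt.eventually_ne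
      h.gradient_ne_zero
  filter_upwards [hg, h.mem_iff.eventually_nhds] with x hx hm h0
  exact ⟨h.contDiff, h0, hx, hm⟩

theorem IsLocalDefiningFunction.eventually_mem_frontier_imp {n : ℕ∞} {Ω : Set E4} (hΩ : IsOpen Ω)
    {z : E4} {φ : E4 → ℝ} (h : IsLocalDefiningFunction n Ω z φ) :
    ∀ᶠ x in 𝓝 z, x ∈ frontier Ω → φ x = 0 := by
  filter_upwards [h.mem_iff.eventually_nhds] with x hx hxf
  rw [hΩ.frontier_eq] at hxf
  refine le_antisymm ?_ (not_lt.1 fun hlt => hxf.2 (hx.self_of_nhds.2 hlt))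
  by_contra hpos
  have : ∀ᶠ y in 𝓝 x, 0 < φ y :=
    h.contDiff.continuous.continuousAt.eventually_const_lt (not_le.1 hpos)
  obtain ⟨y, ⟨hy1, hy2⟩, hyΩ⟩ := mem_closure_iff_nhds.1 hxf.1 _ (this.and hx)
  have := hy2.1 hyΩ
  linarith [show 0 < φ y from hy1]

theorem continuousAt_levelNormal {φ : E4 → ℝ} (hφ : ContDiff ℝ 1 φ) {x : E4}
    (h : gradient φ x ≠ 0) : ContinuousAt (levelNormal φ) x :=
  ((continuous_gradient hφ).norm.continuousAt.inv₀ (norm_ne_zero_iff.2 h)).smul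
    (continuous_gradient hφ).continuousAt

theorem continuousOn_outwardNormal {Ω : Set E4} (hΩ : IsOpen Ω) :
    ContinuousOn (outwardNormal Ω) (regularBoundary 2 Ω) := by
  rintro z ⟨hz, φ, hφ⟩
  have hc : ContDiff ℝ 1 φ := hφ.contDiff.of_le (by norm_cast)
  refine (continuousAt_levelNormal hc hφ.gradient_ne_zero).continuousWithinAt.congr_of_eventuallyEq
    ?_ (outwardNormal_eq_levelNormal hφ)
  filter_upwards [self_mem_nhdsWithin, nhdsWithin_le_nhds (hφ.eventually_mem_frontier_imp hΩ),
    nhdsWithin_le_nhds (hφ.eventually_of_eq_zero (by norm_num))] with x hx h1 h2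
  exact outwardNormal_eq_levelNormal (h2 (h1 hx.1))

theorem norm_outwardNormal {Ω : Set E4} {x : E4} (hx : x ∈ regularBoundary 2 Ω) :
    ‖outwardNormal Ω x‖ = 1 := by
  obtain ⟨-, φ, hφ⟩ := hx
  rw [outwardNormal_eq_levelNormal hφ, norm_levelNormal hφ.gradient_ne_zero]

/-- The regular boundary is relatively open in the boundary. -/
theorem exists_isOpen_regularBoundary {Ω : Set E4} (hΩ : IsOpen Ω) :
    ∃ O, IsOpen O ∧ regularBoundary 2 Ω = frontier Ω ∩ O := by
  refine ⟨interior {x | x ∈ frontier Ω → x ∈ regularBoundary 2 Ω}, isOpen_interior, ?_⟩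
  ext z
  constructor
  · rintro ⟨hz, φ, hφ⟩
    refine ⟨hz, mem_interior_iff_mem_nhds.2 ?_⟩
    filter_upwards [hφ.eventually_mem_frontier_imp hΩ, hφ.eventually_of_eq_zero (by norm_num)]
      with x h1 h2 hx
    exact ⟨hx, φ, h2 (h1 hx)⟩
  · exact fun h => interior_subset h.2 h.1

theorem measurableSet_regularBoundary {Ω : Set E4} (hΩ : IsOpen Ω) :
    MeasurableSet (regularBoundary 2 Ω) := by
  obtain ⟨O, hO, h⟩ := exists_isOpen_regularBoundary hΩ
  rw [h]
  exact isClosed_frontier.measurableSet.inter hO.measurableSet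

/-! ### Graph charts of the boundary -/

/-- The linear coordinates `ℝ³ × ℝ ≃ ℝ⁴` of an isometry `e`. -/
noncomputable def frameMap (e : WithLp 2 (E3 × ℝ) ≃ₗᵢ[ℝ] E4) : (E3 × ℝ) ≃L[ℝ] E4 :=
  (WithLp.prodContinuousLinearEquiv 2 ℝ E3 ℝ).symm.trans e.toContinuousLinearEquiv

theorem inner_frameMap (e : WithLp 2 (E3 × ℝ) ≃ₗᵢ[ℝ] E4) (a b : E3 × ℝ) :
    inner ℝ (frameMap e a) (frameMap e b) = inner ℝ a.1 b.1 + a.2 * b.2 := by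
  have : inner ℝ (frameMap e a) (frameMap e b)
      = inner ℝ (WithLp.toLp 2 a : WithLp 2 (E3 × ℝ)) (WithLp.toLp 2 b) := e.inner_map_map _ _
  rw [this, WithLp.prod_inner_apply]
  simp [mul_comm]

theorem norm_sq_frameMap (e : WithLp 2 (E3 × ℝ) ≃ₗᵢ[ℝ] E4) (a : E3 × ℝ) :
    ‖frameMap e a‖ ^ 2 = ‖a.1‖ ^ 2 + a.2 ^ 2 := by
  rw [← real_inner_self_eq_norm_sq, inner_frameMap, real_inner_self_eq_norm_sq]; ring

theorem measurePreserving_add_frameMap (z : E4) (e : WithLp 2 (E3 × ℝ) ≃ₗᵢ[ℝ] E4) :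
    MeasurePreserving (fun q : E3 × ℝ => z + frameMap e q) :=
  (measurePreserving_add_left volume z).comp
    (e.measurePreserving.comp (WithLp.volume_preserving_toLp E3 ℝ))

theorem exists_frame_apply_eq {n : E4} (hn : ‖n‖ = 1) :
    ∃ e : WithLp 2 (E3 × ℝ) ≃ₗᵢ[ℝ] E4, frameMap e (0, 1) = n := by
  have hfr : Module.finrank ℝ (WithLp 2 (E3 × ℝ)) = Module.finrank ℝ E4 := by
    rw [(WithLp.linearEquiv 2 ℝ (E3 × ℝ)).finrank_eq, Module.finrank_prod]
    simp
  let e₀ : WithLp 2 (E3 × ℝ) ≃ₗᵢ[ℝ] E4 :=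
    (stdOrthonormalBasis ℝ (WithLp 2 (E3 × ℝ))).equiv (stdOrthonormalBasis ℝ E4) (finCongr hfr)
  have hv : ‖frameMap e₀ (0, 1)‖ = ‖n‖ := by
    rw [hn, ← sq_eq_sq₀ (norm_nonneg _) zero_le_one, norm_sq_frameMap]; simp
  exact ⟨e₀.trans (Submodule.reflection (ℝ ∙ (frameMap e₀ (0, 1) - n))ᗮ),
    Submodule.reflection_sub hv⟩

/-- The vector `(-∇ψ(y), 1)`: a normal of the graph of `ψ`, pointing upwards. -/
noncomputable def graphNormal (e : WithLp 2 (E3 × ℝ) ≃ₗᵢ[ℝ] E4) (ψ : E3 → ℝ) (y : E3) : E4 :=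
  frameMap e (-gradient ψ y, 1)

/-- In the coordinates `z + e(y, t)` with `|y| < r`, `|t| < r`, the open set `Ω` is the region
`t < ψ(y)` below the graph of a `C¹` function with `|∇ψ| ≤ ε`. -/
structure IsGraphChart (Ω : Set E4) (z : E4) (e : WithLp 2 (E3 × ℝ) ≃ₗᵢ[ℝ] E4) (ψ : E3 → ℝ)
    (r ε : ℝ) : Prop where
  r_pos : 0 < r
  map_zero : ψ 0 = 0
  contDiffOn : ContDiffOn ℝ 1 ψ (Metric.ball 0 r)
  abs_lt : ∀ y ∈ Metric.ball (0 : E3) r, |ψ y| < r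
  norm_fderiv_le : ∀ y ∈ Metric.ball (0 : E3) r, ‖fderiv ℝ ψ y‖ ≤ ε
  mem_iff : ∀ y ∈ Metric.ball (0 : E3) r, ∀ t : ℝ, |t| < r → (z + frameMap e (y, t) ∈ Ω ↔ t < ψ y)
  outwardNormal_eq : ∀ y ∈ Metric.ball (0 : E3) r, outwardNormal Ω (z + frameMap e (y, ψ y))
    = ‖graphNormal e ψ y‖⁻¹ • graphNormal e ψ y
  exists_defining : ∀ y ∈ Metric.ball (0 : E3) r,
    ∃ φ, IsLocalDefiningFunction 2 Ω (z + frameMap e (y, ψ y)) φ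

theorem inner_graphNormal (e : WithLp 2 (E3 × ℝ) ≃ₗᵢ[ℝ] E4) (ψ : E3 → ℝ) (y : E3) (q : E3 × ℝ) :
    inner ℝ (graphNormal e ψ y) (frameMap e q) = q.2 - fderiv ℝ ψ y q.1 := by
  rw [graphNormal, inner_frameMap, inner_neg_left, gradient, InnerProductSpace.toDual_symm_apply]
  ring

theorem hasFDerivAt_add_frameMap {φ : E4 → ℝ} (hφ : ContDiff ℝ 1 φ) (z : E4)
    (e : WithLp 2 (E3 × ℝ) ≃ₗᵢ[ℝ] E4) (q : E3 × ℝ) :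
    HasFDerivAt (fun q => φ (z + frameMap e q))
      ((fderiv ℝ φ (z + frameMap e q)).comp (frameMap e : (E3 × ℝ) →L[ℝ] E4)) q :=
  (hφ.differentiable one_ne_zero _).hasFDerivAt.comp q ((frameMap e).hasFDerivAt.const_add z)

/-- Near a regular boundary point the boundary is, by the implicit function theorem, a graph over
its tangent space; its slope vanishes at the point, hence is as small as desired nearby. -/
theorem exists_isGraphChart {Ω : Set E4} {z : E4} {φ : E4 → ℝ}
    (h : IsLocalDefiningFunction 2 Ω z φ) {ε : ℝ} (hε : 0 < ε) :
    ∃ e ψ r, IsGraphChart Ω z e ψ r ε ∧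
      ∀ y ∈ Metric.ball (0 : E3) r, φ (z + frameMap e (y, ψ y)) = 0 := by
  have hφ1 : ContDiff ℝ 1 φ := h.contDiff.of_le (by norm_cast)
  obtain ⟨e, he⟩ := exists_frame_apply_eq (norm_levelNormal h.gradient_ne_zero)
  set G : E3 × ℝ → ℝ := fun q => φ (z + frameMap e q) with hG
  have hGd := hasFDerivAt_add_frameMap hφ1 z e
  have hGc : ContDiff ℝ 1 G := hφ1.comp (contDiff_const.add (frameMap e).contDiff)
  have hgz : gradient φ z = ‖gradient φ z‖ • frameMap e (0, 1) := by
    rw [he, levelNormal, smul_inv_smul₀ (norm_ne_zero_iff.2 h.gradient_ne_zero)]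
  have hf0 : ∀ q, fderiv ℝ G 0 q = ‖gradient φ z‖ * q.2 := fun q => by
    rw [(hGd 0).fderiv, ContinuousLinearMap.comp_apply, map_zero, add_zero,
      fderiv_eq_inner_gradient, hgz, inner_smul_left]
    change _ * inner ℝ (frameMap e (0, 1)) (frameMap e q) = _
    rw [inner_frameMap]; simp [norm_smul, he, norm_levelNormal h.gradient_ne_zero]
  have hcd : ContDiffAt ℝ 1 G 0 := hGc.contDiffAt
  have hinv : (fderiv ℝ G 0 ∘L .inr ℝ E3 ℝ).IsInvertible := by
    refine ⟨ContinuousLinearEquiv.unitsEquivAut ℝ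
      (Units.mk0 _ (norm_ne_zero_iff.2 h.gradient_ne_zero)), ?_⟩
    ext
    simp [hf0]
  set ψ : E3 → ℝ := hcd.implicitFunction one_ne_zero hinv with hψ
  have hψ0 : ψ 0 = 0 := hcd.implicitFunction_apply_self one_ne_zero hinv
  have hψd0 : fderiv ℝ ψ 0 = 0 := by
    have := (hcd.hasStrictFDerivAt_implicitFunction one_ne_zero hinv).hasFDerivAt.fderiv
    rw [show ((0 : E3 × ℝ).1) = 0 from rfl] at this
    rw [hψ, this]
    have hz : fderiv ℝ G 0 ∘L .inl ℝ E3 ℝ = 0 := by ext; simp [hf0]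
    rw [hz]; simp
  have hψc : ContDiffAt ℝ 1 ψ 0 := hcd.contDiffAt_implicitFunction one_ne_zero hinv
  have hG0 : G 0 = 0 := by simp [hG, h.eq_zero]
  have hpt : ContinuousAt (fun q : E3 × ℝ => z + frameMap e q) 0 := by fun_prop
  have hpt0 : Tendsto (fun q : E3 × ℝ => z + frameMap e q) (𝓝 0) (𝓝 z) := by
    simpa [ContinuousAt] using hpt
  have A2 : ∀ᶠ x in 𝓝 z, 0 < inner ℝ (gradient φ x) (frameMap e (0, 1)) := by
    have hc : ContinuousAt (fun x => inner ℝ (gradient φ x) (frameMap e (0, 1))) z :=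
      ((continuous_gradient hφ1).inner continuous_const).continuousAt
    refine hc.eventually_const_lt ?_
    beta_reduce
    rw [hgz, inner_smul_left, inner_frameMap]
    simpa [norm_smul, he, norm_levelNormal h.gradient_ne_zero] using
      norm_pos_iff.2 h.gradient_ne_zero
  have A := ((hpt0.eventually h.mem_iff).and (hpt0.eventually A2)).and
    ((hcd.eventually_apply_eq_iff_implicitFunction one_ne_zero hinv).and
      (hpt0.eventually (h.eventually_of_eq_zero (by norm_num))))
  have B1 : ∀ᶠ y in 𝓝 (0 : E3), ContDiffAt ℝ 1 ψ y := hψc.eventually (by simp)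
  have B2 : ∀ᶠ y in 𝓝 (0 : E3), ‖fderiv ℝ ψ y‖ < min ε (1 / 2) := by
    have hc : ContinuousAt (fun y => ‖fderiv ℝ ψ y‖) 0 :=
      (hψc.continuousAt_fderiv one_ne_zero).norm
    exact hc.eventually_lt_const (by simp [hψd0, hε])
  obtain ⟨r₁, hr₁, hA⟩ := Metric.eventually_nhds_iff_ball.1 A
  obtain ⟨r₂, hr₂, hB⟩ := Metric.eventually_nhds_iff_ball.1 (B1.and B2)
  set r := min r₁ r₂ with hr
  have hr0 : 0 < r := lt_min hr₁ hr₂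
  have hA' : ∀ y ∈ Metric.ball (0 : E3) r, ∀ t : ℝ, |t| < r →
      (y, t) ∈ Metric.ball (0 : E3 × ℝ) r₁ :=
    fun y hy t ht => by
      rw [mem_ball_zero_iff] at hy ⊢
      exact max_lt (hy.trans_le (min_le_left _ _)) (lt_of_lt_of_le ht (min_le_left _ _))
  have hB' : ∀ y ∈ Metric.ball (0 : E3) r, y ∈ Metric.ball (0 : E3) r₂ := fun y hy =>
    Metric.ball_subset_ball (min_le_right _ _) hy
  have habs : ∀ y ∈ Metric.ball (0 : E3) r, |ψ y| < r := fun y hy => by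
    have := (convex_ball (0 : E3) r).norm_image_sub_le_of_norm_fderiv_le (𝕜 := ℝ) (f := ψ)
      (C := 1 / 2) (fun x hx => (hB x (hB' x hx)).1.differentiableAt one_ne_zero)
      (fun x hx => ((hB x (hB' x hx)).2.trans_le (min_le_right _ _)).le)
      (Metric.mem_ball_self hr0) hy
    rw [hψ0, sub_zero, sub_zero, Real.norm_eq_abs] at this
    rw [mem_ball_zero_iff] at hy
    linarith [norm_nonneg y]
  have hzero : ∀ y ∈ Metric.ball (0 : E3) r, G (y, ψ y) = 0 := fun y hy => by
    rw [← hG0]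
    exact (hA _ (hA' y hy _ (habs y hy))).2.1.2 rfl
  refine ⟨e, ψ, r, ⟨hr0, hψ0, fun y hy => (hB y (hB' y hy)).1.contDiffWithinAt, habs,
    fun y hy => ((hB y (hB' y hy)).2.trans_le (min_le_left _ _)).le, fun y hy t ht => ?_,
    fun y hy => ?_, fun y hy => ⟨φ, (hA _ (hA' y hy _ (habs y hy))).2.2 (hzero y hy)⟩⟩, hzero⟩
  · -- `φ` is strictly increasing along the last coordinate
    have hmono : StrictMonoOn (fun s : ℝ => G (y, s)) (Ioo (-r) r) := by
      have hder : ∀ s, HasDerivAt (fun s : ℝ => G (y, s))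
          (inner ℝ (gradient φ (z + frameMap e (y, s))) (frameMap e (0, 1))) s := fun s => by
        rw [← fderiv_eq_inner_gradient]
        have h1 : HasDerivAt (fun s : ℝ => (y, s)) ((0 : E3), (1 : ℝ)) s :=
          (hasDerivAt_const s y).prodMk (hasDerivAt_id s)
        exact (hGd (y, s)).comp_hasDerivAt s h1
      refine strictMonoOn_of_deriv_pos (convex_Ioo _ _)
        (fun s _ => (hder s).continuousAt.continuousWithinAt) fun s hs => ?_
      rw [interior_Ioo] at hs
      rw [(hder s).deriv]
      exact (hA _ (hA' y hy s (_root_.abs_lt.2 hs))).1.2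
    rw [(hA _ (hA' y hy t ht)).1.1, ← hmono.lt_iff_lt (_root_.abs_lt.1 ht)
      (_root_.abs_lt.1 (habs y hy))]
    rw [hzero y hy]
  · obtain ⟨⟨-, hpos⟩, -, hdef⟩ := hA _ (hA' y hy _ (habs y hy))
    rw [outwardNormal_eq_levelNormal (hdef (hzero y hy))]
    set x := z + frameMap e (y, ψ y)
    set c : ℝ := inner ℝ (gradient φ x) (frameMap e (0, 1))
    have hgr : gradient φ x = c • graphNormal e ψ y := by
      refine ext_inner_right ℝ fun v => ?_
      obtain ⟨⟨a, s⟩, rfl⟩ := (frameMap e).surjective v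
      rw [inner_smul_left, inner_graphNormal]
      -- differentiate `φ = 0` along the graph
      have h1 : HasFDerivAt (fun y => (y, ψ y))
          ((ContinuousLinearMap.id ℝ E3).prod (fderiv ℝ ψ y)) y :=
        (hasFDerivAt_id y).prodMk ((hB y (hB' y hy)).1.differentiableAt one_ne_zero).hasFDerivAt
      have h2 := ((hGd (y, ψ y)).comp y h1).fderiv
      have h3 : fderiv ℝ (fun y => G (y, ψ y)) y = 0 := by
        have : (fun y => G (y, ψ y)) =ᶠ[𝓝 y] fun _ => 0 := by
          filter_upwards [Metric.isOpen_ball.mem_nhds hy] with y' hy' using hzero y' hy'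
        rw [this.fderiv_eq]; simp
      have h4 : fderiv ℝ φ x (frameMap e (a, fderiv ℝ ψ y a)) = 0 := by
        have := congrArg (fun l : E3 →L[ℝ] ℝ => l a) (h2.symm.trans h3)
        simpa using this
      have h5 : frameMap e (a, s) = frameMap e (a, fderiv ℝ ψ y a)
          + (s - fderiv ℝ ψ y a) • frameMap e (0, 1) := by
        rw [← map_smul, ← map_add]; simp
      rw [h5, inner_add_right, ← fderiv_eq_inner_gradient, h4, inner_smul_right]
      simp [c]; ring
    rw [levelNormal, hgr, norm_smul, Real.norm_of_nonneg hpos.le, smul_smul, mul_inv, mul_comm c⁻¹,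
      mul_assoc, inv_mul_cancel₀ hpos.ne', mul_one]

/-! ### Hausdorff measure in a graph chart -/

theorem LipschitzOnWith.euclideanHausdorffMeasure_image_le {X Y : Type*} [EMetricSpace X]
    [EMetricSpace Y] [MeasurableSpace X] [BorelSpace X] [MeasurableSpace Y] [BorelSpace Y]
    {K : NNReal} {f : X → Y} {s : Set X} (h : LipschitzOnWith K f s) (d : ℕ) :
    μHE[d] (f '' s) ≤ (K : ENNReal) ^ d * μHE[d] s := by
  have := h.hausdorffMeasure_image_le (d := (d : ℝ)) (Nat.cast_nonneg d)
  rw [ENNReal.rpow_natCast] at this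
  rw [Measure.euclideanHausdorffMeasure_def, Measure.euclideanHausdorffMeasure_def,
    Measure.smul_apply, Measure.smul_apply]
  simp only [ENNReal.smul_def, smul_eq_mul]
  rw [mul_left_comm]
  gcongr

/-- The domain of a graph chart. -/
def chartBox (z : E4) (e : WithLp 2 (E3 × ℝ) ≃ₗᵢ[ℝ] E4) (r : ℝ) : Set E4 :=
  {x | ((frameMap e).symm (x - z)).1 ∈ Metric.ball 0 r ∧ |((frameMap e).symm (x - z)).2| < r}

theorem isOpen_chartBox (z : E4) (e : WithLp 2 (E3 × ℝ) ≃ₗᵢ[ℝ] E4) (r : ℝ) :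
    IsOpen (chartBox z e r) := by
  have hc : Continuous fun x => (frameMap e).symm (x - z) := by fun_prop
  exact (Metric.isOpen_ball.preimage (continuous_fst.comp hc)).inter
    (isOpen_lt (continuous_snd.comp hc).abs continuous_const)

theorem add_frameMap_mem_chartBox {z : E4} {e : WithLp 2 (E3 × ℝ) ≃ₗᵢ[ℝ] E4} {r : ℝ}
    {q : E3 × ℝ} : z + frameMap e q ∈ chartBox z e r ↔ q.1 ∈ Metric.ball 0 r ∧ |q.2| < r := by
  simp [chartBox]

theorem exists_eq_add_frameMap (z : E4) (e : WithLp 2 (E3 × ℝ) ≃ₗᵢ[ℝ] E4) (x : E4) :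
    ∃ q, x = z + frameMap e q := ⟨(frameMap e).symm (x - z), by simp⟩

namespace IsGraphChart

variable {Ω : Set E4} {z : E4} {e : WithLp 2 (E3 × ℝ) ≃ₗᵢ[ℝ] E4} {ψ : E3 → ℝ} {r ε : ℝ}

theorem self_mem_chartBox (h : IsGraphChart Ω z e ψ r ε) : z ∈ chartBox z e r := by
  simp [chartBox, h.r_pos]

theorem continuousOn_graph (h : IsGraphChart Ω z e ψ r ε) :
    ContinuousOn (fun y => z + frameMap e (y, ψ y)) (Metric.ball 0 r) :=
  continuousOn_const.add ((frameMap e).continuous.comp_continuousOn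
    (continuousOn_id.prodMk h.contDiffOn.continuousOn))

theorem mem_frontier_iff (h : IsGraphChart Ω z e ψ r ε) (hΩ : IsOpen Ω) {y : E3}
    (hy : y ∈ Metric.ball 0 r) {t : ℝ} (ht : |t| < r) :
    z + frameMap e (y, t) ∈ frontier Ω ↔ t = ψ y := by
  have hline : Continuous fun s : ℝ => z + frameMap e (y, s) := by fun_prop
  rw [hΩ.frontier_eq]
  constructor
  · rintro ⟨hcl, hn⟩
    refine le_antisymm ?_ (not_lt.1 fun hlt => hn ((h.mem_iff y hy t ht).2 hlt))
    by_contra hlt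
    -- above the graph there is a neighbourhood that misses `Ω`
    have hopen : ∀ᶠ q in 𝓝 ((y, t) : E3 × ℝ), q.1 ∈ Metric.ball 0 r ∧ |q.2| < r ∧ ψ q.1 < q.2 := by
      have h1 : ContinuousAt (fun q : E3 × ℝ => ψ q.1) (y, t) :=
        (h.contDiffOn.continuousOn.continuousAt (Metric.isOpen_ball.mem_nhds hy)).comp
          continuousAt_fst
      filter_upwards [continuousAt_fst.eventually (Metric.isOpen_ball.mem_nhds hy),
        (continuous_abs.comp continuous_snd).continuousAt.eventually_lt_const
          (show |((y, t) : E3 × ℝ).2| < r from ht),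
        h1.eventually_lt continuousAt_snd (not_le.1 hlt)] with q a1 a2 a3 using ⟨a1, a2, a3⟩
    have hback : Tendsto (fun x => (frameMap e).symm (x - z)) (𝓝 (z + frameMap e (y, t)))
        (𝓝 (y, t)) := by
      have hc : Continuous fun x => (frameMap e).symm (x - z) := by fun_prop
      simpa using hc.tendsto (z + frameMap e (y, t))
    obtain ⟨x, ⟨h1, h2, h3⟩, hxΩ⟩ := mem_closure_iff_nhds.1 hcl _ (hback.eventually hopen)
    obtain ⟨q, rfl⟩ := exists_eq_add_frameMap z e x
    simp only [add_sub_cancel_left, ContinuousLinearEquiv.symm_apply_apply] at h1 h2 h3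
    exact absurd ((h.mem_iff q.1 h1 q.2 h2).1 hxΩ) (not_lt.2 h3.le)
  · rintro rfl
    refine ⟨?_, fun hm => lt_irrefl _ ((h.mem_iff y hy _ ht).1 hm)⟩
    refine mem_closure_of_tendsto (hline.tendsto (ψ y) |>.mono_left nhdsWithin_le_nhds :
      Tendsto _ (𝓝[<] (ψ y)) _) ?_
    filter_upwards [self_mem_nhdsWithin, nhdsWithin_le_nhds
      (continuous_abs.continuousAt.eventually_lt_const ht)] with s hs hsr
    exact (h.mem_iff y hy s hsr).2 hs

theorem frontier_inter_chartBox (h : IsGraphChart Ω z e ψ r ε) (hΩ : IsOpen Ω) (S : Set E4) :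
    frontier Ω ∩ chartBox z e r ∩ S = (fun y => z + frameMap e (y, ψ y)) ''
      (Metric.ball 0 r ∩ (fun y => z + frameMap e (y, ψ y)) ⁻¹' S) := by
  ext x
  constructor
  · rintro ⟨⟨hf, hb⟩, hS⟩
    obtain ⟨⟨y, t⟩, rfl⟩ := exists_eq_add_frameMap z e x
    obtain ⟨hy, ht⟩ := add_frameMap_mem_chartBox.1 hb
    have hy' : y ∈ Metric.ball 0 r := hy
    obtain rfl : t = ψ y := (h.mem_frontier_iff hΩ hy ht).1 hf
    exact ⟨y, ⟨hy, hS⟩, rfl⟩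
  · rintro ⟨y, ⟨hy, hS⟩, rfl⟩
    exact ⟨⟨(h.mem_frontier_iff hΩ hy (h.abs_lt y hy)).2 rfl,
      add_frameMap_mem_chartBox.2 ⟨hy, h.abs_lt y hy⟩⟩, hS⟩

theorem lipschitzOnWith_graph (h : IsGraphChart Ω z e ψ r ε) (hε : 0 ≤ ε) :
    LipschitzOnWith (Real.toNNReal (1 + ε)) (fun y => z + frameMap e (y, ψ y))
      (Metric.ball 0 r) := by
  refine LipschitzOnWith.of_dist_le_mul fun y hy y' hy' => ?_
  rw [Real.coe_toNNReal _ (by linarith), dist_eq_norm, add_sub_add_left_eq_sub, ← map_sub,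
    dist_eq_norm]
  have h1 : ‖ψ y - ψ y'‖ ≤ ε * ‖y - y'‖ :=
    (convex_ball (0 : E3) r).norm_image_sub_le_of_norm_fderiv_le (𝕜 := ℝ)
      (fun x hx => (h.contDiffOn.contDiffAt (Metric.isOpen_ball.mem_nhds hx)).differentiableAt
        one_ne_zero) h.norm_fderiv_le hy' hy
  refine abs_le_of_sq_le_sq' ?_ (by positivity) |>.2
  rw [norm_sq_frameMap]
  have h2 : (ψ y - ψ y') ^ 2 ≤ (ε * ‖y - y'‖) ^ 2 := by
    rw [← sq_abs]; exact pow_le_pow_left₀ (abs_nonneg _) h1 2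
  simp only [Prod.fst_sub, Prod.snd_sub]
  nlinarith [mul_nonneg hε (sq_nonneg ‖y - y'‖)]

/-- Lebesgue measure of the ball of parameters, transported to the graph. -/
noncomputable def parameterMeasure (z : E4) (e : WithLp 2 (E3 × ℝ) ≃ₗᵢ[ℝ] E4) (ψ : E3 → ℝ)
    (r : ℝ) : Measure E4 :=
  (volume.restrict (Metric.ball (0 : E3) r)).map fun y => z + frameMap e (y, ψ y)

theorem aemeasurable_graph (h : IsGraphChart Ω z e ψ r ε) :
    AEMeasurable (fun y => z + frameMap e (y, ψ y)) (volume.restrict (Metric.ball (0 : E3) r)) :=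
  h.continuousOn_graph.aemeasurable Metric.isOpen_ball.measurableSet

theorem parameterMeasure_apply (h : IsGraphChart Ω z e ψ r ε) {S : Set E4}
    (hS : MeasurableSet S) : parameterMeasure z e ψ r S
      = volume (Metric.ball (0 : E3) r ∩ (fun y => z + frameMap e (y, ψ y)) ⁻¹' S) := by
  rw [parameterMeasure, Measure.map_apply_of_aemeasurable h.aemeasurable_graph hS,
    Measure.restrict_apply' Metric.isOpen_ball.measurableSet, inter_comm]

/-- The vertical projection of the graph does not increase distances. -/
theorem parameterMeasure_le (h : IsGraphChart Ω z e ψ r ε) (hΩ : IsOpen Ω) :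
    parameterMeasure z e ψ r ≤ (μHE[3] : Measure E4).restrict (frontier Ω ∩ chartBox z e r) := by
  refine Measure.le_iff.2 fun S hS => ?_
  rw [h.parameterMeasure_apply hS, Measure.restrict_apply hS, inter_comm S,
    h.frontier_inter_chartBox hΩ, ← EuclideanSpace.euclideanHausdorffMeasure_eq_volume]
  set B := Metric.ball (0 : E3) r ∩ (fun y => z + frameMap e (y, ψ y)) ⁻¹' S
  have hp : LipschitzOnWith 1 (fun x => ((frameMap e).symm (x - z)).1)
      ((fun y => z + frameMap e (y, ψ y)) '' B) := by
    refine (LipschitzWith.of_dist_le_mul fun x x' => ?_).lipschitzOnWith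
    obtain ⟨q, rfl⟩ := exists_eq_add_frameMap z e x
    obtain ⟨q', rfl⟩ := exists_eq_add_frameMap z e x'
    rw [NNReal.coe_one, one_mul, dist_eq_norm, dist_eq_norm]
    simp only [add_sub_cancel_left, ContinuousLinearEquiv.symm_apply_apply,
      add_sub_add_left_eq_sub]
    rw [← map_sub]
    refine abs_le_of_sq_le_sq' ?_ (norm_nonneg _) |>.2
    rw [norm_sq_frameMap, Prod.fst_sub]
    nlinarith [sq_nonneg (q - q').2]
  have := hp.euclideanHausdorffMeasure_image_le 3
  rw [image_image] at this
  simpa using this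

/-- The graph map is `(1 + ε)`-Lipschitz, so that area is at most `(1 + ε)³` times parameter
volume. -/
theorem le_smul_parameterMeasure (h : IsGraphChart Ω z e ψ r ε) (hΩ : IsOpen Ω) (hε : 0 ≤ ε) :
    (μHE[3] : Measure E4).restrict (frontier Ω ∩ chartBox z e r)
      ≤ ENNReal.ofReal ((1 + ε) ^ 3) • parameterMeasure z e ψ r := by
  refine Measure.le_iff.2 fun S hS => ?_
  rw [Measure.smul_apply, h.parameterMeasure_apply hS, Measure.restrict_apply hS, inter_comm S,
    h.frontier_inter_chartBox hΩ, ← EuclideanSpace.euclideanHausdorffMeasure_eq_volume]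
  have := ((h.lipschitzOnWith_graph hε).mono (inter_subset_left (t :=
    (fun y => z + frameMap e (y, ψ y)) ⁻¹' S))).euclideanHausdorffMeasure_image_le 3
  rwa [ENNReal.ofReal_pow (by linarith), smul_eq_mul]

instance isFiniteMeasure_parameterMeasure : IsFiniteMeasure (parameterMeasure z e ψ r) := by
  have : IsFiniteMeasure (volume.restrict (Metric.ball (0 : E3) r)) :=
    ⟨by rw [Measure.restrict_apply_univ]; exact measure_ball_lt_top⟩
  rw [parameterMeasure]; infer_instance

theorem frontier_inter_chartBox_lt_top (h : IsGraphChart Ω z e ψ r ε) (hΩ : IsOpen Ω)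
    (hε : 0 ≤ ε) : (μHE[3] : Measure E4) (frontier Ω ∩ chartBox z e r) < ⊤ := by
  have := h.le_smul_parameterMeasure hΩ hε univ
  rw [Measure.restrict_apply_univ, Measure.smul_apply, smul_eq_mul] at this
  exact this.trans_lt (ENNReal.mul_lt_top ENNReal.ofReal_lt_top (measure_lt_top _ _))

end IsGraphChart

/-- Integrals against two measures with `μ ≤ σ ≤ (1 + C) μ` differ by at most `C ∫ |G| dμ`. -/
theorem abs_integral_sub_le_of_measure_le {X : Type*} [MeasurableSpace X] {μ σ : Measure X}
    {C : ℝ} (hC : 0 ≤ C) (h1 : μ ≤ σ) (h2 : σ ≤ ENNReal.ofReal (1 + C) • μ) {G : X → ℝ}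
    (hG : Integrable G μ) :
    Integrable G σ ∧ |∫ x, G x ∂σ - ∫ x, G x ∂μ| ≤ C * ∫ x, |G x| ∂μ := by
  have hGσ : Integrable G σ := (hG.smul_measure ENNReal.ofReal_ne_top).mono_measure h2
  refine ⟨hGσ, ?_⟩
  have key : ∀ P : X → ℝ, (∀ x, 0 ≤ P x) → Integrable P μ → Integrable P σ →
      0 ≤ ∫ x, P x ∂σ - ∫ x, P x ∂μ ∧ ∫ x, P x ∂σ - ∫ x, P x ∂μ ≤ C * ∫ x, P x ∂μ := by
    intro P hP hPμ hPσ
    have a := integral_mono_measure h1 (ae_of_all _ hP) hPσ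
    have b := integral_mono_measure h2 (ae_of_all _ hP) (hPμ.smul_measure ENNReal.ofReal_ne_top)
    rw [integral_smul_measure, ENNReal.toReal_ofReal (by linarith), smul_eq_mul] at b
    exact ⟨by linarith, by linarith⟩
  have p := key (fun x => max (G x) 0) (fun x => le_max_right _ _) hG.pos_part hGσ.pos_part
  have n := key (fun x => max (-G x) 0) (fun x => le_max_right _ _) hG.neg_part hGσ.neg_part
  have e1 : ∀ x, G x = max (G x) 0 - max (-G x) 0 := fun x => by
    rw [max_zero_sub_max_neg_zero_eq_self]
  have e2 : ∀ x, |G x| = max (G x) 0 + max (-G x) 0 := fun x => by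
    rw [max_zero_add_max_neg_zero_eq_abs_self]
  have i1 : ∫ x, G x ∂σ = ∫ x, max (G x) 0 ∂σ - ∫ x, max (-G x) 0 ∂σ := by
    rw [← integral_sub hGσ.pos_part hGσ.neg_part]; exact integral_congr_ae (ae_of_all _ e1)
  have i2 : ∫ x, G x ∂μ = ∫ x, max (G x) 0 ∂μ - ∫ x, max (-G x) 0 ∂μ := by
    rw [← integral_sub hG.pos_part hG.neg_part]; exact integral_congr_ae (ae_of_all _ e1)
  have i3 : ∫ x, |G x| ∂μ = ∫ x, max (G x) 0 ∂μ + ∫ x, max (-G x) 0 ∂μ := by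
    rw [← integral_add hG.pos_part hG.neg_part]; exact integral_congr_ae (ae_of_all _ e2)
  rw [i1, i2, i3, abs_le]
  constructor <;> linarith [p.1, p.2, n.1, n.2]

/-! ### The divergence theorem in a graph chart -/

theorem contDiff_smoothTransition_one : ContDiff ℝ 1 Real.smoothTransition :=
  Real.smoothTransition.contDiff (n := 1)

theorem deriv_smoothTransition_eq_zero {s : ℝ} (h : s ∉ Icc (0 : ℝ) 1) :
    deriv Real.smoothTransition s = 0 := by
  rw [mem_Icc, not_and_or, not_le, not_le] at h
  rcases h with h | h
  · have : Real.smoothTransition =ᶠ[𝓝 s] fun _ => 0 := by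
      filter_upwards [Iio_mem_nhds h] with t ht
      exact Real.smoothTransition.zero_of_nonpos (le_of_lt ht)
    rw [this.deriv_eq]; simp
  · have : Real.smoothTransition =ᶠ[𝓝 s] fun _ => 1 := by
      filter_upwards [Ioi_mem_nhds h] with t ht
      exact Real.smoothTransition.one_of_one_le (le_of_lt ht)
    rw [this.deriv_eq]; simp

theorem continuous_deriv_smoothTransition : Continuous (deriv Real.smoothTransition) :=
  contDiff_smoothTransition_one.continuous_deriv le_rfl

theorem integrable_deriv_smoothTransition : Integrable (deriv Real.smoothTransition) :=
  continuous_deriv_smoothTransition.integrable_of_hasCompactSupport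
    (HasCompactSupport.intro isCompact_Icc fun _ h => deriv_smoothTransition_eq_zero h)

theorem integral_deriv_smoothTransition : ∫ s, deriv Real.smoothTransition s = 1 := by
  have := integral_of_hasDerivAt_of_tendsto (f := Real.smoothTransition) (m := 0) (n := 1)
    (fun s => (contDiff_smoothTransition_one.differentiable one_ne_zero s).hasDerivAt)
    integrable_deriv_smoothTransition
    (tendsto_const_nhds.congr' (by
      filter_upwards [eventually_le_atBot 0] with s hs
      exact (Real.smoothTransition.zero_of_nonpos hs).symm))
    (tendsto_const_nhds.congr' (by
      filter_upwards [eventually_ge_atTop 1] with s hs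
      exact (Real.smoothTransition.one_of_one_le hs).symm))
  simpa using this

theorem integral_mul_kernel_eq (w : ℝ → ℝ) (a : ℝ) {δ : ℝ} (hδ : 0 < δ) :
    ∫ t, w t * (deriv Real.smoothTransition ((a - t) / δ - 1) / δ)
      = ∫ s, w (a - δ * (s + 1)) * deriv Real.smoothTransition s := by
  set k := deriv Real.smoothTransition
  rw [← integral_sub_left_eq_self (fun t => w t * (k ((a - t) / δ - 1) / δ)) volume a]
  simp only [sub_sub_cancel]
  have h1 := Measure.integral_comp_mul_left (fun x => w (a - x) * (k (x / δ - 1) / δ)) δ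
  rw [abs_of_pos (inv_pos.2 hδ), smul_eq_mul] at h1
  have h2 : ∫ x, w (a - x) * (k (x / δ - 1) / δ)
      = ∫ x, w (a - δ * x) * k (x - 1) := by
    rw [← mul_right_inj' (inv_ne_zero hδ.ne'), ← h1, ← integral_const_mul]
    congr 1; ext x
    rw [mul_div_cancel_left₀ _ hδ.ne']; ring
  rw [h2, ← integral_add_right_eq_self (fun x => w (a - δ * x) * k (x - 1)) (1 : ℝ)]
  simp

/-- One-sided mollification at `a`: the kernels live on `[a - 2δ, a - δ]`. -/
theorem tendsto_integral_mul_kernel {w : ℝ → ℝ} (hw : Continuous w) {C : ℝ}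
    (hC : ∀ t, |w t| ≤ C) (a : ℝ) :
    Tendsto (fun δ : ℝ => ∫ t, w t * (deriv Real.smoothTransition ((a - t) / δ - 1) / δ))
      (𝓝[>] 0) (𝓝 (w a)) := by
  have h1 : Tendsto (fun δ : ℝ => ∫ s, w (a - δ * (s + 1)) * deriv Real.smoothTransition s)
      (𝓝[>] 0) (𝓝 (∫ s, w a * deriv Real.smoothTransition s)) := by
    refine tendsto_integral_filter_of_dominated_convergence
      (fun s => C * ‖deriv Real.smoothTransition s‖) ?_ ?_
      (integrable_deriv_smoothTransition.norm.const_mul C) ?_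
    · exact Eventually.of_forall fun δ => Continuous.aestronglyMeasurable
        ((hw.comp (by fun_prop)).mul continuous_deriv_smoothTransition)
    · refine Eventually.of_forall fun δ => ae_of_all _ fun s => ?_
      rw [norm_mul]
      exact mul_le_mul_of_nonneg_right (hC _) (norm_nonneg _)
    · refine ae_of_all _ fun s => Tendsto.mul_const _ ?_
      have : Continuous fun δ : ℝ => w (a - δ * (s + 1)) := hw.comp (by fun_prop)
      have h0 := this.tendsto 0
      simp only [zero_mul, sub_zero] at h0
      exact h0.mono_left nhdsWithin_le_nhds
  rw [integral_const_mul, integral_deriv_smoothTransition, mul_one] at h1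
  refine h1.congr' ?_
  filter_upwards [self_mem_nhdsWithin] with δ hδ
  exact (integral_mul_kernel_eq w a hδ).symm

theorem abs_integral_mul_kernel_le {w : ℝ → ℝ} {C : ℝ} (hC : ∀ t, |w t| ≤ C) (a : ℝ) {δ : ℝ}
    (hδ : 0 < δ) :
    |∫ t, w t * (deriv Real.smoothTransition ((a - t) / δ - 1) / δ)|
      ≤ C * ∫ s, ‖deriv Real.smoothTransition s‖ := by
  rw [integral_mul_kernel_eq w a hδ, ← integral_const_mul, ← Real.norm_eq_abs]
  refine norm_integral_le_of_norm_le (integrable_deriv_smoothTransition.norm.const_mul C)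
    (ae_of_all _ fun s => ?_)
  rw [norm_mul]
  exact mul_le_mul_of_nonneg_right (hC _) (norm_nonneg _)

theorem integrableOn_test_pairing {Ω : Set E4} {V : E4 → E4} {g χ : E4 → ℝ}
    (hV : Continuous V)
    (hg : IntegrableOn g Ω) (hχ : ContDiff ℝ 1 χ) (hχc : HasCompactSupport χ) :
    IntegrableOn (fun x => χ x * g x + fderiv ℝ χ x (V x)) Ω := by
  refine Integrable.add ?_ ?_
  · obtain ⟨B, hB⟩ := hχ.continuous.bounded_above_of_compact_support hχc
    exact hg.bdd_mul hχ.continuous.aestronglyMeasurable (ae_of_all _ hB)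
  · refine Integrable.integrableOn (Continuous.integrable_of_hasCompactSupport
      ((hχ.continuous_fderiv one_ne_zero).clm_apply hV) ?_)
    refine HasCompactSupport.intro hχc fun x hx => ?_
    simp [fderiv_of_notMem_tsupport ℝ hx]

namespace IsGraphChart

variable {Ω : Set E4} {z : E4} {e : WithLp 2 (E3 × ℝ) ≃ₗᵢ[ℝ] E4} {ψ : E3 → ℝ} {r ε : ℝ}

theorem continuousOn_graphNormal (h : IsGraphChart Ω z e ψ r ε) :
    ContinuousOn (graphNormal e ψ) (Metric.ball 0 r) := by
  have h1 : ContinuousOn (gradient ψ) (Metric.ball 0 r) :=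
    (InnerProductSpace.toDual ℝ E3).symm.continuous.comp_continuousOn
      (h.contDiffOn.continuousOn_fderiv_of_isOpen Metric.isOpen_ball le_rfl)
  exact (frameMap e).continuous.comp_continuousOn (h1.neg.prodMk continuousOn_const)

theorem norm_graphNormal_mem (h : IsGraphChart Ω z e ψ r ε) (hε : 0 ≤ ε) {y : E3}
    (hy : y ∈ Metric.ball 0 r) : 1 ≤ ‖graphNormal e ψ y‖ ∧ ‖graphNormal e ψ y‖ ≤ 1 + ε := by
  have h1 : ‖graphNormal e ψ y‖ ^ 2 = ‖gradient ψ y‖ ^ 2 + 1 := by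
    rw [graphNormal, norm_sq_frameMap, norm_neg]; ring
  have h2 : ‖gradient ψ y‖ ≤ ε := by
    rw [gradient, LinearIsometryEquiv.norm_map]; exact h.norm_fderiv_le y hy
  have h3 : ‖gradient ψ y‖ ^ 2 ≤ ε ^ 2 := pow_le_pow_left₀ (norm_nonneg _) h2 2
  constructor
  · nlinarith [norm_nonneg (graphNormal e ψ y), sq_nonneg ‖gradient ψ y‖]
  · refine abs_le_of_sq_le_sq' ?_ (by linarith) |>.2
    nlinarith

/-- The signed vertical distance of a point to the graph, positive in `Ω`. -/
noncomputable def depth (z : E4) (e : WithLp 2 (E3 × ℝ) ≃ₗᵢ[ℝ] E4) (ψ : E3 → ℝ) (x : E4) : ℝ :=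
  ψ ((frameMap e).symm (x - z)).1 - ((frameMap e).symm (x - z)).2

theorem depth_add_frameMap (q : E3 × ℝ) : depth z e ψ (z + frameMap e q) = ψ q.1 - q.2 := by
  simp [depth]

theorem contDiffOn_depth (h : IsGraphChart Ω z e ψ r ε) :
    ContDiffOn ℝ 1 (depth z e ψ) (chartBox z e r) := by
  have hc : ContDiff ℝ 1 fun x => (frameMap e).symm (x - z) :=
    (frameMap e).symm.contDiff.comp (contDiff_id.sub contDiff_const)
  exact (h.contDiffOn.comp (contDiff_fst.comp hc).contDiffOn fun x hx => hx.1).sub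
    (contDiff_snd.comp hc).contDiffOn

theorem fderiv_depth (h : IsGraphChart Ω z e ψ r ε) {x : E4} (hx : x ∈ chartBox z e r) (v : E4) :
    fderiv ℝ (depth z e ψ) x v
      = -inner ℝ (graphNormal e ψ ((frameMap e).symm (x - z)).1) v := by
  have hc : HasFDerivAt (fun x => (frameMap e).symm (x - z))
      ((frameMap e).symm : E4 →L[ℝ] E3 × ℝ) x :=
    (frameMap e).symm.hasFDerivAt.comp x ((hasFDerivAt_id x).sub_const z)
  have hψ : DifferentiableAt ℝ ψ ((frameMap e).symm (x - z)).1 :=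
    (h.contDiffOn.contDiffAt (Metric.isOpen_ball.mem_nhds hx.1)).differentiableAt one_ne_zero
  have h1 := (hψ.hasFDerivAt.comp x hc.fst).sub hc.snd
  have h2 : depth z e ψ = (ψ ∘ fun x => ((frameMap e).symm (x - z)).1)
      - fun x => ((frameMap e).symm (x - z)).2 := rfl
  rw [h2, h1.fderiv]
  obtain ⟨q, rfl⟩ := (frameMap e).surjective v
  rw [inner_graphNormal]
  simp

/-- The divergence theorem for fields supported in the domain of a chart, with the boundary integral
expressed in the parameters. -/
theorem integral_eq_integral_ball (h : IsGraphChart Ω z e ψ r ε) (hε : 0 ≤ ε) (hΩ : IsOpen Ω)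
    {V : E4 → E4} {g χ : E4 → ℝ} (hV : Continuous V) (hW : IsWeakDiv Ω V g)
    (hg : IntegrableOn g Ω) (hχ : ContDiff ℝ 1 χ) (hχc : HasCompactSupport χ)
    (hχs : tsupport χ ⊆ chartBox z e r) :
    ∫ x in Ω, (χ x * g x + fderiv ℝ χ x (V x)) = ∫ y in Metric.ball (0 : E3) r,
      χ (z + frameMap e (y, ψ y)) * inner ℝ (graphNormal e ψ y) (V (z + frameMap e (y, ψ y))) := by
  set T := Real.smoothTransition with hT
  set D := depth z e ψ with hD
  set U := chartBox z e r with hU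
  have hUo : IsOpen U := isOpen_chartBox z e r
  have hDc : ContDiffOn ℝ 1 D U := h.contDiffOn_depth
  have hχ0 : ∀ x, x ∉ U → χ x = 0 ∧ fderiv ℝ χ x = 0 := fun x hx =>
    ⟨image_eq_zero_of_notMem_tsupport fun h' => hx (hχs h'),
      fderiv_of_notMem_tsupport ℝ fun h' => hx (hχs h')⟩
  have hDΩ : ∀ x ∈ U, (x ∈ Ω ↔ 0 < D x) := by
    intro x hx
    obtain ⟨q, rfl⟩ := exists_eq_add_frameMap z e x
    obtain ⟨h1, h2⟩ := add_frameMap_mem_chartBox.1 hx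
    rw [hD, depth_add_frameMap, sub_pos]
    exact h.mem_iff q.1 h1 q.2 h2
  -- the cutoff that vanishes at depth less than `δ`
  set H : ℝ → E4 → ℝ := fun δ x => T (D x / δ - 1) with hH
  have hHc : ∀ δ, ContDiffOn ℝ 1 (H δ) U := fun δ =>
    contDiff_smoothTransition_one.comp_contDiffOn ((hDc.div_const δ).sub contDiffOn_const)
  have hH0 : ∀ δ > 0, ∀ x ∈ U, x ∉ Ω → H δ x = 0 := fun δ hδ x hx hxΩ => by
    have : D x ≤ 0 := not_lt.1 fun hpos => hxΩ ((hDΩ x hx).2 hpos)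
    exact Real.smoothTransition.zero_of_nonpos (by
      have := div_nonpos_of_nonpos_of_nonneg this hδ.le; linarith)
  set N : E4 → E4 := fun x => graphNormal e ψ ((frameMap e).symm (x - z)).1 with hN
  have hNc : ContinuousOn N U := h.continuousOn_graphNormal.comp
    (by fun_prop : Continuous fun x => ((frameMap e).symm (x - z)).1).continuousOn fun x hx => hx.1
  set k : ℝ → E4 → ℝ := fun δ x =>
    χ x * (inner ℝ (N x) (V x) * (deriv T (D x / δ - 1) / δ)) with hk
  have hkc : ∀ δ, Continuous (k δ) := fun δ => by
    refine continuous_of_continuousOn_of_tsupport_subset hUo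
      (hχ.continuous.continuousOn.mul ((hNc.inner hV.continuousOn).mul ?_))
      (tsupport_mul_subset_left.trans hχs)
    exact ((continuous_deriv_smoothTransition.comp_continuousOn
      ((hDc.continuousOn.div_const δ).sub continuousOn_const))).div_const δ
  have hks : ∀ δ, HasCompactSupport (k δ) := fun δ => hχc.mul_right
  have hki : ∀ δ, Integrable (k δ) := fun δ =>
    (hkc δ).integrable_of_hasCompactSupport (hks δ)
  have hmain : ∀ δ > 0, ∫ x in Ω, H δ x * (χ x * g x + fderiv ℝ χ x (V x)) = ∫ x, k δ x := by
    intro δ hδ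
    set η : E4 → ℝ := fun x => χ x * H δ x with hη
    have hηs : tsupport η ⊆ tsupport χ := tsupport_mul_subset_left
    have hηd : ContDiff ℝ 1 η := contDiff_of_contDiffOn_of_tsupport_subset hUo
      (hχ.contDiffOn.mul (hHc δ)) (hηs.trans hχs)
    have hηc : HasCompactSupport η := hχc.mul_right
    have hηΩ : tsupport η ⊆ Ω := by
      have hcl : IsClosed (tsupport χ ∩ D ⁻¹' Ici δ) :=
        (hDc.continuousOn.mono hχs).preimage_isClosed_of_isClosed isClosed_closure isClosed_Ici
      refine (closure_minimal (fun x hx => ?_) hcl).trans fun x hx => ?_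
      · have hxχ : x ∈ tsupport χ := hηs (subset_closure hx)
        refine ⟨hxχ, ?_⟩
        by_contra hlt
        refine hx ?_
        have : H δ x = 0 := Real.smoothTransition.zero_of_nonpos (by
          have : D x / δ < 1 := (div_lt_one hδ).2 (not_le.1 hlt)
          linarith)
        simp [hη, this]
      · exact (hDΩ x (hχs hx.1)).2 (hδ.trans_le hx.2)
    have h0 := hW.integral_eq_zero η hηd hηc hηΩ
    obtain ⟨i1, i2⟩ := integrable_test_pairing hΩ hW.1 hW.2 hηd hηc hηΩ
    have hpt : ∀ x, η x * g x + fderiv ℝ η x (V x) + k δ x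
        = H δ x * (χ x * g x + fderiv ℝ χ x (V x)) := by
      intro x
      by_cases hx : x ∈ U
      · have hHd : HasFDerivAt (H δ) (deriv T (D x / δ - 1) • ((δ⁻¹ : ℝ) • fderiv ℝ D x)) x := by
          have d1 := ((hDc.contDiffAt (hUo.mem_nhds hx)).differentiableAt one_ne_zero).hasFDerivAt
          have d2 : HasFDerivAt (fun x => D x / δ - 1) ((δ⁻¹ : ℝ) • fderiv ℝ D x) x := by
            simp only [div_eq_mul_inv]
            exact (d1.mul_const δ⁻¹).sub_const 1
          exact ((contDiff_smoothTransition_one.differentiable one_ne_zero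
            _).hasDerivAt).comp_hasFDerivAt x d2
        rw [hη, ((hχ.differentiable one_ne_zero x).hasFDerivAt.fun_mul hHd).fderiv]
        simp only [add_apply, smul_apply, smul_eq_mul, hk, hN]
        rw [h.fderiv_depth hx]
        ring
      · obtain ⟨a1, a2⟩ := hχ0 x hx
        have a3 : fderiv ℝ η x = 0 := fderiv_of_notMem_tsupport ℝ fun h' => hx (hχs (hηs h'))
        have a4 : η x = 0 := by simp only [hη, a1, zero_mul]
        have a5 : k δ x = 0 := by simp only [hk, a1, zero_mul]
        rw [a3, a4, a5, a1, a2]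
        simp
    have h1 : ∫ x, (η x * g x + fderiv ℝ η x (V x) + k δ x) = ∫ x, k δ x := by
      have := integral_add (i1.add i2) (hki δ)
      simp only [Pi.add_apply] at this
      rw [this, h0, zero_add]
    rw [← h1]
    simp only [hpt]
    refine setIntegral_eq_integral_of_forall_compl_eq_zero fun x hx => ?_
    by_cases hxU : x ∈ U
    · rw [hH0 δ hδ x hxU hx, zero_mul]
    · obtain ⟨a1, a2⟩ := hχ0 x hxU
      simp [a1, a2]
  -- Fubini in the coordinates of the chart
  have hfub : ∀ δ, ∫ x, k δ x = ∫ y in Metric.ball (0 : E3) r,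
      ∫ t : ℝ, k δ (z + frameMap e (y, t)) := by
    intro δ
    have hmp := measurePreserving_add_frameMap z e
    have hemb : MeasurableEmbedding fun q : E3 × ℝ => z + frameMap e q :=
      ((frameMap e).toHomeomorph.trans (Homeomorph.addLeft z)).measurableEmbedding
    have hi : Integrable (fun q : E3 × ℝ => k δ (z + frameMap e q)) (volume.prod volume) :=
      (hmp.integrable_comp_emb hemb).2 (hki δ)
    rw [← hmp.integral_comp hemb, Measure.volume_eq_prod, integral_prod _ hi]
    refine (setIntegral_eq_integral_of_forall_compl_eq_zero fun y hy => ?_).symm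
    have : ∀ t : ℝ, k δ (z + frameMap e (y, t)) = 0 := fun t => by
      have : z + frameMap e (y, t) ∉ U := fun hm => hy (add_frameMap_mem_chartBox.1 hm).1
      simp [hk, (hχ0 _ this).1]
    simp [this]
  obtain ⟨C, hC⟩ := (hχ.continuous.smul hV).bounded_above_of_compact_support
    (hχc.smul_right (f' := V))
  have hC0 : 0 ≤ C := (norm_nonneg _).trans (hC 0)
  set w : E3 → ℝ → ℝ := fun y t =>
    χ (z + frameMap e (y, t)) * inner ℝ (graphNormal e ψ y) (V (z + frameMap e (y, t))) with hw
  have hwb : ∀ y ∈ Metric.ball (0 : E3) r, ∀ t, |w y t| ≤ (1 + ε) * C := by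
    intro y hy t
    have h1 : w y t = inner ℝ (graphNormal e ψ y)
        (χ (z + frameMap e (y, t)) • V (z + frameMap e (y, t))) := by
      rw [inner_smul_right]
    rw [h1]
    exact (abs_real_inner_le_norm _ _).trans (mul_le_mul (h.norm_graphNormal_mem hε hy).2 (hC _)
      (norm_nonneg _) (by linarith))
  have hwc : ∀ y, Continuous (w y) := fun y => by
    have hp : Continuous fun t : ℝ => z + frameMap e (y, t) := by fun_prop
    exact (hχ.continuous.comp hp).mul (continuous_const.inner (hV.comp hp))
  have hkw : ∀ δ y t, k δ (z + frameMap e (y, t))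
      = w y t * (deriv T ((ψ y - t) / δ - 1) / δ) := fun δ y t => by
    simp only [hk, hw, hN, hD, depth_add_frameMap, add_sub_cancel_left,
      ContinuousLinearEquiv.symm_apply_apply]
    ring
  have hR : Tendsto (fun δ : ℝ => ∫ x, k δ x) (𝓝[>] 0)
      (𝓝 (∫ y in Metric.ball (0 : E3) r, w y (ψ y))) := by
    simp only [hfub]
    refine tendsto_integral_filter_of_dominated_convergence
      (fun _ => (1 + ε) * C * ∫ s, ‖deriv T s‖) ?_ ?_ ?_ ?_
    · refine Eventually.of_forall fun δ => ?_
      have hmp := measurePreserving_add_frameMap z e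
      have hemb : MeasurableEmbedding fun q : E3 × ℝ => z + frameMap e q :=
        ((frameMap e).toHomeomorph.trans (Homeomorph.addLeft z)).measurableEmbedding
      have hi : Integrable (fun q : E3 × ℝ => k δ (z + frameMap e q)) (volume.prod volume) :=
        (hmp.integrable_comp_emb hemb).2 (hki δ)
      exact hi.integral_prod_left.aestronglyMeasurable.restrict
    · filter_upwards [self_mem_nhdsWithin] with δ hδ
      refine (ae_restrict_mem Metric.isOpen_ball.measurableSet).mono fun y hy => ?_
      simp only [hkw]
      exact abs_integral_mul_kernel_le (hwb y hy) _ hδ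
    · exact integrableOn_const measure_ball_lt_top.ne
    · refine (ae_restrict_mem Metric.isOpen_ball.measurableSet).mono fun y hy => ?_
      simp only [hkw]
      exact tendsto_integral_mul_kernel (hwc y) (hwb y hy) (ψ y)
  have hgi : IntegrableOn (fun x => χ x * g x + fderiv ℝ χ x (V x)) Ω :=
    integrableOn_test_pairing hV hg hχ hχc
  have hL : Tendsto (fun δ : ℝ => ∫ x in Ω, H δ x * (χ x * g x + fderiv ℝ χ x (V x))) (𝓝[>] 0)
      (𝓝 (∫ x in Ω, (χ x * g x + fderiv ℝ χ x (V x)))) := by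
    refine tendsto_integral_filter_of_dominated_convergence
      (fun x => ‖χ x * g x + fderiv ℝ χ x (V x)‖) ?_ ?_ hgi.norm ?_
    · filter_upwards [self_mem_nhdsWithin] with δ hδ
      have e1 : ∀ x, H δ x * (χ x * g x + fderiv ℝ χ x (V x))
          = U.indicator (H δ) x * (χ x * g x + fderiv ℝ χ x (V x)) := fun x => by
        by_cases hx : x ∈ U
        · rw [indicator_of_mem hx]
        · simp [hχ0 x hx]
      simp only [e1]
      refine AEStronglyMeasurable.mul ?_ hgi.1
      exact ((aestronglyMeasurable_indicator_iff hUo.measurableSet).2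
        ((hHc δ).continuousOn.aestronglyMeasurable hUo.measurableSet)).restrict
    · refine Eventually.of_forall fun δ => ae_of_all _ fun x => ?_
      rw [norm_mul]
      refine mul_le_of_le_one_left (norm_nonneg _) ?_
      rw [Real.norm_of_nonneg (Real.smoothTransition.nonneg _)]
      exact Real.smoothTransition.le_one _
    · refine (ae_restrict_mem hΩ.measurableSet).mono fun x hx => ?_
      by_cases hxU : x ∈ U
      · have hpos := (hDΩ x hxU).1 hx
        refine tendsto_const_nhds.congr' ?_
        filter_upwards [Ioc_mem_nhdsGT (show 0 < D x / 2 by linarith)] with δ hδ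
        have : H δ x = 1 := Real.smoothTransition.one_of_one_le (by
          have : 2 ≤ D x / δ := by rw [le_div_iff₀ hδ.1]; linarith [hδ.2]
          linarith)
        rw [this, one_mul]
      · simp [hχ0 x hxU]
  refine tendsto_nhds_unique (hL.congr' ?_) hR
  filter_upwards [self_mem_nhdsWithin] with δ hδ using hmain δ hδ

end IsGraphChart

/-! ### The divergence theorem away from the singular part of the boundary -/

theorem IsGraphChart.frontier_inter_chartBox_subset {Ω : Set E4} {z : E4}
    {e : WithLp 2 (E3 × ℝ) ≃ₗᵢ[ℝ] E4} {ψ : E3 → ℝ} {r ε : ℝ} (h : IsGraphChart Ω z e ψ r ε)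
    (hΩ : IsOpen Ω) : frontier Ω ∩ chartBox z e r ⊆ regularBoundary 2 Ω := by
  rintro x ⟨hx, hb⟩
  obtain ⟨⟨y, t⟩, rfl⟩ := exists_eq_add_frameMap z e x
  obtain ⟨h1, h2⟩ := add_frameMap_mem_chartBox.1 hb
  have h3 : t = ψ y := (h.mem_frontier_iff hΩ h1 h2).1 hx
  subst h3
  exact ⟨hx, h.exists_defining y h1⟩

theorem euclideanHausdorffMeasure_lt_top_of_isCompact {Ω K : Set E4} (hΩ : IsOpen Ω)
    (hK : IsCompact K) (hKr : K ⊆ regularBoundary 2 Ω) : (μHE[3] : Measure E4) K < ⊤ := by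
  refine hK.measure_lt_top_of_nhdsWithin fun z hz => ?_
  obtain ⟨-, φ, hφ⟩ := hKr hz
  obtain ⟨e, ψ, r, h, -⟩ := exists_isGraphChart hφ one_pos
  exact ⟨frontier Ω ∩ chartBox z e r, mem_nhdsWithin.2 ⟨chartBox z e r, isOpen_chartBox z e r,
    h.self_mem_chartBox, fun x hx => ⟨(hKr hx.2).1, hx.1⟩⟩,
    h.frontier_inter_chartBox_lt_top hΩ zero_le_one⟩

/-- Compact parts of the regular boundary have finite area, so that bounded functions living there
are integrable. -/
theorem integrableOn_frontier_of_tsupport {Ω : Set E4} (hΩ : IsOpen Ω) {G : E4 → ℝ}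
    (hG : ContinuousOn G (regularBoundary 2 Ω)) {B : ℝ} (hB : ∀ x ∈ frontier Ω, |G x| ≤ B)
    {K : Set E4} (hK : IsCompact K) (hKr : frontier Ω ∩ K ⊆ regularBoundary 2 Ω)
    (h0 : ∀ x ∉ K, G x = 0) : IntegrableOn G (frontier Ω) μHE[3] := by
  have hfm : MeasurableSet (frontier Ω) := isClosed_frontier.measurableSet
  have hKm : MeasurableSet (frontier Ω ∩ K) := hfm.inter hK.measurableSet
  have h1 : IntegrableOn G (frontier Ω ∩ K) μHE[3] := by
    refine IntegrableOn.of_bound (C := B) (euclideanHausdorffMeasure_lt_top_of_isCompact hΩ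
      (hK.inter_left isClosed_frontier) hKr) ((hG.mono hKr).aestronglyMeasurable hKm) ?_
    exact (ae_restrict_mem hKm).mono fun x hx => hB x hx.1
  exact h1.of_forall_sdiff_eq_zero hfm fun x hx => h0 x fun hxK => hx.2 ⟨hx.1, hxK⟩

section Flux

variable {Ω : Set E4} {V : E4 → E4} {χ : E4 → ℝ}

theorem integrableOn_flux (hΩ : IsOpen Ω) (hV : Continuous V) (hχ : Continuous χ)
    (hχc : HasCompactSupport χ) (hχr : frontier Ω ∩ tsupport χ ⊆ regularBoundary 2 Ω) :
    IntegrableOn (fun x => χ x * inner ℝ (outwardNormal Ω x) (V x)) (frontier Ω) μHE[3] ∧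
      IntegrableOn (fun x => |χ x| * ‖V x‖) (frontier Ω) μHE[3] := by
  obtain ⟨C, hC⟩ := (hχ.smul hV).bounded_above_of_compact_support (hχc.smul_right (f' := V))
  have hC0 : 0 ≤ C := (norm_nonneg _).trans (hC 0)
  have hC' : ∀ x, |χ x| * ‖V x‖ ≤ C := fun x => by rw [← Real.norm_eq_abs, ← norm_smul]; exact hC x
  have h0 : ∀ x ∉ tsupport χ, χ x = 0 := fun x hx => image_eq_zero_of_notMem_tsupport hx
  constructor
  · refine integrableOn_frontier_of_tsupport hΩ (hχ.continuousOn.mul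
      ((continuousOn_outwardNormal hΩ).inner hV.continuousOn)) (B := C) (fun x hx => ?_) hχc hχr
      fun x hx => by rw [h0 x hx, zero_mul]
    by_cases hxr : x ∈ tsupport χ
    · rw [abs_mul]
      refine (mul_le_mul_of_nonneg_left (abs_real_inner_le_norm _ _) (abs_nonneg _)).trans ?_
      rw [norm_outwardNormal (hχr ⟨hx, hxr⟩), one_mul]
      exact hC' x
    · rw [h0 x hxr, zero_mul, abs_zero]; exact hC0
  · refine integrableOn_frontier_of_tsupport hΩ (hχ.abs.mul hV.norm).continuousOn (B := C)
      (fun x hx => ?_) hχc hχr fun x hx => by rw [h0 x hx, abs_zero, zero_mul]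
    rw [abs_of_nonneg (by positivity)]
    exact hC' x

/-- In a chart of slope at most `ε` the divergence theorem holds up to a relative error `8 ε`:
both the normal `(-∇ψ, 1)` and the area element differ from their values for a flat boundary by
that order. -/
theorem IsGraphChart.abs_flux_sub_le {z : E4} {e : WithLp 2 (E3 × ℝ) ≃ₗᵢ[ℝ] E4} {ψ : E3 → ℝ}
    {r ε : ℝ} {g : E4 → ℝ} (h : IsGraphChart Ω z e ψ r ε) (hε : 0 ≤ ε) (hε1 : ε ≤ 1)
    (hΩ : IsOpen Ω) (hV : Continuous V) (hW : IsWeakDiv Ω V g) (hg : IntegrableOn g Ω)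
    (hχ : ContDiff ℝ 1 χ) (hχc : HasCompactSupport χ) (hχs : tsupport χ ⊆ chartBox z e r) :
    |(∫ x in Ω, (χ x * g x + fderiv ℝ χ x (V x)))
        - ∫ x in frontier Ω, χ x * inner ℝ (outwardNormal Ω x) (V x) ∂μHE[3]|
      ≤ 8 * ε * ∫ x in frontier Ω, |χ x| * ‖V x‖ ∂μHE[3] := by
  have hfm : MeasurableSet (frontier Ω) := isClosed_frontier.measurableSet
  have hχr : frontier Ω ∩ tsupport χ ⊆ regularBoundary 2 Ω := fun x hx =>
    h.frontier_inter_chartBox_subset hΩ ⟨hx.1, hχs hx.2⟩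
  have h0 : ∀ x ∉ chartBox z e r, χ x = 0 := fun x hx =>
    image_eq_zero_of_notMem_tsupport fun h' => hx (hχs h')
  obtain ⟨i1, i2⟩ := integrableOn_flux hΩ hV hχ.continuous hχc hχr
  have r1 := setIntegral_eq_of_subset_of_forall_sdiff_eq_zero (μ := (μHE[3] : Measure E4)) hfm
    (inter_subset_left (t := chartBox z e r))
    (f := fun x => χ x * inner ℝ (outwardNormal Ω x) (V x))
    fun x hx => by rw [h0 x fun hb => hx.2 ⟨hx.1, hb⟩, zero_mul]
  have r2 := setIntegral_eq_of_subset_of_forall_sdiff_eq_zero (μ := (μHE[3] : Measure E4)) hfm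
    (inter_subset_left (t := chartBox z e r)) (f := fun x => |χ x| * ‖V x‖)
    fun x hx => by rw [h0 x fun hb => hx.2 ⟨hx.1, hb⟩, abs_zero, zero_mul]
  rw [r1, r2, h.integral_eq_integral_ball hε hΩ hV hW hg hχ hχc hχs]
  have j1 := i1.mono_set (inter_subset_left (t := chartBox z e r))
  have j2 := i2.mono_set (inter_subset_left (t := chartBox z e r))
  set σ := (μHE[3] : Measure E4).restrict (frontier Ω ∩ chartBox z e r) with hσ
  set μ := parameterMeasure z e ψ r with hμ
  have hle : μ ≤ σ := h.parameterMeasure_le hΩ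
  have k1 : Integrable (fun x => χ x * inner ℝ (outwardNormal Ω x) (V x)) μ :=
    Integrable.mono_measure j1 hle
  have k2 : Integrable (fun x => |χ x| * ‖V x‖) μ := Integrable.mono_measure j2 hle
  have hC : σ ≤ ENNReal.ofReal (1 + 7 * ε) • μ := by
    refine (h.le_smul_parameterMeasure hΩ hε).trans (Measure.le_iff.2 fun S _ => ?_)
    simp only [Measure.smul_apply, smul_eq_mul]
    gcongr
    nlinarith [mul_nonneg hε (sub_nonneg.2 hε1), mul_nonneg (mul_nonneg hε hε) (sub_nonneg.2 hε1)]
  have e1 := (abs_integral_sub_le_of_measure_le (by positivity) hle hC k1).2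
  have e2 : ∫ x, |χ x * inner ℝ (outwardNormal Ω x) (V x)| ∂μ ≤ ∫ x, |χ x| * ‖V x‖ ∂μ := by
    refine integral_mono_ae k1.abs k2 ?_
    have : ∀ᵐ x ∂σ, |χ x * inner ℝ (outwardNormal Ω x) (V x)| ≤ |χ x| * ‖V x‖ := by
      refine (ae_restrict_mem (hfm.inter (isOpen_chartBox z e r).measurableSet)).mono fun x hx => ?_
      rw [abs_mul]
      refine mul_le_mul_of_nonneg_left ((abs_real_inner_le_norm _ _).trans_eq ?_) (abs_nonneg _)
      rw [norm_outwardNormal (h.frontier_inter_chartBox_subset hΩ hx), one_mul]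
    exact (Measure.absolutelyContinuous_of_le hle).ae_le this
  have e3 : ∫ x, |χ x| * ‖V x‖ ∂μ ≤ ∫ x, |χ x| * ‖V x‖ ∂σ :=
    integral_mono_measure hle (ae_of_all _ fun x => by positivity) j2
  have p1 := integral_map h.aemeasurable_graph k1.1
  have p2 := integral_map h.aemeasurable_graph k2.1
  have q1 := k1.comp_aemeasurable h.aemeasurable_graph
  have q2 := k2.comp_aemeasurable h.aemeasurable_graph
  simp only [Function.comp_def] at q1 q2
  have e4 : |(∫ y in Metric.ball (0 : E3) r, χ (z + frameMap e (y, ψ y))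
        * inner ℝ (graphNormal e ψ y) (V (z + frameMap e (y, ψ y))))
      - ∫ x, χ x * inner ℝ (outwardNormal Ω x) (V x) ∂μ| ≤ ε * ∫ x, |χ x| * ‖V x‖ ∂μ := by
    have hpt : ∀ y ∈ Metric.ball (0 : E3) r,
        ‖χ (z + frameMap e (y, ψ y)) * inner ℝ (graphNormal e ψ y) (V (z + frameMap e (y, ψ y)))
          - χ (z + frameMap e (y, ψ y)) * inner ℝ (outwardNormal Ω (z + frameMap e (y, ψ y)))
            (V (z + frameMap e (y, ψ y)))‖
        ≤ ε * (|χ (z + frameMap e (y, ψ y))| * ‖V (z + frameMap e (y, ψ y))‖) := by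
      intro y hy
      obtain ⟨n1, n2⟩ := h.norm_graphNormal_mem hε hy
      rw [← mul_sub, ← inner_sub_left, norm_mul, Real.norm_eq_abs, mul_left_comm]
      refine mul_le_mul_of_nonneg_left ((norm_inner_le_norm _ _).trans
        (mul_le_mul_of_nonneg_right ?_ (norm_nonneg _))) (abs_nonneg _)
      rw [h.outwardNormal_eq y hy]
      have : graphNormal e ψ y - ‖graphNormal e ψ y‖⁻¹ • graphNormal e ψ y
          = (1 - ‖graphNormal e ψ y‖⁻¹) • graphNormal e ψ y := by rw [sub_smul, one_smul]
      have hpos : 0 < ‖graphNormal e ψ y‖ := by linarith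
      have hle1 : ‖graphNormal e ψ y‖⁻¹ ≤ 1 := inv_le_one_of_one_le₀ n1
      rw [this, norm_smul, Real.norm_of_nonneg (by linarith), sub_mul, inv_mul_cancel₀ hpos.ne']
      linarith
    have hball : MeasurableSet (Metric.ball (0 : E3) r) := Metric.isOpen_ball.measurableSet
    have q3 : Integrable (fun y => χ (z + frameMap e (y, ψ y))
        * inner ℝ (graphNormal e ψ y) (V (z + frameMap e (y, ψ y))))
        (volume.restrict (Metric.ball (0 : E3) r)) := by
      have hm : AEStronglyMeasurable (fun y => χ (z + frameMap e (y, ψ y))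
          * inner ℝ (graphNormal e ψ y) (V (z + frameMap e (y, ψ y))))
          (volume.restrict (Metric.ball (0 : E3) r)) := by
        refine ContinuousOn.aestronglyMeasurable ?_ hball
        exact (hχ.continuous.comp_continuousOn h.continuousOn_graph).mul
          (h.continuousOn_graphNormal.inner (hV.comp_continuousOn h.continuousOn_graph))
      refine (q2.const_mul (1 + ε)).mono' hm ?_
      refine (ae_restrict_mem hball).mono fun y hy => ?_
      rw [norm_mul, Real.norm_eq_abs]
      rw [mul_left_comm]
      exact mul_le_mul_of_nonneg_left ((norm_inner_le_norm _ _).trans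
        (mul_le_mul_of_nonneg_right (h.norm_graphNormal_mem hε hy).2 (norm_nonneg _)))
        (abs_nonneg _)
    rw [hμ, parameterMeasure, p1, p2, ← integral_sub q3 q1, ← integral_const_mul,
      ← Real.norm_eq_abs]
    exact norm_integral_le_of_norm_le (q2.const_mul ε) ((ae_restrict_mem hball).mono hpt)
  rw [abs_le] at *
  have e5 := mul_le_mul_of_nonneg_left e2 (show 0 ≤ 7 * ε by positivity)
  have e6 := mul_le_mul_of_nonneg_left e3 (show 0 ≤ 8 * ε by positivity)
  constructor <;> linarith [e1.1, e1.2, e4.1, e4.2]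

theorem integral_eq_flux_of_tsupport_subset_or {g : E4 → ℝ} (hΩ : IsOpen Ω)
    (hW : IsWeakDiv Ω V g) (hχ : ContDiff ℝ 1 χ) (hχc : HasCompactSupport χ)
    (hχs : tsupport χ ⊆ Ω ∨ tsupport χ ⊆ (closure Ω)ᶜ) :
    ∫ x in Ω, (χ x * g x + fderiv ℝ χ x (V x))
      = ∫ x in frontier Ω, χ x * inner ℝ (outwardNormal Ω x) (V x) ∂μHE[3] := by
  have h0 : ∀ x ∉ tsupport χ, χ x = 0 := fun x hx => image_eq_zero_of_notMem_tsupport hx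
  have hb : ∫ x in frontier Ω, χ x * inner ℝ (outwardNormal Ω x) (V x) ∂μHE[3] = 0 := by
    refine setIntegral_eq_zero_of_forall_eq_zero fun x hx => ?_
    rw [h0 x, zero_mul]
    intro hxs
    rcases hχs with h | h
    · rw [hΩ.frontier_eq] at hx
      exact hx.2 (h hxs)
    · exact h hxs hx.1
  rw [hb]
  rcases hχs with h | h
  · rw [← hW.3 χ hχ hχc h]
    refine setIntegral_eq_integral_of_forall_compl_eq_zero fun x hx => ?_
    have hx' : x ∉ tsupport χ := fun h' => hx (h h')
    simp [fderiv_of_notMem_tsupport ℝ hx', h0 x hx']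
  · refine setIntegral_eq_zero_of_forall_eq_zero fun x hx => ?_
    have hx' : x ∉ tsupport χ := fun h' => h h' (subset_closure hx)
    simp [fderiv_of_notMem_tsupport ℝ hx', h0 x hx']

theorem exists_smooth_partition_of_isCompact {E : Type*} [NormedAddCommGroup E]
    [InnerProductSpace ℝ E] [FiniteDimensional ℝ E] {K : Set E} (hK : IsCompact K)
    {U : E → Set E} (hU : ∀ x ∈ K, IsOpen (U x)) (hmem : ∀ x ∈ K, x ∈ U x) :
    ∃ (t : Finset K) (f : t → E → ℝ), (∀ i, ContDiff ℝ ∞ (f i)) ∧ (∀ i x, 0 ≤ f i x) ∧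
      (∀ i, tsupport (f i) ⊆ U i) ∧ (∀ x ∈ K, ∑ i, f i x = 1) ∧ ∀ x, ∑ i, f i x ≤ 1 := by
  obtain ⟨t, ht⟩ := hK.elim_finite_subcover (fun x : K => U x) (fun x => hU x x.2)
    fun x hx => mem_iUnion.2 ⟨⟨x, hx⟩, hmem x hx⟩
  obtain ⟨f, hf⟩ := SmoothPartitionOfUnity.exists_isSubordinate (modelWithCornersSelf ℝ E)
    hK.isClosed (fun i : t => U i) (fun i => hU _ i.1.2)
    (fun x hx => by
      obtain ⟨i, hi⟩ := mem_iUnion.1 (ht hx)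
      obtain ⟨hi', hx'⟩ := mem_iUnion.1 hi
      exact mem_iUnion.2 ⟨⟨i, hi'⟩, hx'⟩)
  refine ⟨t, fun i => f i, fun i => (f i).contMDiff.contDiff, fun i x => f.nonneg i x, hf,
    fun x hx => ?_, fun x => ?_⟩
  · rw [← finsum_eq_sum_of_fintype]; exact f.sum_eq_one hx
  · rw [← finsum_eq_sum_of_fintype]; exact f.sum_le_one x

/-- The divergence theorem against test functions that stay away from the singular part of the
boundary. Around each point there is a chart of slope at most `ε`, in which the identity holds up to
`8ε ∫ |χ| ‖V‖`; the errors add up along a partition of unity to a multiple of `ε`. -/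
theorem integral_eq_flux {g : E4 → ℝ} (hΩ : IsOpen Ω) (hV : Continuous V) (hW : IsWeakDiv Ω V g)
    (hg : IntegrableOn g Ω) (hχ : ContDiff ℝ 1 χ) (hχc : HasCompactSupport χ)
    (hχr : frontier Ω ∩ tsupport χ ⊆ regularBoundary 2 Ω) :
    ∫ x in Ω, (χ x * g x + fderiv ℝ χ x (V x))
      = ∫ x in frontier Ω, χ x * inner ℝ (outwardNormal Ω x) (V x) ∂μHE[3] := by
  set M := ∫ x in frontier Ω, |χ x| * ‖V x‖ ∂μHE[3] with hM
  suffices hε : ∀ ε : ℝ, 0 < ε → ε ≤ 1 → |(∫ x in Ω, (χ x * g x + fderiv ℝ χ x (V x)))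
      - ∫ x in frontier Ω, χ x * inner ℝ (outwardNormal Ω x) (V x) ∂μHE[3]| ≤ 8 * ε * M by
    rw [← sub_eq_zero, ← abs_nonpos_iff]
    have hlim : Tendsto (fun ε : ℝ => 8 * ε * M) (𝓝[>] 0) (𝓝 0) := by
      have : Continuous fun ε : ℝ => 8 * ε * M := by fun_prop
      have := this.tendsto 0
      simp only [mul_zero, zero_mul] at this
      exact this.mono_left nhdsWithin_le_nhds
    refine ge_of_tendsto hlim ?_
    filter_upwards [Ioc_mem_nhdsGT one_pos] with ε h using hε ε h.1 h.2
  intro ε hε hε1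
  have hcov : ∀ x ∈ tsupport χ, ∃ U : Set E4, IsOpen U ∧ x ∈ U ∧ ∀ η : E4 → ℝ, ContDiff ℝ 1 η →
      HasCompactSupport η → tsupport η ⊆ U →
      |(∫ x in Ω, (η x * g x + fderiv ℝ η x (V x)))
        - ∫ x in frontier Ω, η x * inner ℝ (outwardNormal Ω x) (V x) ∂μHE[3]|
      ≤ 8 * ε * ∫ x in frontier Ω, |η x| * ‖V x‖ ∂μHE[3] := by
    intro x hx
    have hpos : ∀ η : E4 → ℝ, 0 ≤ 8 * ε * ∫ x in frontier Ω, |η x| * ‖V x‖ ∂μHE[3] := fun η =>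
      mul_nonneg (by positivity) (integral_nonneg fun x => by positivity)
    by_cases h1 : x ∈ Ω
    · refine ⟨Ω, hΩ, h1, fun η a b c => ?_⟩
      rw [integral_eq_flux_of_tsupport_subset_or hΩ hW a b (Or.inl c), sub_self, abs_zero]
      exact hpos η
    by_cases h2 : x ∈ closure Ω
    · obtain ⟨-, φ, hφ⟩ := hχr ⟨by rw [hΩ.frontier_eq]; exact ⟨h2, h1⟩, hx⟩
      obtain ⟨e, ψ, r, h, -⟩ := exists_isGraphChart hφ hε
      exact ⟨chartBox x e r, isOpen_chartBox x e r, h.self_mem_chartBox, fun η a b c =>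
        h.abs_flux_sub_le hε.le hε1 hΩ hV hW hg a b c⟩
    · refine ⟨(closure Ω)ᶜ, isClosed_closure.isOpen_compl, h2, fun η a b c => ?_⟩
      rw [integral_eq_flux_of_tsupport_subset_or hΩ hW a b (Or.inr c), sub_self, abs_zero]
      exact hpos η
  choose! U hUo hUm hU using hcov
  obtain ⟨t, f, hf, hf0, hfs, hf1, -⟩ := exists_smooth_partition_of_isCompact
    (K := tsupport χ) hχc hUo hUm
  have hf' : ∀ i, ContDiff ℝ 1 (f i) := fun i => (hf i).of_le (by simp)
  have hd : ∀ i, ContDiff ℝ 1 fun x => f i x * χ x := fun i => (hf' i).mul hχ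
  have hc : ∀ i, HasCompactSupport fun x => f i x * χ x := fun i => hχc.mul_left
  have hs1 : ∀ i, tsupport (fun x => f i x * χ x) ⊆ tsupport χ := fun i =>
    tsupport_mul_subset_right
  have hs2 : ∀ i, tsupport (fun x => f i x * χ x) ⊆ U i := fun i =>
    tsupport_mul_subset_left.trans (hfs i)
  have hr : ∀ i, frontier Ω ∩ tsupport (fun x => f i x * χ x) ⊆ regularBoundary 2 Ω := fun i =>
    (inter_subset_inter_right _ (hs1 i)).trans hχr
  have hsum : ∀ x, χ x = ∑ i, f i x * χ x := fun x => by
    rw [← Finset.sum_mul]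
    by_cases hx : x ∈ tsupport χ
    · rw [hf1 x hx, one_mul]
    · rw [image_eq_zero_of_notMem_tsupport hx, mul_zero]
  have hsum' : ∀ x v, fderiv ℝ χ x v = ∑ i, fderiv ℝ (fun x => f i x * χ x) x v := fun x v => by
    have : χ = fun x => ∑ i, f i x * χ x := funext hsum
    conv_lhs => rw [this]
    rw [fderiv_fun_sum fun i _ => (hd i).differentiable one_ne_zero x]
    simp
  have L : ∫ x in Ω, (χ x * g x + fderiv ℝ χ x (V x))
      = ∑ i, ∫ x in Ω, (f i x * χ x * g x + fderiv ℝ (fun x => f i x * χ x) x (V x)) := by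
    rw [← integral_finsetSum _ fun i _ => integrableOn_test_pairing hV hg (hd i) (hc i)]
    congr 1; ext x
    rw [Finset.sum_add_distrib, ← hsum', ← Finset.sum_mul, ← hsum]
  have R : ∫ x in frontier Ω, χ x * inner ℝ (outwardNormal Ω x) (V x) ∂μHE[3]
      = ∑ i, ∫ x in frontier Ω, f i x * χ x * inner ℝ (outwardNormal Ω x) (V x) ∂μHE[3] := by
    rw [← integral_finsetSum _ fun i _ =>
      (integrableOn_flux hΩ hV (hd i).continuous (hc i) (hr i)).1]
    congr 1; ext x
    rw [← Finset.sum_mul, ← hsum]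
  have S : M = ∑ i, ∫ x in frontier Ω, |f i x * χ x| * ‖V x‖ ∂μHE[3] := by
    rw [← integral_finsetSum _ fun i _ =>
      (integrableOn_flux hΩ hV (hd i).continuous (hc i) (hr i)).2]
    rw [hM]
    congr 1; ext x
    rw [← Finset.sum_mul]
    congr 1
    simp only [abs_mul, abs_of_nonneg (hf0 _ x)]
    rw [← Finset.sum_mul]
    by_cases hx : x ∈ tsupport χ
    · rw [hf1 x hx, one_mul]
    · rw [image_eq_zero_of_notMem_tsupport hx, abs_zero, mul_zero]
  rw [L, R, S, ← Finset.sum_sub_distrib, Finset.mul_sum]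
  refine (Finset.abs_sum_le_sum_abs _ _).trans (Finset.sum_le_sum fun i _ => ?_)
  exact hU i i.1.2 _ (hd i) (hc i) (hs2 i)

end Flux

/-! ### Area of the regular boundary -/

section Area

variable {Ω : Set E4}

theorem isWeakDiv_const (hΩ : IsOpen Ω) (v : E4) :
    IsWeakDiv Ω (fun _ => v) (fun _ => (0 : ℝ)) := by
  have := IsWeakDiv.of_contDiffOn hΩ (contDiffOn_const (c := (1 : ℝ)) (n := 1)) v
  refine this.congr (fun x _ => ?_) fun x _ => ?_ <;> simp

/-- The divergence theorem for a `C¹` field `T`: each coordinate `T i` is a test function for the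
constant field `e i`. -/
theorem integral_divergence_eq_flux (hΩ : IsOpen Ω) {T : E4 → E4} (hT : ContDiff ℝ 1 T)
    (hTc : HasCompactSupport T) (hTr : frontier Ω ∩ tsupport T ⊆ regularBoundary 2 Ω) :
    IntegrableOn (fun x => inner ℝ (outwardNormal Ω x) (T x)) (frontier Ω) μHE[3] ∧
      ∫ x in Ω, divergence T x
        = ∫ x in frontier Ω, inner ℝ (outwardNormal Ω x) (T x) ∂μHE[3] := by
  have hd : ∀ i, ContDiff ℝ 1 fun x => T x i := fun i => (contDiff_euclidean.1 hT) i
  have hs : ∀ i, tsupport (fun x => T x i) ⊆ tsupport T := fun i =>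
    closure_mono (Function.support_subset_iff'.2 fun x hx => by
      rw [Function.notMem_support.1 hx]; rfl)
  have hc : ∀ i, HasCompactSupport fun x => T x i := fun i =>
    hTc.mono' (subset_closure.trans (hs i))
  have hr : ∀ i, frontier Ω ∩ tsupport (fun x => T x i) ⊆ regularBoundary 2 Ω := fun i =>
    (inter_subset_inter_right _ (hs i)).trans hTr
  have key : ∀ i, ∫ x in Ω, pderiv i (fun x => T x i) x = ∫ x in frontier Ω,
      T x i * inner ℝ (outwardNormal Ω x) (EuclideanSpace.single i (1 : ℝ)) ∂μHE[3] := fun i => by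
    rw [← integral_eq_flux hΩ continuous_const (isWeakDiv_const hΩ (EuclideanSpace.single i 1))
      (integrableOn_zero) (hd i) (hc i) (hr i)]
    simp [pderiv]
  have hI : ∀ i, IntegrableOn (fun x => T x i * inner ℝ (outwardNormal Ω x)
      (EuclideanSpace.single i (1 : ℝ))) (frontier Ω) μHE[3] := fun i =>
    (integrableOn_flux hΩ continuous_const (hd i).continuous (hc i) (hr i)).1
  have hin : ∀ x, inner ℝ (outwardNormal Ω x) (T x)
      = ∑ i, T x i * inner ℝ (outwardNormal Ω x) (EuclideanSpace.single i (1 : ℝ)) := fun x => by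
    rw [inner_eq_sum]
    refine Finset.sum_congr rfl fun i _ => ?_
    rw [EuclideanSpace.inner_single_right]
    simp [mul_comm]
  simp only [hin]
  refine ⟨integrable_finsetSum _ fun i _ => hI i, ?_⟩
  rw [integral_finsetSum _ fun i _ => hI i, ← Finset.sum_congr rfl fun i _ => key i]
  simp only [divergence]
  rw [integral_finsetSum]
  intro i _
  exact (Continuous.integrable_of_hasCompactSupport
    (((hd i).continuous_fderiv one_ne_zero).clm_apply
    continuous_const) ((hc i).fderiv_apply (𝕜 := ℝ) _)).integrableOn

theorem contDiffOn_levelNormal {φ : E4 → ℝ} (hφ : ContDiff ℝ 2 φ) {U : Set E4}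
    (hU : ∀ x ∈ U, gradient φ x ≠ 0) : ContDiffOn ℝ 1 (levelNormal φ) U := by
  have h1 : ContDiff ℝ 1 (gradient φ) :=
    (InnerProductSpace.toDual ℝ E4).symm.contDiff.comp (hφ.fderiv_right (by norm_num))
  intro x hx
  have h2 := h1.contDiffAt (x := x)
  exact (((h2.norm ℝ (hU x hx)).inv (norm_ne_zero_iff.2 (hU x hx))).smul h2).contDiffWithinAt

/-- Compact parts of the regular boundary carry fields of norm at most `1` that agree with the
normal there and point outwards elsewhere, so that their area is bounded by the perimeter. -/
theorem measureReal_le_of_isCompact (hΩ : IsOpen Ω) {C : ℝ}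
    (hC : ∀ T : E4 → E4, ContDiff ℝ 1 T → HasCompactSupport T → (∀ x, ‖T x‖ ≤ 1) →
      ∫ x in Ω, divergence T x ≤ C) {K : Set E4} (hK : IsCompact K)
    (hKr : K ⊆ regularBoundary 2 Ω) : (μHE[3] : Measure E4).real K ≤ C := by
  have hloc : ∀ z ∈ K, ∃ (U : Set E4) (φ : E4 → ℝ), IsOpen U ∧ z ∈ U ∧
      ContDiffOn ℝ 1 (levelNormal φ) U ∧ (∀ x ∈ U, ‖levelNormal φ x‖ = 1) ∧
      (∀ x ∈ frontier Ω ∩ U, outwardNormal Ω x = levelNormal φ x) ∧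
      Bornology.IsBounded U ∧ frontier Ω ∩ U ⊆ regularBoundary 2 Ω := by
    intro z hz
    obtain ⟨hzf, φ, hφ⟩ := hKr hz
    have h1 := hφ.eventually_of_eq_zero (by norm_num)
    have h2 := hφ.eventually_mem_frontier_imp hΩ
    have hg : ∀ᶠ x in 𝓝 z, gradient φ x ≠ 0 :=
      (continuous_gradient (hφ.contDiff.of_le (by norm_cast))).continuousAt.eventually_ne
        hφ.gradient_ne_zero
    obtain ⟨U, hU, hUo, hzU⟩ := eventually_nhds_iff.1 ((h1.and h2).and hg)
    refine ⟨U ∩ Metric.ball z 1, φ, hUo.inter Metric.isOpen_ball, ⟨hzU, by simp⟩,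
      contDiffOn_levelNormal hφ.contDiff fun x hx => (hU x hx.1).2,
      fun x hx => norm_levelNormal (hU x hx.1).2, fun x hx => ?_,
      Metric.isBounded_ball.subset inter_subset_right, fun x hx => ?_⟩
    · obtain ⟨⟨a, b⟩, -⟩ := hU x hx.2.1
      exact outwardNormal_eq_levelNormal (a (b hx.1))
    · obtain ⟨⟨a, b⟩, -⟩ := hU x hx.2.1
      exact ⟨hx.1, φ, a (b hx.1)⟩
  choose! U φ hUo hUm hUd hUn hUν hUb hUr using hloc
  obtain ⟨t, f, hf, hf0, hfs, hf1, hfle⟩ := exists_smooth_partition_of_isCompact hK hUo hUm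
  set T : E4 → E4 := fun x => ∑ i, f i x • levelNormal (φ i) x with hT
  have hz : ∀ i x, x ∉ tsupport (f i) → f i x = 0 := fun i x hx =>
    image_eq_zero_of_notMem_tsupport hx
  have hs : ∀ i, tsupport (fun x => f i x • levelNormal (φ i) x) ⊆ tsupport (f i) := fun i =>
    tsupport_smul_subset_left _ _
  have hcs : ∀ i, HasCompactSupport (f i) := fun i => Metric.isCompact_of_isClosed_isBounded
    isClosed_closure ((hUb i i.1.2).subset (hfs i))
  have hTd : ContDiff ℝ 1 T := ContDiff.sum fun i _ =>
    contDiff_of_contDiffOn_of_tsupport_subset (hUo i i.1.2)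
      (((hf i).of_le (by simp)).contDiffOn.smul (hUd i i.1.2)) ((hs i).trans (hfs i))
  have hTs : tsupport T ⊆ ⋃ i, tsupport (f i) := by
    refine closure_minimal (Function.support_subset_iff'.2 fun x hx => ?_)
      (isClosed_iUnion_of_finite fun i => isClosed_closure)
    refine Finset.sum_eq_zero fun i _ => ?_
    rw [hz i x fun h => hx (mem_iUnion.2 ⟨i, h⟩), zero_smul]
  have hTc : HasCompactSupport T :=
    (isCompact_iUnion fun i => hcs i).of_isClosed_subset isClosed_closure hTs
  have hn : ∀ i x, ‖f i x • levelNormal (φ i) x‖ = f i x := fun i x => by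
    rw [norm_smul, Real.norm_of_nonneg (hf0 i x)]
    by_cases hx : x ∈ tsupport (f i)
    · rw [hUn i i.1.2 x (hfs i hx), mul_one]
    · rw [hz i x hx, zero_mul]
  have hT1 : ∀ x, ‖T x‖ ≤ 1 := fun x => by
    refine (norm_sum_le _ _).trans ?_
    simp only [hn]
    exact hfle x
  have hTr : frontier Ω ∩ tsupport T ⊆ regularBoundary 2 Ω := fun x hx => by
    obtain ⟨i, hi⟩ := mem_iUnion.1 (hTs hx.2)
    exact hUr i i.1.2 ⟨hx.1, hfs i hi⟩
  obtain ⟨hI, hE⟩ := integral_divergence_eq_flux hΩ hTd hTc hTr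
  have hν : ∀ x ∈ frontier Ω, inner ℝ (outwardNormal Ω x) (T x) = ∑ i, f i x := fun x hx => by
    rw [hT, inner_sum]
    refine Finset.sum_congr rfl fun i _ => ?_
    by_cases hxi : x ∈ tsupport (f i)
    · rw [inner_smul_right, hUν i i.1.2 x ⟨hx, hfs i hxi⟩, real_inner_self_eq_norm_sq,
        hUn i i.1.2 x (hfs i hxi)]
      ring
    · rw [hz i x hxi, zero_smul, inner_zero_right]
  have hKf : K ⊆ frontier Ω := fun x hx => (hKr hx).1
  have hfm : MeasurableSet (frontier Ω) := isClosed_frontier.measurableSet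
  calc (μHE[3] : Measure E4).real K
      = ∫ x in K, inner ℝ (outwardNormal Ω x) (T x) ∂μHE[3] := by
        rw [setIntegral_congr_fun hK.measurableSet (g := fun _ => (1 : ℝ)) fun x hx => by
          simp only; rw [hν x (hKf hx), hf1 x hx]]
        simp
    _ ≤ ∫ x in frontier Ω, inner ℝ (outwardNormal Ω x) (T x) ∂μHE[3] := by
        refine setIntegral_mono_set hI ?_ hKf.eventuallyLE
        refine (ae_restrict_mem hfm).mono fun x hx => ?_
        simp only [Pi.zero_apply]
        rw [hν x hx]
        exact Finset.sum_nonneg fun i _ => hf0 i x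
    _ ≤ C := by rw [← hE]; exact hC T hTd hTc hT1

/-- The regular boundary, relatively open in the frontier, is exhausted by compact sets, and their
areas are bounded by the perimeter. -/
theorem measure_regularBoundary_lt_top (hΩ : IsOpen Ω) (hΩb : Bornology.IsBounded Ω)
    (hP : HasFinitePerimeter Ω) : (μHE[3] : Measure E4) (regularBoundary 2 Ω) < ⊤ := by
  obtain ⟨C, hC⟩ := hP
  obtain ⟨O, hO, hreg⟩ := exists_isOpen_regularBoundary hΩ
  obtain ⟨S, hSc, hSO, hSU, hSm⟩ := hO.exists_iUnion_isClosed
  have hfc : IsCompact (frontier Ω) := hΩb.isCompact_closure.of_isClosed_subset isClosed_frontier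
    frontier_subset_closure
  have hK : ∀ n, IsCompact (frontier Ω ∩ S n) := fun n => hfc.inter_right (hSc n)
  have hKr : ∀ n, frontier Ω ∩ S n ⊆ regularBoundary 2 Ω := fun n => by
    rw [hreg]; exact inter_subset_inter_right _ (hSO n)
  have : regularBoundary 2 Ω = ⋃ n, frontier Ω ∩ S n := by rw [hreg, ← inter_iUnion, hSU]
  rw [this]
  have hle : (μHE[3] : Measure E4) (⋃ n, frontier Ω ∩ S n) ≤ ENNReal.ofReal C := by
    rw [Monotone.measure_iUnion fun a b hab => inter_subset_inter_right _ (hSm hab)]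
    refine iSup_le fun n => ?_
    rw [ENNReal.le_ofReal_iff_toReal_le
      (euclideanHausdorffMeasure_lt_top_of_isCompact hΩ (hK n) (hKr n)).ne
      (measureReal_nonneg.trans (measureReal_le_of_isCompact hΩ hC (hK n) (hKr n)))]
    exact measureReal_le_of_isCompact hΩ hC (hK n) (hKr n)
  exact hle.trans_lt ENNReal.ofReal_lt_top

end Area

/-! ### Removing a singular set of zero area -/

/-- A compact `ℋ³`-null set has finite covers by small balls with small sum of cubed radii. -/
theorem exists_cover_balls_of_measure_zero {S : Set E4} (hS : IsCompact S)
    (h0 : (μHE[3] : Measure E4) S = 0) {ε : ℝ} (hε : 0 < ε) :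
    ∃ (F : Finset ℕ) (c : ℕ → E4) (r : ℕ → ℝ), (∀ n ∈ F, c n ∈ S ∧ 0 < r n ∧ r n < ε) ∧
      S ⊆ ⋃ n ∈ F, Metric.ball (c n) (r n) ∧ ∑ n ∈ F, r n ^ 3 < ε := by
  have h1 : (μH[(3 : ℕ)] : Measure E4) S = 0 := by
    rw [Measure.euclideanHausdorffMeasure_def, Measure.smul_apply, ENNReal.smul_def, smul_eq_mul,
      mul_eq_zero] at h0
    refine h0.resolve_left ?_
    simpa using Measure.addHaarScalarFactor_volume_hausdorffMeasure_ne_zero 3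
  rw [Measure.hausdorffMeasure_apply] at h1
  have hε2 : 0 < ENNReal.ofReal (ε / 2) := ENNReal.ofReal_pos.2 (by positivity)
  have h2 : (⨅ (t : ℕ → Set E4) (_ : S ⊆ ⋃ n, t n)
      (_ : ∀ n, Metric.ediam (t n) ≤ ENNReal.ofReal (ε / 2)),
      ∑' n, ⨆ _ : (t n).Nonempty, Metric.ediam (t n) ^ ((3 : ℕ) : ℝ)) < ENNReal.ofReal (ε / 2) := by
    refine lt_of_le_of_lt ?_ hε2
    rw [← h1]
    exact le_iSup₂_of_le (ENNReal.ofReal (ε / 2)) hε2 le_rfl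
  simp only [iInf_lt_iff] at h2
  obtain ⟨t, ht, hd, hsum⟩ := h2
  obtain ⟨δ, hδ, hδs⟩ := ENNReal.exists_pos_sum_of_countable hε2.ne' ℕ
  have htop : ∀ n, Metric.ediam (t n) ≠ ⊤ := fun n => ((hd n).trans_lt ENNReal.ofReal_lt_top).ne
  have hr : ∀ n, ∃ r : ℝ, Metric.diam (t n) < r ∧ r < ε ∧ r ^ 3 < Metric.diam (t n) ^ 3 + δ n := by
    intro n
    have hlt : Metric.diam (t n) < ε := by
      have : Metric.diam (t n) ≤ ε / 2 := ENNReal.toReal_le_of_le_ofReal (by positivity) (hd n)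
      linarith
    have hc : ∀ᶠ r in 𝓝 (Metric.diam (t n)), r ^ 3 < Metric.diam (t n) ^ 3 + δ n :=
      (continuous_pow 3).continuousAt.eventually_lt_const (by
        have := hδ n
        simpa using this)
    obtain ⟨r, ⟨a, b⟩, c⟩ := (((hc.filter_mono nhdsWithin_le_nhds).and
      (nhdsWithin_le_nhds (Iio_mem_nhds hlt))).and
      (self_mem_nhdsWithin (s := Ioi (Metric.diam (t n))))).exists
    exact ⟨r, c, b, a⟩
  choose r hr1 hr2 hr3 using hr
  choose! c hc using fun (n : ℕ) (hn : (t n ∩ S).Nonempty) => hn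
  obtain ⟨F, hF⟩ := hS.elim_finite_subcover
    (fun n : {n | (t n ∩ S).Nonempty} => Metric.ball (c n) (r n)) (fun n => Metric.isOpen_ball) (by
      intro x hx
      obtain ⟨n, hn⟩ := mem_iUnion.1 (ht hx)
      have hn' : (t n ∩ S).Nonempty := ⟨x, hn, hx⟩
      refine mem_iUnion.2 ⟨⟨n, hn'⟩, ?_⟩
      exact (Metric.dist_le_diam_of_mem' (htop n) hn (hc n hn').1).trans_lt (hr1 n))
  refine ⟨F.map (Function.Embedding.subtype _), c, r, ?_, ?_, ?_⟩
  · intro n hn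
    obtain ⟨m, hm, rfl⟩ := Finset.mem_map.1 hn
    exact ⟨(hc _ m.2).2, Metric.diam_nonneg.trans_lt (hr1 _), hr2 _⟩
  · intro x hx
    obtain ⟨m, hm⟩ := mem_iUnion.1 (hF hx)
    obtain ⟨hmF, hx'⟩ := mem_iUnion.1 hm
    exact mem_iUnion₂.2 ⟨m, Finset.mem_map.2 ⟨m, hmF, rfl⟩, hx'⟩
  · set G := F.map (Function.Embedding.subtype _) with hG
    have hGne : ∀ n ∈ G, (t n).Nonempty := fun n hn => by
      obtain ⟨m, hm, rfl⟩ := Finset.mem_map.1 hn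
      exact ⟨_, (hc _ m.2).1⟩
    have hr0 : ∀ n, 0 ≤ r n := fun n => Metric.diam_nonneg.trans (hr1 n).le
    have e1 : ENNReal.ofReal (∑ n ∈ G, r n ^ 3)
        < ENNReal.ofReal (ε / 2) + ENNReal.ofReal (ε / 2) := by
      calc ENNReal.ofReal (∑ n ∈ G, r n ^ 3) = ∑ n ∈ G, ENNReal.ofReal (r n ^ 3) :=
            ENNReal.ofReal_sum_of_nonneg fun n _ => pow_nonneg (hr0 n) 3
        _ ≤ ∑ n ∈ G, ((⨆ _ : (t n).Nonempty, Metric.ediam (t n) ^ ((3 : ℕ) : ℝ)) + δ n) := by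
            refine Finset.sum_le_sum fun n hn => ?_
            rw [ciSup_pos (hGne n hn), ENNReal.rpow_natCast, ← ENNReal.ofReal_toReal (htop n),
              ← ENNReal.ofReal_pow ENNReal.toReal_nonneg, ← ENNReal.ofReal_coe_nnreal,
              ← ENNReal.ofReal_add (by positivity) (NNReal.coe_nonneg _)]
            exact ENNReal.ofReal_le_ofReal (hr3 n).le
        _ = (∑ n ∈ G, ⨆ _ : (t n).Nonempty, Metric.ediam (t n) ^ ((3 : ℕ) : ℝ))
              + ∑ n ∈ G, (δ n : ENNReal) := Finset.sum_add_distrib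
        _ < _ := ENNReal.add_lt_add ((ENNReal.sum_le_tsum _).trans_lt hsum)
              ((ENNReal.sum_le_tsum _).trans_lt hδs)
    rw [← ENNReal.ofReal_add (by positivity) (by positivity), add_halves] at e1
    exact (ENNReal.ofReal_lt_ofReal_iff hε).1 e1

/-- The cutoff that vanishes on the ball of radius `r` about `c` and is `1` off the ball of radius
`2 r`. -/
noncomputable def ballCutoff (c : E4) (r : ℝ) (x : E4) : ℝ :=
  Real.smoothTransition (‖x - c‖ ^ 2 / r ^ 2 - 1)

theorem contDiff_ballCutoff (c : E4) (r : ℝ) : ContDiff ℝ 1 (ballCutoff c r) :=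
  contDiff_smoothTransition_one.comp
    ((((contDiff_id.sub contDiff_const).norm_sq ℝ).div_const _).sub contDiff_const)

theorem ballCutoff_mem_Icc (c : E4) (r : ℝ) (x : E4) : ballCutoff c r x ∈ Icc (0 : ℝ) 1 :=
  ⟨Real.smoothTransition.nonneg _, Real.smoothTransition.le_one _⟩

theorem ballCutoff_eq_zero {c x : E4} {r : ℝ} (hr : 0 < r) (hx : x ∈ Metric.ball c r) :
    ballCutoff c r x = 0 := by
  refine Real.smoothTransition.zero_of_nonpos ?_
  rw [mem_ball_iff_norm] at hx
  rw [sub_nonpos, div_le_one (by positivity)]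
  gcongr

theorem ballCutoff_eq_one {c x : E4} {r : ℝ} (hr : 0 < r) (hx : x ∉ Metric.ball c (2 * r)) :
    ballCutoff c r x = 1 := by
  refine Real.smoothTransition.one_of_one_le ?_
  rw [mem_ball_iff_norm, not_lt] at hx
  have : 2 ≤ ‖x - c‖ ^ 2 / r ^ 2 := by
    rw [le_div_iff₀ (by positivity)]
    nlinarith
  linarith

/-- The gradient of the cutoff at scale `r` is of order `1/r` and vanishes off the ball of radius
`2r`. -/
theorem exists_norm_fderiv_ballCutoff_le :
    ∃ A : ℝ, 0 ≤ A ∧ ∀ (c : E4) (r : ℝ), 0 < r → ∀ x,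
      ‖fderiv ℝ (ballCutoff c r) x‖
        ≤ (Metric.closedBall c (2 * r)).indicator (fun _ => A / r) x := by
  obtain ⟨B, hB⟩ := continuous_deriv_smoothTransition.bounded_above_of_compact_support
    (HasCompactSupport.intro isCompact_Icc fun _ h => deriv_smoothTransition_eq_zero h)
  have hB0 : 0 ≤ B := (norm_nonneg _).trans (hB 0)
  refine ⟨4 * B, by positivity, fun c r hr x => ?_⟩
  by_cases hx : x ∈ Metric.closedBall c (2 * r)
  · rw [indicator_of_mem hx]
    have h1 : HasFDerivAt (fun x : E4 => ‖x - c‖ ^ 2 / r ^ 2 - 1)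
        ((r ^ 2)⁻¹ • ((2 : ℝ) • innerSL ℝ (x - c))) x := by
      have : HasFDerivAt (fun x : E4 => ‖x - c‖ ^ 2) ((2 : ℝ) • innerSL ℝ (x - c)) x :=
        (((hasFDerivAt_id x).sub_const c).norm_sq).congr_fderiv (by ext v; simp)
      simp only [div_eq_mul_inv]
      exact (this.mul_const ((r ^ 2)⁻¹)).sub_const 1
    have h2 := ((contDiff_smoothTransition_one.differentiable one_ne_zero
      (‖x - c‖ ^ 2 / r ^ 2 - 1)).hasDerivAt).comp_hasFDerivAt x h1
    have h3 : fderiv ℝ (ballCutoff c r) x = _ := h2.fderiv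
    rw [h3, norm_smul, norm_smul, norm_smul, innerSL_apply_norm]
    have hxn : ‖x - c‖ ≤ 2 * r := by rwa [mem_closedBall_iff_norm] at hx
    have : ‖(r ^ 2)⁻¹‖ * (‖(2 : ℝ)‖ * ‖x - c‖) ≤ 4 / r := by
      rw [Real.norm_of_nonneg (by positivity), Real.norm_of_nonneg (by norm_num),
        inv_mul_eq_div, div_le_div_iff₀ (by positivity) hr]
      nlinarith
    calc _ ≤ B * (4 / r) := mul_le_mul (hB _) this (by positivity) hB0
      _ = 4 * B / r := by ring
  · rw [indicator_of_notMem hx]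
    have : ballCutoff c r =ᶠ[𝓝 x] fun _ => 1 := by
      filter_upwards [Metric.isClosed_closedBall.isOpen_compl.mem_nhds hx] with y hy
      exact ballCutoff_eq_one hr fun hb => hy (Metric.ball_subset_closedBall hb)
    rw [this.fderiv_eq]
    simp

theorem contDiff_prod_and_norm_fderiv_prod_le (F : Finset ℕ) (φ : ℕ → E4 → ℝ)
    (hφ : ∀ n, ContDiff ℝ 1 (φ n)) (h01 : ∀ n x, φ n x ∈ Icc (0 : ℝ) 1) :
    ContDiff ℝ 1 (fun x => ∏ n ∈ F, φ n x) ∧ (∀ x, ∏ n ∈ F, φ n x ∈ Icc (0 : ℝ) 1) ∧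
      ∀ x, ‖fderiv ℝ (fun x => ∏ n ∈ F, φ n x) x‖ ≤ ∑ n ∈ F, ‖fderiv ℝ (φ n) x‖ := by
  induction F using Finset.induction_on with
  | empty => simpa using contDiff_const
  | insert a F ha ih =>
    obtain ⟨i1, i2, i3⟩ := ih
    simp only [Finset.prod_insert ha, Finset.sum_insert ha]
    refine ⟨(hφ a).mul i1, fun x => ⟨mul_nonneg (h01 a x).1 (i2 x).1,
      mul_le_one₀ (h01 a x).2 (i2 x).1 (i2 x).2⟩, fun x => ?_⟩
    rw [fderiv_fun_mul ((hφ a).differentiable one_ne_zero x) (i1.differentiable one_ne_zero x),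
      add_comm]
    refine (norm_add_le _ _).trans (add_le_add ?_ ?_)
    · rw [norm_smul, Real.norm_of_nonneg (i2 x).1]
      exact mul_le_of_le_one_left (norm_nonneg _) (i2 x).2
    · rw [norm_smul, Real.norm_of_nonneg (h01 a x).1]
      exact (mul_le_of_le_one_left (norm_nonneg _) (h01 a x).2).trans (i3 x)

/-- Cutoffs near an `ℋ³`-null compact set with small Dirichlet `L¹` energy: the gradient of a
cutoff at scale `r` is of order `1/r` on a set of volume of order `r⁴`. -/
theorem exists_cutoff_of_measure_zero {S : Set E4} (hS : IsCompact S)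
    (h0 : (μHE[3] : Measure E4) S = 0) {ε : ℝ} (hε : 0 < ε) :
    ∃ η : E4 → ℝ, ContDiff ℝ 1 η ∧ (∀ x, η x ∈ Icc (0 : ℝ) 1) ∧ (∃ W, IsOpen W ∧ S ⊆ W ∧
      ∀ x ∈ W, η x = 0) ∧ (∀ x, η x ≠ 1 → ∃ s ∈ S, dist x s < ε) ∧
      Integrable (fun x => ‖fderiv ℝ η x‖) ∧ ∫ x, ‖fderiv ℝ η x‖ < ε := by
  obtain ⟨A, hA, hAb⟩ := exists_norm_fderiv_ballCutoff_le
  set κ := (volume : Measure E4).real (Metric.ball 0 1) with hκ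
  have hκ0 : 0 ≤ κ := measureReal_nonneg
  set ε' := min (ε / 2) (ε / (16 * A * κ + 1)) with hε'
  have hε'0 : 0 < ε' := lt_min (by positivity) (by positivity)
  obtain ⟨F, c, r, hcr, hcov, hsum⟩ := exists_cover_balls_of_measure_zero hS h0 hε'0
  obtain ⟨p1, p2, p3⟩ := contDiff_prod_and_norm_fderiv_prod_le F (fun n => ballCutoff (c n) (r n))
    (fun n => contDiff_ballCutoff _ _) (fun n x => ballCutoff_mem_Icc _ _ x)
  set η : E4 → ℝ := fun x => ∏ n ∈ F, ballCutoff (c n) (r n) x with hη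
  have hi : ∀ n, Integrable ((Metric.closedBall (c n) (2 * r n)).indicator fun _ => A / r n) :=
    fun n => (integrable_indicator_iff Metric.isClosed_closedBall.measurableSet).2
      (integrableOn_const measure_closedBall_lt_top.ne)
  have hle : ∀ x, ‖fderiv ℝ η x‖
      ≤ ∑ n ∈ F, (Metric.closedBall (c n) (2 * r n)).indicator (fun _ => A / r n) x := fun x =>
    (p3 x).trans (Finset.sum_le_sum fun n hn => hAb _ _ (hcr n hn).2.1 x)
  have hI : Integrable fun x => ‖fderiv ℝ η x‖ :=
    (integrable_finsetSum F fun n _ => hi n).mono'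
      (p1.continuous_fderiv one_ne_zero).norm.aestronglyMeasurable
      (ae_of_all _ fun x => by rw [norm_norm]; exact hle x)
  refine ⟨η, p1, p2, ⟨⋃ n ∈ F, Metric.ball (c n) (r n),
    isOpen_biUnion fun _ _ => Metric.isOpen_ball, hcov, fun x hx => ?_⟩, fun x hx => ?_, hI, ?_⟩
  · obtain ⟨n, hn, hx⟩ := mem_iUnion₂.1 hx
    exact Finset.prod_eq_zero hn (ballCutoff_eq_zero (hcr n hn).2.1 hx)
  · by_contra! hno
    refine hx (Finset.prod_eq_one fun n hn => ballCutoff_eq_one (hcr n hn).2.1 fun hb => ?_)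
    have h1 := hno _ (hcr n hn).1
    have h2 := (hcr n hn).2.2.trans_le (min_le_left _ _)
    rw [Metric.mem_ball] at hb
    linarith
  · have e1 : ∀ n ∈ F, ∫ x, (Metric.closedBall (c n) (2 * r n)).indicator (fun _ => A / r n) x
        = 16 * A * κ * r n ^ 3 := fun n hn => by
      have hr := (hcr n hn).2.1
      rw [integral_indicator Metric.isClosed_closedBall.measurableSet, setIntegral_const,
        smul_eq_mul, measureReal_def, Measure.addHaar_closedBall _ _ (by positivity),
        ENNReal.toReal_mul, ENNReal.toReal_ofReal (by positivity), ← measureReal_def, ← hκ]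
      simp only [finrank_euclideanSpace, Fintype.card_fin]
      field_simp
      ring
    calc ∫ x, ‖fderiv ℝ η x‖ ≤ ∫ x, ∑ n ∈ F,
          (Metric.closedBall (c n) (2 * r n)).indicator (fun _ => A / r n) x :=
          integral_mono hI (integrable_finsetSum F fun n _ => hi n) hle
      _ = 16 * A * κ * ∑ n ∈ F, r n ^ 3 := by
          rw [integral_finsetSum _ fun n _ => hi n, Finset.sum_congr rfl e1, Finset.mul_sum]
      _ ≤ 16 * A * κ * (ε / (16 * A * κ + 1)) := by
          gcongr
          exact hsum.le.trans (min_le_right _ _)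
      _ < ε := by
          rw [← mul_div_assoc, div_lt_iff₀ (by positivity)]
          nlinarith

section SingularBoundary

variable {Ω : Set E4} {V : E4 → E4} {g : E4 → ℝ}

theorem isCompact_singularBoundary (hΩ : IsOpen Ω) (hΩb : Bornology.IsBounded Ω) :
    IsCompact (frontier Ω \ regularBoundary 2 Ω) := by
  obtain ⟨O, hO, hreg⟩ := exists_isOpen_regularBoundary hΩ
  rw [hreg, sdiff_self_inter]
  exact (hΩb.isCompact_closure.of_isClosed_subset isClosed_frontier frontier_subset_closure).diff hO

theorem integrableOn_frontier_of_continuousOn (hΩ : IsOpen Ω) (hS : HasAlmostC2Boundary Ω)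
    (hfin : (μHE[3] : Measure E4) (regularBoundary 2 Ω) < ⊤) {G : E4 → ℝ}
    (hG : ContinuousOn G (regularBoundary 2 Ω)) {B : ℝ}
    (hB : ∀ x ∈ regularBoundary 2 Ω, |G x| ≤ B) : IntegrableOn G (frontier Ω) μHE[3] := by
  have hm := measurableSet_regularBoundary hΩ
  have h1 : IntegrableOn G (regularBoundary 2 Ω) μHE[3] :=
    IntegrableOn.of_bound hfin (hG.aestronglyMeasurable hm) B
      ((ae_restrict_mem hm).mono fun x hx => hB x hx)
  have h2 : IntegrableOn G (frontier Ω \ regularBoundary 2 Ω) μHE[3] := by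
    rw [IntegrableOn, Measure.restrict_eq_zero.2 hS]
    exact integrable_zero_measure
  have := h1.union h2
  rwa [union_sdiff_cancel fun x hx => hx.1] at this

theorem ae_frontier_mem_regularBoundary (hS : HasAlmostC2Boundary Ω) :
    ∀ᵐ x ∂(μHE[3] : Measure E4).restrict (frontier Ω), x ∈ regularBoundary 2 Ω := by
  rw [ae_restrict_iff' isClosed_frontier.measurableSet, ae_iff]
  refine measure_mono_null (fun x hx => ?_) hS
  simp only [mem_ofPred_eq, Classical.not_imp] at hx
  exact hx

/-- The divergence theorem on a bounded domain whose boundary has finite regular part and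
`ℋ³`-null singular part: cutoffs near the singular part have gradients that vanish in `L¹`. -/
theorem integral_eq_integral_frontier_inner (hΩ : IsOpen Ω) (hΩb : Bornology.IsBounded Ω)
    (hS : HasAlmostC2Boundary Ω) (hfin : (μHE[3] : Measure E4) (regularBoundary 2 Ω) < ⊤)
    (hV : Continuous V) (hW : IsWeakDiv Ω V g) (hg : IntegrableOn g Ω) :
    IntegrableOn (fun x => inner ℝ (outwardNormal Ω x) (V x)) (frontier Ω) μHE[3] ∧
      ∫ x in Ω, g x = ∫ x in frontier Ω, inner ℝ (outwardNormal Ω x) (V x) ∂μHE[3] := by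
  have hcl := hΩb.isCompact_closure
  obtain ⟨M, hM⟩ := hcl.exists_bound_of_continuousOn hV.continuousOn
  have hI : IntegrableOn (fun x => inner ℝ (outwardNormal Ω x) (V x)) (frontier Ω) μHE[3] := by
    refine integrableOn_frontier_of_continuousOn hΩ hS hfin
      ((continuousOn_outwardNormal hΩ).inner hV.continuousOn) (B := M) fun x hx => ?_
    refine (abs_real_inner_le_norm _ _).trans ?_
    rw [norm_outwardNormal hx, one_mul]
    exact hM x (frontier_subset_closure hx.1)
  refine ⟨hI, ?_⟩
  set Sg := frontier Ω \ regularBoundary 2 Ω with hSg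
  have hSc : IsCompact Sg := isCompact_singularBoundary hΩ hΩb
  obtain ⟨χ₀, hχ₀, hχ₀c, -, hχ₀1, -⟩ := exists_contDiff_one_nhds_of_isCompact hcl isOpen_univ
    (subset_univ _)
  have hχ₀Ω : ∀ x ∈ closure Ω, χ₀ =ᶠ[𝓝 x] fun _ => 1 := fun x hx =>
    (eventually_nhdsSet_iff_forall.1 hχ₀1) x hx
  have hpos : ∀ n : ℕ, (0 : ℝ) < 1 / ((n : ℝ) + 1) := fun n => by positivity
  choose η hη h01 hW0 h1 hint hlt using fun n : ℕ => exists_cutoff_of_measure_zero hSc hS (hpos n)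
  have hd : ∀ n, ContDiff ℝ 1 fun x => η n x * χ₀ x := fun n =>
    (hη n).mul (hχ₀.of_le (by simp))
  have hc : ∀ n, HasCompactSupport fun x => η n x * χ₀ x := fun n => hχ₀c.mul_left
  have hr : ∀ n, frontier Ω ∩ tsupport (fun x => η n x * χ₀ x) ⊆ regularBoundary 2 Ω := by
    rintro n x ⟨hxf, hxs⟩
    by_contra hx
    obtain ⟨W, hWo, hSW, hW1⟩ := hW0 n
    have : x ∉ tsupport (η n) := by
      rw [notMem_tsupport_iff_eventuallyEq]
      filter_upwards [hWo.mem_nhds (hSW ⟨hxf, hx⟩)] with y hy using hW1 y hy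
    exact this (tsupport_mul_subset_left hxs)
  have key : ∀ n, ∫ x in Ω, (η n x * g x + fderiv ℝ (η n) x (V x))
      = ∫ x in frontier Ω, η n x * inner ℝ (outwardNormal Ω x) (V x) ∂μHE[3] := fun n => by
    have hA := integral_eq_flux hΩ hV hW hg (hd n) (hc n) (hr n)
    have e1 : ∀ x ∈ closure Ω, (fun x => η n x * χ₀ x) =ᶠ[𝓝 x] η n := fun x hx => by
      filter_upwards [hχ₀Ω x hx] with y hy
      rw [hy, mul_one]
    rw [setIntegral_congr_fun hΩ.measurableSet (g := fun x => η n x * g x + fderiv ℝ (η n) x (V x))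
        fun x hx => by
          simp only
          rw [(e1 x (subset_closure hx)).fderiv_eq, (e1 x (subset_closure hx)).eq_of_nhds],
      setIntegral_congr_fun isClosed_frontier.measurableSet
        (g := fun x => η n x * inner ℝ (outwardNormal Ω x) (V x)) fun x hx => by
          have := (e1 x (frontier_subset_closure hx)).eq_of_nhds
          simp only at this ⊢
          rw [this]] at hA
    exact hA
  have hlim0 : Tendsto (fun n : ℕ => 1 / ((n : ℝ) + 1)) atTop (𝓝 0) :=
    tendsto_one_div_add_atTop_nhds_zero_nat
  have hptw : ∀ x ∉ Sg, Tendsto (fun n => η n x) atTop (𝓝 1) := by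
    intro x hx
    obtain ⟨δ, hδ, hb⟩ := Metric.isOpen_iff.1 hSc.isClosed.isOpen_compl x hx
    refine tendsto_const_nhds.congr' ?_
    filter_upwards [hlim0.eventually_lt_const hδ] with n hn
    by_contra hne
    obtain ⟨s, hs, hds⟩ := h1 n x (Ne.symm hne)
    exact hb (by rw [Metric.mem_ball, dist_comm]; exact hds.trans hn) hs
  have hΩS : ∀ x ∈ Ω, x ∉ Sg := fun x hx hxS => by
    have := hxS.1
    rw [hΩ.frontier_eq] at this
    exact this.2 hx
  have hle1 : ∀ n x, ‖η n x‖ ≤ 1 := fun n x => by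
    rw [Real.norm_of_nonneg (h01 n x).1]; exact (h01 n x).2
  have L1 : Tendsto (fun n => ∫ x in Ω, η n x * g x) atTop (𝓝 (∫ x in Ω, g x)) := by
    refine tendsto_integral_of_dominated_convergence (fun x => ‖g x‖)
      (fun n => (hη n).continuous.aestronglyMeasurable.mul hg.1) hg.norm
      (fun n => ae_of_all _ fun x => ?_) ((ae_restrict_mem hΩ.measurableSet).mono fun x hx => ?_)
    · rw [norm_mul]; exact mul_le_of_le_one_left (norm_nonneg _) (hle1 n x)
    · simpa using (hptw x (hΩS x hx)).mul_const (g x)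
  have hfi : ∀ n, IntegrableOn (fun x => fderiv ℝ (η n) x (V x)) Ω := fun n => by
    refine ((hint n).integrableOn.mul_const M).mono' (((hη n).continuous_fderiv
      one_ne_zero).clm_apply hV).aestronglyMeasurable ?_
    refine (ae_restrict_mem hΩ.measurableSet).mono fun x hx => ?_
    exact (ContinuousLinearMap.le_opNorm _ _).trans (mul_le_mul_of_nonneg_left
      (hM x (subset_closure hx)) (norm_nonneg _))
  have L2 : Tendsto (fun n => ∫ x in Ω, fderiv ℝ (η n) x (V x)) atTop (𝓝 0) := by
    have hM' : Tendsto (fun n : ℕ => 1 / ((n : ℝ) + 1) * |M|) atTop (𝓝 0) := by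
      simpa using hlim0.mul_const |M|
    refine squeeze_zero_norm (fun n => ?_) hM'
    calc ‖∫ x in Ω, fderiv ℝ (η n) x (V x)‖ ≤ ∫ x in Ω, ‖fderiv ℝ (η n) x‖ * |M| := by
          refine norm_integral_le_of_norm_le ((hint n).integrableOn.mul_const |M|)
            ((ae_restrict_mem hΩ.measurableSet).mono fun x hx => ?_)
          exact (ContinuousLinearMap.le_opNorm _ _).trans (mul_le_mul_of_nonneg_left
            ((hM x (subset_closure hx)).trans (le_abs_self M)) (norm_nonneg _))
      _ = (∫ x in Ω, ‖fderiv ℝ (η n) x‖) * |M| := integral_mul_const _ _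
      _ ≤ 1 / ((n : ℝ) + 1) * |M| := by
          refine mul_le_mul_of_nonneg_right ?_ (abs_nonneg M)
          exact (setIntegral_le_integral (hint n) (ae_of_all _ fun x => norm_nonneg _)).trans
            (hlt n).le
  have L : Tendsto (fun n => ∫ x in Ω, (η n x * g x + fderiv ℝ (η n) x (V x))) atTop
      (𝓝 (∫ x in Ω, g x)) := by
    have := L1.add L2
    rw [add_zero] at this
    refine this.congr fun n => (integral_add ?_ (hfi n)).symm
    exact hg.bdd_mul (hη n).continuous.aestronglyMeasurable (ae_of_all _ (hle1 n))
  have R : Tendsto (fun n => ∫ x in frontier Ω, η n x * inner ℝ (outwardNormal Ω x) (V x) ∂μHE[3])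
      atTop (𝓝 (∫ x in frontier Ω, inner ℝ (outwardNormal Ω x) (V x) ∂μHE[3])) := by
    refine tendsto_integral_of_dominated_convergence
      (fun x => ‖(inner ℝ (outwardNormal Ω x) (V x) : ℝ)‖)
      (fun n => (hη n).continuous.aestronglyMeasurable.mul hI.1) hI.norm
      (fun n => ae_of_all _ fun x => ?_) ?_
    · rw [norm_mul]; exact mul_le_of_le_one_left (norm_nonneg _) (hle1 n x)
    · filter_upwards [ae_frontier_mem_regularBoundary hS] with x hx
      simpa using (hptw x fun h => h.2 hx).mul_const (inner ℝ (outwardNormal Ω x) (V x))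
  exact tendsto_nhds_unique (L.congr key) R

end SingularBoundary

/-! ### Derivatives on the boundary -/

/-- The coordinates `(y, t) ↦ z + e(y, ψ(y) + t)`, in which the boundary is `t = 0`. -/
noncomputable def straighten (z : E4) (e : WithLp 2 (E3 × ℝ) ≃ₗᵢ[ℝ] E4) (ψ : E3 → ℝ)
    (q : E3 × ℝ) : E4 :=
  z + frameMap e (q.1, ψ q.1 + q.2)

/-- The derivative of `straighten` at a point above `y`. -/
noncomputable def straightenDeriv (e : WithLp 2 (E3 × ℝ) ≃ₗᵢ[ℝ] E4) (ψ : E3 → ℝ) (y : E3) :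
    E3 × ℝ →L[ℝ] E4 :=
  (frameMap e : E3 × ℝ →L[ℝ] E4) ∘L ((ContinuousLinearMap.fst ℝ E3 ℝ).prod
    (fderiv ℝ ψ y ∘L ContinuousLinearMap.fst ℝ E3 ℝ + ContinuousLinearMap.snd ℝ E3 ℝ))

theorem straightenDeriv_apply (e : WithLp 2 (E3 × ℝ) ≃ₗᵢ[ℝ] E4) (ψ : E3 → ℝ) (y : E3)
    (q : E3 × ℝ) : straightenDeriv e ψ y q = frameMap e (q.1, fderiv ℝ ψ y q.1 + q.2) := by
  simp [straightenDeriv]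

namespace IsGraphChart

variable {Ω : Set E4} {z : E4} {e : WithLp 2 (E3 × ℝ) ≃ₗᵢ[ℝ] E4} {ψ : E3 → ℝ} {r ε : ℝ}

theorem straighten_zero (h : IsGraphChart Ω z e ψ r ε) : straighten z e ψ 0 = z := by
  have : ((0 : ℝ), (0 : ℝ)) = 0 := rfl
  simp [straighten, h.map_zero]

theorem hasFDerivAt_straighten (h : IsGraphChart Ω z e ψ r ε) {q : E3 × ℝ}
    (hq : q.1 ∈ Metric.ball (0 : E3) r) :
    HasFDerivAt (straighten z e ψ) (straightenDeriv e ψ q.1) q := by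
  have h1 : HasFDerivAt ψ (fderiv ℝ ψ q.1) q.1 :=
    ((h.contDiffOn.contDiffAt (Metric.isOpen_ball.mem_nhds hq)).differentiableAt
      one_ne_zero).hasFDerivAt
  have h2 : HasFDerivAt (fun q : E3 × ℝ => (q.1, ψ q.1 + q.2)) _ q :=
    hasFDerivAt_fst.prodMk ((h1.comp q hasFDerivAt_fst).add hasFDerivAt_snd)
  exact ((frameMap e).hasFDerivAt.comp q h2).const_add z

theorem exists_straighten_mem (h : IsGraphChart Ω z e ψ r ε) (hΩ : IsOpen Ω) :
    ∃ δ > 0, ∀ q ∈ Metric.closedBall (0 : E3 × ℝ) δ, q.1 ∈ Metric.ball (0 : E3) r ∧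
      (q.2 < 0 → straighten z e ψ q ∈ Ω) ∧ (q.2 = 0 → straighten z e ψ q ∈ frontier Ω) := by
  have hψ : ContinuousAt ψ 0 :=
    h.contDiffOn.continuousOn.continuousAt (Metric.ball_mem_nhds 0 h.r_pos)
  have h1 : ∀ᶠ q in 𝓝 (0 : E3 × ℝ), q.1 ∈ Metric.ball (0 : E3) r :=
    continuous_fst.continuousAt.preimage_mem_nhds (Metric.ball_mem_nhds 0 h.r_pos)
  have h2 : ∀ᶠ q in 𝓝 (0 : E3 × ℝ), |ψ q.1 + q.2| < r := by
    have hc : ContinuousAt (fun q : E3 × ℝ => |ψ q.1 + q.2|) 0 :=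
      ((ContinuousAt.comp (f := Prod.fst) (x := (0 : E3 × ℝ)) hψ continuous_fst.continuousAt).add
        continuous_snd.continuousAt).abs
    refine hc.eventually_lt_const ?_
    simp [h.map_zero, h.r_pos]
  obtain ⟨δ, hδ, hb⟩ := Metric.nhds_basis_closedBall.eventually_iff.1 (h1.and h2)
  refine ⟨δ, hδ, fun q hq => ⟨(hb hq).1, fun hneg => ?_, fun h0 => ?_⟩⟩
  · exact (h.mem_iff q.1 (hb hq).1 _ (hb hq).2).2 (by linarith)
  · exact (h.mem_frontier_iff hΩ (hb hq).1 (hb hq).2).2 (by linarith)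

/-- A function with a gradient that extends continuously to the boundary is differentiable up to the
boundary in the straightened coordinates. -/
theorem exists_hasFDerivWithinAt_straighten (h : IsGraphChart Ω z e ψ r ε) (hΩ : IsOpen Ω)
    {v : E4 → ℝ} {G : E4 → E4} (hv : ContinuousOn v (closure Ω)) (hvd : DifferentiableOn ℝ v Ω)
    (hG : ContinuousAt G z) (hvG : EqOn G (gradient v) Ω) :
    ∃ δ > 0, (∀ q ∈ Metric.ball (0 : E3 × ℝ) δ, q.2 ≤ 0 → straighten z e ψ q ∈ closure Ω) ∧
      HasFDerivWithinAt (v ∘ straighten z e ψ) (innerSL ℝ (G z) ∘L straightenDeriv e ψ 0)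
      (Metric.ball 0 δ ∩ {q | q.2 ≤ 0}) 0 := by
  obtain ⟨δ, hδ, hb⟩ := h.exists_straighten_mem hΩ
  set s : Set (E3 × ℝ) := Metric.ball 0 δ ∩ {q | q.2 < 0} with hs
  have hso : IsOpen s := Metric.isOpen_ball.inter (isOpen_lt continuous_snd continuous_const)
  have hsc : Convex ℝ s := (convex_ball _ _).inter
    (convex_halfSpace_lt (LinearMap.snd ℝ E3 ℝ).isLinear 0)
  have hcl : closure s ⊆ Metric.closedBall 0 δ ∩ {q | q.2 ≤ 0} :=
    closure_minimal (inter_subset_inter Metric.ball_subset_closedBall fun q hq =>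
      show q.2 ≤ 0 from le_of_lt (show q.2 < 0 from hq))
      (Metric.isClosed_closedBall.inter (isClosed_le continuous_snd continuous_const))
  have hsub : Metric.ball 0 δ ∩ {q | q.2 ≤ 0} ⊆ closure s := by
    rintro ⟨y, t⟩ ⟨hq, ht⟩
    refine Metric.isOpen_ball.inter_closure ⟨hq, ?_⟩
    have hcont : Tendsto (fun a : ℝ => (y, t - a)) (𝓝[>] 0) (𝓝 (y, t)) := by
      have : Continuous fun a : ℝ => (y, t - a) := by fun_prop
      have h0 := this.tendsto 0
      simp only [sub_zero] at h0
      exact h0.mono_left nhdsWithin_le_nhds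
    refine mem_closure_of_tendsto hcont ?_
    filter_upwards [self_mem_nhdsWithin] with a ha
    have ht' : t ≤ 0 := ht
    have ha' : 0 < a := ha
    show t - a < 0
    linarith
  have hmem : ∀ q ∈ Metric.closedBall (0 : E3 × ℝ) δ, q.2 ≤ 0 →
      straighten z e ψ q ∈ closure Ω := fun q hq h0 => by
    rcases h0.lt_or_eq with h0 | h0
    · exact subset_closure ((hb q hq).2.1 h0)
    · exact frontier_subset_closure ((hb q hq).2.2 h0)
  have hcontΦ : ∀ q ∈ Metric.closedBall (0 : E3 × ℝ) δ, ContinuousAt (straighten z e ψ) q :=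
    fun q hq => (h.hasFDerivAt_straighten (hb q hq).1).continuousAt
  have hder : ∀ q ∈ s, HasFDerivAt (v ∘ straighten z e ψ)
      (innerSL ℝ (G (straighten z e ψ q)) ∘L straightenDeriv e ψ q.1) q := fun q hq => by
    have hq' := Metric.ball_subset_closedBall hq.1
    have hΩq := (hb q hq').2.1 hq.2
    have h1 : HasFDerivAt v (innerSL ℝ (G (straighten z e ψ q))) (straighten z e ψ q) := by
      have := (hvd.differentiableAt (hΩ.mem_nhds hΩq)).hasFDerivAt
      refine this.congr_fderiv ?_
      ext w
      rw [fderiv_eq_inner_gradient, ← hvG hΩq, innerSL_apply_apply]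
    exact h1.comp q (h.hasFDerivAt_straighten (hb q hq').1)
  refine ⟨δ, hδ, fun q hq h0 => hmem q (Metric.ball_subset_closedBall hq) h0,
    (hasFDerivWithinAt_closure_of_tendsto_fderiv (fun q hq =>
      (hder q hq).differentiableAt.differentiableWithinAt) hsc hso (fun q hq => ?_) ?_).mono hsub⟩
  · obtain ⟨hq1, hq2⟩ := hcl hq
    exact ((hv _ (hmem q hq1 hq2)).comp (hcontΦ q hq1).continuousWithinAt fun q' hq' =>
      subset_closure ((hb q' (Metric.ball_subset_closedBall hq'.1)).2.1 hq'.2))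
  · have hΦ0 : Tendsto (straighten z e ψ) (𝓝[s] 0) (𝓝 z) := by
      have := (hcontΦ 0 (Metric.mem_closedBall_self hδ.le)).tendsto
      rw [h.straighten_zero] at this
      exact this.mono_left nhdsWithin_le_nhds
    have hψ : Tendsto (fun q : E3 × ℝ => fderiv ℝ ψ q.1) (𝓝[s] 0) (𝓝 (fderiv ℝ ψ 0)) := by
      have h1 : ContinuousAt (fderiv ℝ ψ) (0 : E3 × ℝ).1 :=
        (h.contDiffOn.continuousOn_fderiv_of_isOpen Metric.isOpen_ball le_rfl).continuousAt
          (Metric.ball_mem_nhds 0 h.r_pos)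
      exact (ContinuousAt.comp (f := Prod.fst) (x := (0 : E3 × ℝ)) h1
        continuous_fst.continuousAt).tendsto.mono_left nhdsWithin_le_nhds
    have hcD : Continuous fun l : E3 →L[ℝ] ℝ => (frameMap e : E3 × ℝ →L[ℝ] E4) ∘L
        ((ContinuousLinearMap.fst ℝ E3 ℝ).prod
          (l ∘L ContinuousLinearMap.fst ℝ E3 ℝ + ContinuousLinearMap.snd ℝ E3 ℝ)) := by
      exact continuous_const.clm_comp ((ContinuousLinearMap.prodₗᵢ ℝ).continuous.comp
        (continuous_const.prodMk ((continuous_id.clm_comp continuous_const).add continuous_const)))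
    have hD : Tendsto (fun q : E3 × ℝ => straightenDeriv e ψ q.1) (𝓝[s] 0)
        (𝓝 (straightenDeriv e ψ 0)) := (hcD.tendsto _).comp hψ
    have hGt : Tendsto (fun q => innerSL ℝ (G (straighten z e ψ q))) (𝓝[s] 0)
        (𝓝 (innerSL ℝ (G z))) :=
      ((innerSL ℝ).continuous.tendsto _).comp (hG.tendsto.comp hΦ0)
    refine ((isBoundedBilinearMap_comp.continuous.tendsto
      (innerSL ℝ (G z), straightenDeriv e ψ 0)).comp (hGt.prodMk_nhds hD)).congr' ?_
    filter_upwards [self_mem_nhdsWithin] with q hq using (hder q hq).fderiv.symm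

/-- A function whose gradient extends continuously to the boundary is differentiable along the
boundary, with the derivative given by the extended gradient. -/
theorem hasFDerivAt_graph (h : IsGraphChart Ω z e ψ r ε) (hΩ : IsOpen Ω)
    {v : E4 → ℝ} {G : E4 → E4} (hv : ContinuousOn v (closure Ω)) (hvd : DifferentiableOn ℝ v Ω)
    (hG : ContinuousAt G z) (hvG : EqOn G (gradient v) Ω) :
    HasFDerivAt (fun y => v (z + frameMap e (y, ψ y)))
      (innerSL ℝ (G z) ∘L straightenDeriv e ψ 0 ∘L ContinuousLinearMap.inl ℝ E3 ℝ) 0 := by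
  obtain ⟨δ, hδ, -, hd⟩ := h.exists_hasFDerivWithinAt_straighten hΩ hv hvd hG hvG
  have h1 : HasFDerivWithinAt (fun y : E3 => (y, (0 : ℝ))) (ContinuousLinearMap.inl ℝ E3 ℝ)
      (Metric.ball 0 δ) 0 := (hasFDerivAt_prodMk_left (𝕜 := ℝ) (0 : E3) (0 : ℝ)).hasFDerivWithinAt
  have h2 := (HasFDerivWithinAt.comp (0 : E3) (f := fun y : E3 => (y, (0 : ℝ))) hd h1
    fun y hy => by
      rw [mem_ball_zero_iff] at hy
      refine ⟨?_, le_refl (0 : ℝ)⟩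
      rw [mem_ball_zero_iff, Prod.norm_def]
      simpa [hδ] using hy).hasFDerivAt (Metric.ball_mem_nhds 0 hδ)
  refine (h2.congr_of_eventuallyEq (Eventually.of_forall fun y => ?_)).congr_fderiv ?_
  · simp [straighten]
  · rfl

end IsGraphChart

/-! ### The Pohozaev flux through the boundary -/

theorem exists_continuous_extension {Ω : Set E4} {v w : E4 → ℝ} (hw : ContinuousOn w (closure Ω))
    (h : EqOn w v Ω) : ∃ W : E4 → ℝ, Continuous W ∧ EqOn W v Ω := by
  obtain ⟨W, hW⟩ := ContinuousMap.exists_restrict_eq (isClosed_closure (s := Ω))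
    (⟨(closure Ω).domRestrict w, hw.domRestrict⟩ : C(closure Ω, ℝ))
  refine ⟨W, W.continuous, fun x hx => ?_⟩
  rw [← h hx]
  exact DFunLike.congr_fun hW ⟨x, subset_closure hx⟩

/-- Continuous extensions of `∇u` and `D²u` to the whole space. -/
theorem exists_extension_gradient_hessian {Ω : Set E4} (hΩ : IsOpen Ω) {u : E4 → ℝ}
    (hu : IsCkUpToBoundary 2 Ω u) :
    ∃ (P : E4 → E4) (Q : E4 → Matrix (Fin 4) (Fin 4) ℝ), Continuous P ∧ Continuous Q ∧
      EqOn P (gradient u) Ω ∧ EqOn Q (hessianMatrix u) Ω := by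
  obtain ⟨hd, -, hg⟩ := hu
  have hd' : ContDiffOn ℝ 2 u Ω := hd
  obtain ⟨g1, hg1, he1⟩ := hg 1 one_le_two
  obtain ⟨g2, hg2, he2⟩ := hg 2 le_rfl
  have hP : ∀ i, ∃ W : E4 → ℝ, Continuous W ∧ EqOn W (pderiv i u) Ω := fun i => by
    refine exists_continuous_extension (w := fun x => g1 x fun _ => EuclideanSpace.single i 1)
      ?_ fun x hx => ?_
    · exact (ContinuousMultilinearMap.apply ℝ (fun _ : Fin 1 => E4) ℝ
        fun _ => EuclideanSpace.single i 1).continuous.comp_continuousOn hg1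
    · simp only [he1 hx, iteratedFDeriv_one_apply, pderiv]
  have hQ : ∀ i j, ∃ W : E4 → ℝ, Continuous W ∧ EqOn W (pderiv i (pderiv j u)) Ω := fun i j => by
    refine exists_continuous_extension
      (w := fun x => g2 x ![EuclideanSpace.single i 1, EuclideanSpace.single j 1])
      ?_ fun x hx => ?_
    · exact (ContinuousMultilinearMap.apply ℝ (fun _ : Fin 2 => E4) ℝ
        ![EuclideanSpace.single i 1, EuclideanSpace.single j 1]).continuous.comp_continuousOn hg2
    · have hdf : DifferentiableAt ℝ (fderiv ℝ u) x :=
        ((hd'.fderiv_of_isOpen hΩ (m := 1) (by norm_num)).contDiffAt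
          (hΩ.mem_nhds hx)).differentiableAt one_ne_zero
      simp only [he2 hx, iteratedFDeriv_two_apply, pderiv]
      have h1 : HasFDerivAt (fun y => fderiv ℝ u y (EuclideanSpace.single j 1))
          ((fderiv ℝ (fderiv ℝ u) x).flip (EuclideanSpace.single j 1)) x :=
        (hdf.hasFDerivAt.clm_apply (hasFDerivAt_const _ x)).congr_fderiv (by ext v; simp)
      exact (congrArg (fun l : E4 →L[ℝ] ℝ => l (EuclideanSpace.single i 1)) h1.fderiv).symm
  choose P hPc hPe using hP
  choose Q hQc hQe using hQ
  refine ⟨fun x => WithLp.toLp 2 fun i => P i x, fun x => Matrix.of fun i j => Q i j x,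
    ?_, ?_, fun x hx => ?_, fun x hx => ?_⟩
  · exact (PiLp.continuous_toLp 2 _).comp (continuous_pi hPc)
  · exact continuous_pi fun i => continuous_pi fun j => hQc i j
  · ext i
    rw [gradient_apply_eq_pderiv]
    exact hPe i hx
  · ext i j
    exact hQe i j hx

theorem gradUpToBoundary_eq {Ω : Set E4} {u : E4 → ℝ} {P : E4 → E4} (hP : Continuous P)
    (hPe : EqOn P (gradient u) Ω) {x : E4} (hx : x ∈ closure Ω) : gradUpToBoundary Ω u x = P x := by
  refine extendFrom_eq hx ((hP.continuousAt.tendsto.mono_left nhdsWithin_le_nhds).congr' ?_)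
  filter_upwards [self_mem_nhdsWithin] with y hy using hPe hy

section Boundary

variable {Ω : Set E4} {u : E4 → ℝ} {τ : ℝ} {P : E4 → E4} {Q : E4 → Matrix (Fin 4) (Fin 4) ℝ}

/-- The gradient of a function that attains its minimum on the boundary points inwards. -/
theorem eq_neg_norm_smul_outwardNormal (hΩ : IsOpen Ω) (hu : DifferentiableOn ℝ u Ω)
    (huc : ContinuousOn u (closure Ω)) (hbd : ∀ x ∈ frontier Ω, u x = τ)
    (hle : ∀ x ∈ Ω, τ < u x) (hP : Continuous P) (hPe : EqOn P (gradient u) Ω) {z : E4}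
    (hz : z ∈ regularBoundary 2 Ω) : P z = -‖P z‖ • outwardNormal Ω z := by
  obtain ⟨hzf, φ, hφ⟩ := hz
  obtain ⟨e, ψ, r, h, -⟩ := exists_isGraphChart hφ one_pos
  have hball : (0 : E3) ∈ Metric.ball (0 : E3) r := Metric.mem_ball_self h.r_pos
  have hz0 : z + frameMap e (0, ψ 0) = z := by
    have : ((0 : E3), (0 : ℝ)) = 0 := rfl
    rw [h.map_zero, this, map_zero, add_zero]
  set N := graphNormal e ψ 0 with hN
  set c : ℝ := inner ℝ (P z) (frameMap e (0, 1)) with hc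
  -- the tangential derivatives vanish
  have htan : ∀ a : E3, inner ℝ (P z) (frameMap e (a, fderiv ℝ ψ 0 a)) = 0 := by
    intro a
    have h1 := h.hasFDerivAt_graph hΩ huc hu hP.continuousAt hPe
    have h2 : (fun y => u (z + frameMap e (y, ψ y))) =ᶠ[𝓝 0] fun _ => τ := by
      filter_upwards [Metric.ball_mem_nhds 0 h.r_pos] with y hy
      exact hbd _ ((h.mem_frontier_iff hΩ hy (h.abs_lt y hy)).2 rfl)
    have h3 := (h1.congr_of_eventuallyEq h2.symm).unique (hasFDerivAt_const τ 0)
    have := congrArg (fun l : E3 →L[ℝ] ℝ => l a) h3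
    simpa [straightenDeriv_apply] using this
  have hPN : P z = c • N := by
    refine ext_inner_right ℝ fun v => ?_
    obtain ⟨⟨a, s⟩, rfl⟩ := (frameMap e).surjective v
    have h5 : frameMap e (a, s) = frameMap e (a, fderiv ℝ ψ 0 a)
        + (s - fderiv ℝ ψ 0 a) • frameMap e (0, 1) := by
      rw [← map_smul, ← map_add]; simp
    rw [inner_smul_left, hN, inner_graphNormal, h5, inner_add_right, htan, inner_smul_right, ← hc]
    simp; ring
  -- the derivative in the outward direction is not positive
  have hc0 : c ≤ 0 := by
    obtain ⟨δ, hδ, hcl, hd⟩ := h.exists_hasFDerivWithinAt_straighten hΩ huc hu hP.continuousAt hPe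
    have hmin : IsLocalMinOn (u ∘ straighten z e ψ) (Metric.ball 0 δ ∩ {q | q.2 ≤ 0}) 0 := by
      filter_upwards [self_mem_nhdsWithin] with q hq
      simp only [Function.comp, h.straighten_zero]
      rw [hbd z hzf]
      by_cases hqΩ : straighten z e ψ q ∈ Ω
      · exact (hle _ hqΩ).le
      · rw [hbd _ (by rw [hΩ.frontier_eq]; exact ⟨hcl q hq.1 hq.2, hqΩ⟩)]
    have hcone : ((0 : E3), -(δ / 2)) ∈
        posTangentConeAt (Metric.ball (0 : E3 × ℝ) δ ∩ {q | q.2 ≤ 0}) 0 := by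
      refine mem_posTangentConeAt_of_segment_subset ?_
      have hconv : Convex ℝ (Metric.ball (0 : E3 × ℝ) δ ∩ {q | q.2 ≤ 0}) :=
        (convex_ball _ _).inter (convex_halfSpace_le (LinearMap.snd ℝ E3 ℝ).isLinear 0)
      refine hconv.segment_subset ⟨Metric.mem_ball_self hδ, le_refl (0 : ℝ)⟩ ⟨?_, ?_⟩
      · rw [zero_add, mem_ball_zero_iff, Prod.norm_def]
        simp [abs_of_pos hδ, hδ]
      · show (0 : ℝ) + -(δ / 2) ≤ 0
        linarith
    have h6 := hmin.hasFDerivWithinAt_nonneg hd hcone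
    have h7 : frameMap e ((0 : E3), -(δ / 2)) = (-(δ / 2)) • frameMap e (0, 1) := by
      rw [← map_smul]; simp
    rw [ContinuousLinearMap.comp_apply, straightenDeriv_apply, map_zero, zero_add, h7,
      innerSL_apply_apply, inner_smul_right, ← hc] at h6
    nlinarith
  have hN1 := (h.norm_graphNormal_mem zero_le_one hball).1
  have hν : outwardNormal Ω z = ‖N‖⁻¹ • N := by
    have := h.outwardNormal_eq 0 hball
    rwa [hz0] at this
  have hN0 : ‖N‖ ≠ 0 := by linarith
  rw [hν, smul_smul]
  conv_rhs => rw [hPN]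
  rw [norm_smul, Real.norm_eq_abs, abs_of_nonpos hc0]
  rw [neg_mul, mul_assoc, mul_inv_cancel₀ hN0, mul_one, neg_neg]
  exact hPN

/-- Tracing `(1 - n nᵀ) Q (1 - n nᵀ)` leaves `tr Q - ⟨Q n, n⟩` for a unit vector `n`. -/
theorem sum_tangential_trace (q : Fin 4 → Fin 4 → ℝ) (n : Fin 4 → ℝ) (hn : ∑ i, n i * n i = 1) :
    ∑ i, ((∑ k, q k i * ((if k = i then 1 else 0) - n i * n k))
      - (∑ j, (∑ k, q k j * ((if k = i then 1 else 0) - n i * n k)) * n j) * n i)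
    = ∑ i, q i i - ∑ i, ∑ k, n i * q k i * n k := by
  have e1 : ∀ i j, ∑ k, q k j * ((if k = i then 1 else 0) - n i * n k)
      = q i j - n i * ∑ k, q k j * n k := fun i j => by
    simp only [mul_sub, Finset.sum_sub_distrib, mul_ite, mul_one, mul_zero, Finset.sum_ite_eq',
      Finset.mem_univ, if_true, Finset.mul_sum]
    congr 1
    exact Finset.sum_congr rfl fun k _ => by ring
  simp only [e1]
  simp only [Fin.sum_univ_four] at hn ⊢
  linear_combination ((q 0 0 * n 0 + q 1 0 * n 1 + q 2 0 * n 2 + q 3 0 * n 3) * n 0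
    + (q 0 1 * n 0 + q 1 1 * n 1 + q 2 1 * n 2 + q 3 1 * n 3) * n 1
    + (q 0 2 * n 0 + q 1 2 * n 1 + q 2 2 * n 2 + q 3 2 * n 3) * n 2
    + (q 0 3 * n 0 + q 1 3 * n 1 + q 2 3 * n 2 + q 3 3 * n 3) * n 3) * hn

/-- On the boundary `tr D²u - ⟨D²u ν, ν⟩ = H u_ν`: differentiate the proportionality of `∇u` and the
normal along the boundary. -/
theorem trace_sub_inner_eq (hΩ : IsOpen Ω) (hu : ContDiffOn ℝ 2 u Ω)
    (huc : ContinuousOn u (closure Ω)) (hbd : ∀ x ∈ frontier Ω, u x = τ)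
    (hle : ∀ x ∈ Ω, τ < u x) (hP : Continuous P) (hQ : Continuous Q) (hPe : EqOn P (gradient u) Ω)
    (hQe : EqOn Q (hessianMatrix u) Ω) {z : E4} {φ : E4 → ℝ}
    (hφ : IsLocalDefiningFunction 2 Ω z φ) :
    (Q z).trace - ∑ i, ∑ k, levelNormal φ z i * Q z k i * levelNormal φ z k
      = -‖P z‖ * divergence (levelNormal φ) z := by
  obtain ⟨e, ψ, r, h, hφ0⟩ := exists_isGraphChart hφ one_pos
  have hball : (0 : E3) ∈ Metric.ball (0 : E3) r := Metric.mem_ball_self h.r_pos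
  have hz0 : z + frameMap e (0, ψ 0) = z := by
    have : ((0 : E3), (0 : ℝ)) = 0 := rfl
    rw [h.map_zero, this, map_zero, add_zero]
  have hgrad : ∀ᶠ x in 𝓝 z, gradient φ x ≠ 0 :=
    (continuous_gradient (hφ.contDiff.of_le (by norm_cast))).continuousAt.eventually_ne
      hφ.gradient_ne_zero
  set n := levelNormal φ with hn
  have hnd : ∀ i, DifferentiableAt ℝ (fun x => n x i) z := fun i => by
    obtain ⟨U, hU, hUo, hzU⟩ := eventually_nhds_iff.1 hgrad
    exact (differentiableAt_euclidean.1 (((contDiffOn_levelNormal hφ.contDiff hU).contDiffAt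
      (hUo.mem_nhds hzU)).differentiableAt one_ne_zero)) i
  set M : Fin 4 → E4 → ℝ := fun i v => fderiv ℝ (fun x => n x i) z v with hM
  have hn1 : ∑ i, n z i * n z i = 1 := by
    rw [← inner_eq_sum, real_inner_self_eq_norm_sq, norm_levelNormal hφ.gradient_ne_zero, one_pow]
  -- the normal has unit length, so its derivatives are tangential
  have hnM : ∀ v, ∑ i, n z i * M i v = 0 := fun v => by
    have h1 : HasFDerivAt (fun x => ∑ i, n x i * n x i)
        (∑ i, (n z i • fderiv ℝ (fun x => n x i) z + n z i • fderiv ℝ (fun x => n x i) z)) z :=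
      HasFDerivAt.fun_sum fun i _ => (hnd i).hasFDerivAt.fun_mul (hnd i).hasFDerivAt
    have h2 : (fun x => ∑ i, n x i * n x i) =ᶠ[𝓝 z] fun _ => 1 := by
      filter_upwards [hgrad] with x hx
      rw [← inner_eq_sum, real_inner_self_eq_norm_sq, norm_levelNormal hx, one_pow]
    have h3 := (h1.congr_of_eventuallyEq h2.symm).unique (hasFDerivAt_const (1 : ℝ) z)
    have h4 := congrArg (fun l : E4 →L[ℝ] ℝ => l v) h3
    simp only [sum_apply, add_apply, smul_apply, smul_eq_mul,
      zero_apply] at h4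
    rw [Finset.sum_add_distrib] at h4
    simp only [hM]
    linarith
  have hνn : ∀ᶠ y in 𝓝 (0 : E3), P (z + frameMap e (y, ψ y))
      = -‖P (z + frameMap e (y, ψ y))‖ • n (z + frameMap e (y, ψ y)) := by
    have hcont : Tendsto (fun y => z + frameMap e (y, ψ y)) (𝓝 0) (𝓝 z) := by
      have := h.continuousOn_graph.continuousAt (Metric.ball_mem_nhds 0 h.r_pos)
      rw [ContinuousAt, hz0] at this
      exact this
    filter_upwards [Metric.ball_mem_nhds 0 h.r_pos,
      hcont.eventually (hφ.eventually_of_eq_zero (by norm_num))] with y hy hdef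
    have hd := hdef (hφ0 y hy)
    rw [hn, ← outwardNormal_eq_levelNormal hd]
    exact eq_neg_norm_smul_outwardNormal hΩ (hu.differentiableOn two_ne_zero) huc hbd hle hP hPe
      ⟨(h.mem_frontier_iff hΩ hy (h.abs_lt y hy)).2 rfl, φ, hd⟩
  have hPz : ∀ i, P z i = -‖P z‖ * n z i := fun i => by
    have := hνn.self_of_nhds
    rw [hz0] at this
    conv_lhs => rw [this]
    simp
  -- the gradient of the extension of `∂ᵢ u`
  have hPd : ∀ i, HasFDerivAt (fun y => P (z + frameMap e (y, ψ y)) i)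
      (innerSL ℝ (WithLp.toLp 2 fun k => Q z k i) ∘L straightenDeriv e ψ 0 ∘L
        ContinuousLinearMap.inl ℝ E3 ℝ) 0 := fun i => by
    have hcoord : Continuous fun x => P x i :=
      (EuclideanSpace.proj i : E4 →L[ℝ] ℝ).continuous.comp hP
    have heq : EqOn (fun x => P x i) (pderiv i u) Ω := fun x hx => by
      simp only [hPe hx, gradient_apply_eq_pderiv]
    refine h.hasFDerivAt_graph hΩ (v := fun x => P x i)
      (G := fun x => WithLp.toLp 2 fun k => Q x k i) hcoord.continuousOn ?_ ?_ fun x hx => ?_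
    · exact ((hu.pderiv hΩ (m := 1) (by norm_num) i).differentiableOn one_ne_zero).congr heq
    · exact ((PiLp.continuous_toLp 2 _).comp (continuous_pi fun k =>
        (continuous_apply_apply k i).comp hQ)).continuousAt
    · ext k
      rw [gradient_apply_eq_pderiv]
      have : (fun x => P x i) =ᶠ[𝓝 x] pderiv i u := by
        filter_upwards [hΩ.mem_nhds hx] with y hy using heq hy
      rw [pderiv, this.fderiv_eq]
      simp only [hQe hx]
      rfl
  have hbd0 : HasFDerivAt (fun y => z + frameMap e (y, ψ y))
      (straightenDeriv e ψ 0 ∘L ContinuousLinearMap.inl ℝ E3 ℝ) 0 := by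
    have h1 := h.hasFDerivAt_straighten (q := 0) hball
    have h2 : HasFDerivAt (fun y : E3 => (y, (0 : ℝ))) (ContinuousLinearMap.inl ℝ E3 ℝ) 0 :=
      hasFDerivAt_prodMk_left (𝕜 := ℝ) (0 : E3) (0 : ℝ)
    have h3 := HasFDerivAt.comp (0 : E3) (f := fun y : E3 => (y, (0 : ℝ))) h1 h2
    refine h3.congr_of_eventuallyEq (Eventually.of_forall fun y => ?_)
    simp [straighten]
  have hnd' : ∀ i, HasFDerivAt (fun y => n (z + frameMap e (y, ψ y)) i)
      (fderiv ℝ (fun x => n x i) z ∘L straightenDeriv e ψ 0 ∘L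
        ContinuousLinearMap.inl ℝ E3 ℝ) 0 := fun i => by
    have h1 : HasFDerivAt (fun x => n x i) (fderiv ℝ (fun x => n x i) z)
        (z + frameMap e (0, ψ 0)) := by rw [hz0]; exact (hnd i).hasFDerivAt
    exact h1.comp (0 : E3) hbd0
  -- differentiate `Pᵢ nⱼ = Pⱼ nᵢ` in a tangential direction
  have htan : ∀ (a : E3) (i j : Fin 4),
      (∑ k, Q z k i * frameMap e (a, fderiv ℝ ψ 0 a) k) * n z j
        + P z i * M j (frameMap e (a, fderiv ℝ ψ 0 a))
      = (∑ k, Q z k j * frameMap e (a, fderiv ℝ ψ 0 a) k) * n z i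
        + P z j * M i (frameMap e (a, fderiv ℝ ψ 0 a)) := by
    intro a i j
    have h1 := (hPd i).fun_mul (hnd' j)
    have h2 := (hPd j).fun_mul (hnd' i)
    have h3 : (fun y => P (z + frameMap e (y, ψ y)) i * n (z + frameMap e (y, ψ y)) j)
        =ᶠ[𝓝 0] fun y => P (z + frameMap e (y, ψ y)) j * n (z + frameMap e (y, ψ y)) i := by
      filter_upwards [hνn] with y hy
      rw [hy]
      simp only [PiLp.smul_apply, smul_eq_mul]
      ring
    have h4 := h1.unique (h2.congr_of_eventuallyEq h3)
    have h5 := congrArg (fun l : E3 →L[ℝ] ℝ => l a) h4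
    simp only [add_apply, smul_apply, smul_eq_mul,
      ContinuousLinearMap.comp_apply, ContinuousLinearMap.inl_apply, straightenDeriv_apply,
      add_zero, innerSL_apply_apply, hz0] at h5
    rw [inner_eq_sum, inner_eq_sum] at h5
    simp only [hM]
    linarith
  -- the tangential directions are those orthogonal to the normal
  have hdir : ∀ w : E4, ∑ k, n z k * w k = 0 → ∀ i j,
      (∑ k, Q z k i * w k) * n z j + P z i * M j w
        = (∑ k, Q z k j * w k) * n z i + P z j * M i w := by
    intro w hw
    obtain ⟨⟨a, s⟩, rfl⟩ := (frameMap e).surjective w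
    have h1 : inner ℝ (graphNormal e ψ 0) (frameMap e (a, s)) = 0 := by
      have hν := h.outwardNormal_eq 0 hball
      rw [hz0, outwardNormal_eq_levelNormal hφ] at hν
      rw [← inner_eq_sum, hn, hν, inner_smul_left] at hw
      have hN1 := (h.norm_graphNormal_mem zero_le_one hball).1
      refine (mul_eq_zero.1 hw).resolve_left ?_
      simp only [conj_trivial]
      exact inv_ne_zero (by linarith)
    rw [inner_graphNormal, sub_eq_zero] at h1
    simp only at h1
    rw [h1]
    exact htan a
  have hkey : ∀ w : E4, ∑ k, n z k * w k = 0 → ∀ i,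
      (∑ k, Q z k i * w k) - (∑ j, (∑ k, Q z k j * w k) * n z j) * n z i = -‖P z‖ * M i w := by
    intro w hw i
    have h1 : ∑ j, ((∑ k, Q z k i * w k) * n z j + P z i * M j w) * n z j
        = ∑ j, ((∑ k, Q z k j * w k) * n z i + P z j * M i w) * n z j :=
      Finset.sum_congr rfl fun j _ => by rw [hdir w hw i j]
    have e1 : ∑ j, ((∑ k, Q z k i * w k) * n z j + P z i * M j w) * n z j
        = (∑ k, Q z k i * w k) * (∑ j, n z j * n z j) + P z i * ∑ j, n z j * M j w := by
      rw [Finset.mul_sum, Finset.mul_sum, ← Finset.sum_add_distrib]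
      exact Finset.sum_congr rfl fun j _ => by ring
    have e2 : ∑ j, ((∑ k, Q z k j * w k) * n z i + P z j * M i w) * n z j
        = (∑ j, (∑ k, Q z k j * w k) * n z j) * n z i + -‖P z‖ * M i w * (∑ j, n z j * n z j) := by
      rw [Finset.sum_mul, Finset.mul_sum, ← Finset.sum_add_distrib]
      exact Finset.sum_congr rfl fun j _ => by rw [hPz]; ring
    rw [e1, e2, hn1, hnM] at h1
    linarith
  -- take the trace over `w = eᵢ - nᵢ n`
  have hw : ∀ i, (∑ k, Q z k i * ((if k = i then 1 else 0) - n z i * n z k))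
      - (∑ j, (∑ k, Q z k j * ((if k = i then 1 else 0) - n z i * n z k)) * n z j) * n z i
      = -‖P z‖ * (M i (EuclideanSpace.single i 1) - n z i * M i (n z)) := by
    intro i
    have := hkey (EuclideanSpace.single i 1 - n z i • n z) (by
      simp only [PiLp.sub_apply, PiLp.smul_apply, smul_eq_mul, mul_sub, Finset.sum_sub_distrib]
      have : ∑ k, n z k * (n z i * n z k) = n z i * ∑ k, n z k * n z k := by
        rw [Finset.mul_sum]; exact Finset.sum_congr rfl fun k _ => by ring
      rw [this, hn1]
      simp) i
    simp only [PiLp.sub_apply, PiLp.smul_apply, smul_eq_mul, PiLp.single_apply] at this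
    rw [this]
    simp only [hM, map_sub, map_smul, smul_eq_mul]
  have hsum := Finset.sum_congr (s₁ := (Finset.univ : Finset (Fin 4))) rfl fun i _ => hw i
  rw [← Finset.mul_sum, Finset.sum_sub_distrib (fun i => M i (EuclideanSpace.single i 1)), hnM,
    sub_zero] at hsum
  have hdiv : divergence n z = ∑ i, M i (EuclideanSpace.single i 1) := rfl
  rw [hdiv, ← hsum]
  exact (sum_tangential_trace (Q z) (n z) hn1).symm

end Boundary

/-! ### The boundary integrand -/

theorem matVec_smul (Q : Matrix (Fin 4) (Fin 4) ℝ) (c : ℝ) (v : E4) :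
    matVec Q (c • v) = c • matVec Q v := by
  ext i
  simp only [matVec_apply, PiLp.smul_apply, smul_eq_mul, Finset.mul_sum]
  exact Finset.sum_congr rfl fun j _ => by ring

theorem inner_matVec_comm {Q : Matrix (Fin 4) (Fin 4) ℝ} (hQ : Q.IsSymm) (v w : E4) :
    inner ℝ v (matVec Q w) = inner ℝ w (matVec Q v) := by
  simp only [inner_eq_sum, matVec_apply, Finset.mul_sum]
  rw [Finset.sum_comm]
  refine Finset.sum_congr rfl fun i _ => Finset.sum_congr rfl fun j _ => ?_
  rw [hQ.apply j i]
  ring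

/-- If `p` is normal, the second derivatives enter the normal component of the flux through
`tr Q - ⟨Q ν, ν⟩` only. -/
theorem inner_pohozaevFlux (ρ c : ℝ) {x p n : E4} {Q : Matrix (Fin 4) (Fin 4) ℝ} (hQ : Q.IsSymm)
    (hn : ‖n‖ = 1) (hp : p = c • n) :
    inner ℝ n (pohozaevFlux ρ x p Q)
      = 2 / 3 * c ^ 2 * (Q.trace - inner ℝ n (matVec Q n)) * inner ℝ x n
        + 3 / 4 * ρ * c ^ 4 * inner ℝ x n := by
  have hnn : inner ℝ n n = (1 : ℝ) := by rw [real_inner_self_eq_norm_sq, hn, one_pow]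
  have hpn : ‖p‖ ^ 2 = c ^ 2 := by
    rw [hp, norm_smul, hn, mul_one, Real.norm_eq_abs, sq_abs]
  rw [pohozaevFlux, hpn, hp, matVec_smul]
  simp only [inner_add_right, inner_sub_right, inner_smul_right, inner_smul_left, hnn,
    conj_trivial, inner_matVec_comm hQ n x, real_inner_comm x n]
  ring

section Assembly

variable {Ω : Set E4} {u : E4 → ℝ} {ρ τ : ℝ} {P : E4 → E4} {Q : E4 → Matrix (Fin 4) (Fin 4) ℝ}

theorem continuous_matVec (hP : Continuous P) (hQ : Continuous Q) :
    Continuous fun x => matVec (Q x) (P x) := by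
  refine (PiLp.continuous_toLp 2 _).comp (hQ.matrix_mulVec ?_)
  exact (PiLp.continuous_ofLp 2 _).comp hP

theorem continuous_pohozaevFlux (ρ : ℝ) (hP : Continuous P) (hQ : Continuous Q) :
    Continuous fun x => pohozaevFlux ρ x (P x) (Q x) := by
  have h1 := continuous_matVec hP hQ
  have h2 := continuous_matVec continuous_id hQ
  have h3 : Continuous fun x => (Q x).trace := hQ.matrix_trace
  simp only [id] at h2
  unfold pohozaevFlux
  fun_prop

theorem isSymm_extension (hΩ : IsOpen Ω) (hu : ContDiffOn ℝ 2 u Ω) (hQ : Continuous Q)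
    (hQe : EqOn Q (hessianMatrix u) Ω) {x : E4} (hx : x ∈ closure Ω) : (Q x).IsSymm := by
  have h1 : EqOn (fun x => (Q x).transpose) Q Ω := fun x hx => by
    simp only [hQe hx]
    ext i j
    exact pderiv_comm hΩ hu hx j i
  exact h1.closure hQ.matrix_transpose hQ hx

/-- `σ₂(A(ρ,u))` as a polynomial in `p = ∇u` and `Q = D²u`. -/
noncomputable def sigmaTwoPolynomial (ρ : ℝ) (p : E4) (Q : Matrix (Fin 4) (Fin 4) ℝ) : ℝ :=
  (Q.trace ^ 2 - ∑ i, ∑ j, Q i j ^ 2) / 2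
    + ρ * ((∑ k, p k ^ 2) * Q.trace / 2 + ∑ i, ∑ j, p i * Q i j * p j)

theorem sigma_two_tensorA (hΩ : IsOpen Ω) (hu : ContDiffOn ℝ 2 u Ω) (ρ : ℝ) {x : E4} (hx : x ∈ Ω) :
    sigma 2 (tensorA ρ u x) = sigmaTwoPolynomial ρ (gradient u x) (hessianMatrix u x) := by
  have hs : (hessianMatrix u x).IsSymm := by
    ext i j
    exact pderiv_comm hΩ hu hx j i
  refine sigma_two_expand ρ hs fun i j => ?_
  simp only [tensorA_apply, gradient_apply_eq_pderiv]

theorem continuous_sigmaTwoPolynomial (ρ : ℝ) (hP : Continuous P) (hQ : Continuous Q) :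
    Continuous fun x => sigmaTwoPolynomial ρ (P x) (Q x) := by
  have h3 : Continuous fun x => (Q x).trace := hQ.matrix_trace
  have h4 : ∀ i j, Continuous fun x => Q x i j := fun i j => hQ.matrix_elem i j
  have h5 : ∀ i, Continuous fun x => P x i := fun i =>
    (EuclideanSpace.proj i : E4 →L[ℝ] ℝ).continuous.comp hP
  unfold sigmaTwoPolynomial
  fun_prop

/-- The boundary integrand is minus the normal component of the Pohozaev flux. -/
theorem boundary_integrand_eq (hΩ : IsOpen Ω) (hu : ContDiffOn ℝ 2 u Ω)
    (huc : ContinuousOn u (closure Ω)) (hbd : ∀ x ∈ frontier Ω, u x = τ)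
    (hle : ∀ x ∈ Ω, τ < u x) (hP : Continuous P) (hQ : Continuous Q) (hPe : EqOn P (gradient u) Ω)
    (hQe : EqOn Q (hessianMatrix u) Ω) (ρ : ℝ) {x : E4} (hx : x ∈ regularBoundary 2 Ω) :
    -(3 / 4) * ρ * ‖gradUpToBoundary Ω u x‖ ^ 4 * inner ℝ x (outwardNormal Ω x)
        + 2 / 3 * meanCurvature Ω x * ‖gradUpToBoundary Ω u x‖ ^ 3 * inner ℝ x (outwardNormal Ω x)
      = -inner ℝ (outwardNormal Ω x) (pohozaevFlux ρ x (P x) (Q x)) := by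
  have hcl : x ∈ closure Ω := frontier_subset_closure hx.1
  obtain ⟨-, hex⟩ := id hx
  have hφ := hex.choose_spec
  have hH : meanCurvature Ω x = divergence (levelNormal hex.choose) x := by
    rw [meanCurvature, dif_pos hex]
  have hν : outwardNormal Ω x = levelNormal hex.choose x := outwardNormal_eq_levelNormal hφ
  have htr := trace_sub_inner_eq hΩ hu huc hbd hle hP hQ hPe hQe hφ
  have hsymm := isSymm_extension hΩ hu hQ hQe hcl
  have hform : inner ℝ (outwardNormal Ω x) (matVec (Q x) (outwardNormal Ω x))
      = ∑ i, ∑ k, levelNormal hex.choose x i * Q x k i * levelNormal hex.choose x k := by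
    rw [hν, inner_eq_sum]
    refine Finset.sum_congr rfl fun i _ => ?_
    rw [matVec_apply, Finset.mul_sum]
    refine Finset.sum_congr rfl fun k _ => ?_
    rw [hsymm.apply i k]
    ring
  rw [inner_pohozaevFlux ρ (-‖P x‖) hsymm (norm_outwardNormal hx)
    (eq_neg_norm_smul_outwardNormal hΩ (hu.differentiableOn two_ne_zero) huc hbd hle hP hPe hx),
    hform, htr, gradUpToBoundary_eq hP hPe hcl, hH]
  ring

end Assembly

theorem mainTheorem5 (Ω : Set E4) (hΩ : IsOpen Ω) (hΩb : Bornology.IsBounded Ω)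
    (ρ τ : ℝ) (u K : E4 → ℝ) (f F : ℝ → ℝ)
    (hK : ContDiffOn ℝ 1 K Ω)
    (hF : ∀ t ∈ u '' closure Ω, HasDerivWithinAt F (f t) (u '' closure Ω) t)
    (hFτ : F τ = 0)
    (hKF : IntegrableOn
      (fun x => 8 * (K x + 1 / 4 * inner ℝ x (gradient K x)) * F (u x)) Ω volume)
    (hreg :
      (HasFinitePerimeter Ω ∧ HasAlmostC2Boundary Ω ∧
        ContDiffOn ℝ 3 u Ω ∧ IsCkUpToBoundary 2 Ω u) ∨
      (HasSmoothBoundary Ω ∧ IsCkUpToBoundary 2 Ω u))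
    (heq : ∀ x ∈ Ω, sigma 2 (tensorA ρ u x) = K x * f (u x))
    (hcone : ∀ x ∈ Ω, tensorA ρ u x ∈ GammaTwoPos)
    (hbd : ∀ x ∈ frontier Ω, u x = τ) :
    IntegrableOn
      (fun x =>
        -(3 / 4) * ρ * ‖gradUpToBoundary Ω u x‖ ^ 4 * inner ℝ x (outwardNormal Ω x)
          + 2 / 3 * meanCurvature Ω x * ‖gradUpToBoundary Ω u x‖ ^ 3
            * inner ℝ x (outwardNormal Ω x))
      (frontier Ω) μHE[3] ∧
    ∫ x in Ω, 8 * (K x + 1 / 4 * inner ℝ x (gradient K x)) * F (u x) =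
      ∫ x in frontier Ω,
        (-(3 / 4) * ρ * ‖gradUpToBoundary Ω u x‖ ^ 4 * inner ℝ x (outwardNormal Ω x)
          + 2 / 3 * meanCurvature Ω x * ‖gradUpToBoundary Ω u x‖ ^ 3
            * inner ℝ x (outwardNormal Ω x)) ∂μHE[3] := by
  have huC : IsCkUpToBoundary 2 Ω u := by
    rcases hreg with ⟨-, -, -, h⟩ | ⟨-, h⟩ <;> exact h
  have hu : ContDiffOn ℝ 2 u Ω := huC.1
  have huc : ContinuousOn u (closure Ω) := huC.2.1
  have hbdry : HasAlmostC2Boundary Ω ∧ (μHE[3] : Measure E4) (regularBoundary 2 Ω) < ⊤ := by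
    rcases hreg with ⟨hper, hC2, -, -⟩ | ⟨hsm, -⟩
    · exact ⟨hC2, measure_regularBoundary_lt_top hΩ hΩb hper⟩
    · have hsub : frontier Ω ⊆ regularBoundary 2 Ω := fun x hx => by
        obtain ⟨hxf, φ, hφ⟩ := hsm hx
        exact ⟨hxf, φ, hφ.of_le le_top⟩
      have hcomp : IsCompact (frontier Ω) :=
        hΩb.isCompact_closure.of_isClosed_subset isClosed_frontier frontier_subset_closure
      refine ⟨?_, (measure_mono fun x hx => hx.1).trans_lt
        (euclideanHausdorffMeasure_lt_top_of_isCompact hΩ hcomp hsub)⟩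
      rw [HasAlmostC2Boundary, sdiff_eq_empty.2 hsub, measure_empty]
  obtain ⟨hS, hfin⟩ := hbdry
  have hle : ∀ x ∈ Ω, τ < u x := fun x hx =>
    lt_of_sigma_one_pos hΩ hΩb hu huc (fun y hy => ⟨(hcone y hy).1, (hcone y hy).2.1⟩) hbd hx
  obtain ⟨P, Q, hP, hQ, hPe, hQe⟩ := exists_extension_gradient_hessian hΩ huC
  have hσe : EqOn (fun x => sigma 2 (tensorA ρ u x)) (fun x => sigmaTwoPolynomial ρ (P x) (Q x))
      Ω := fun x hx => by
    simp only [sigma_two_tensorA hΩ hu ρ hx, hPe hx, hQe hx]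
  have hσc := continuous_sigmaTwoPolynomial ρ hP hQ
  have hg : IntegrableOn (fun x => 2 * sigma 2 (tensorA ρ u x) * inner ℝ x (gradient u x)) Ω := by
    have hc : Continuous fun x => 2 * sigmaTwoPolynomial ρ (P x) (Q x) * inner ℝ x (P x) :=
      (continuous_const.mul hσc).mul (continuous_id.inner hP)
    refine ((hc.continuousOn.integrableOn_compact hΩb.isCompact_closure).mono_set
      subset_closure).congr_fun (fun x hx => ?_) hΩ.measurableSet
    have := hσe hx
    simp only at this ⊢
    rw [this, hPe hx]
  have hW : IsWeakDiv Ω (fun x => pohozaevFlux ρ x (P x) (Q x))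
      (fun x => 2 * sigma 2 (tensorA ρ u x) * inner ℝ x (gradient u x)) :=
    (isWeakDiv_pohozaevFlux hΩ ρ hu).congr (fun x hx => by simp only [hPe hx, hQe hx])
      fun x _ => rfl
  obtain ⟨hI, hE⟩ := integral_eq_integral_frontier_inner hΩ hΩb hS hfin
    (continuous_pohozaevFlux ρ hP hQ) hW hg
  have hae := (ae_frontier_mem_regularBoundary hS).mono fun x hx =>
    (boundary_integrand_eq hΩ hu huc hbd hle hP hQ hPe hQe ρ hx).symm
  refine ⟨Integrable.congr hI.neg hae, ?_⟩
  rw [integral_curvature_eq_neg_integral_sigma_two hΩ hΩb hu huc hK hF hFτ hKF heq hcone hbd hg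
    (hσc.continuousOn.congr hσe), hE, ← integral_neg]
  exact integral_congr_ae hae
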